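/- **Model.** Let $\mathcal C$, $\mathcal S$ be finite sets of customer types and server types, and let $\mathcal E\subset\mathcal C\times\mathcal S$ be a compatibility relation whose bipartite graph on $\mathcal C\sqcup\mathcal S$ is connected. Let $\alpha$, $\beta$ be probability distributions on $\mathcal C$, $\mathcal S$ with $\alpha_i>0$, $\beta_j>0$ for all $i,j$. *Complete resource pooling* is assumed: for every $C\subset\mathcal C$ with $C\neq\emptyset,\mathcal C$, $$\sum_{i\in C}\alpha_i<\sum_{j\in\mathcal S(C)}\beta_j,\qquad \mathcal S(C)=\{j:\exists i\in C,\ (i,j)\in\mathcal E\}.$$ Let $(c^m)_{m\in\mathbb Z}$ be i.i.d. with law $\alpha$ and $(s^n)_{n\in\mathbb Z}$ i.i.d. with law $\beta$, the two sequences being independent, on a probability space $(\Omega,P)$. **FCFS matchings.** For $T\subset\mathbb Z$, a *matching* of $(c^m)_{m\in T}$, $(s^n)_{n\in T}$ is a set $A\subset T\times T$ such that $(c^m,s^n)\in\mathcal E$ for all $(m,n)\in A$, each $m$ and each $n$ occurs in at most one pair of $A$, and no compatible $c^m,s^n$ ($m,n\in T$) are both left unmatched. It is *FCFS* if for every $(m,n)\in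 A$: whenever $l<n$, $l\in T$ and $(c^m,s^l)\in\mathcal E$, there is $k<m$ with $(k,l)\in A$; and whenever $k<m$, $k\in T$ and $(c^k,s^n)\in\mathcal E$, there is $l<n$ with $(k,l)\in A$. It is *perfect* if every customer and every server at a position in $T$ is matched. For $A\subset\mathbb Z\times\mathbb Z$ and $N\in\mathbb Z$ let $U_N(A)$ (resp. $V_N(A)$) be the set of positions $m\le N$ of customers (resp. $n\le N$ of servers) that $A$ does not match with a server (resp. customer) at a position $\le N$. Call $A$ *balanced recurrent* if there is $B<\infty$ such that $|U_N(A)|=|V_N(A)|\le B$ for arbitrarily large negative $N$. **Pair-by-pair chain.** Its states are the pairs $(u,v)$ of finite lists, $u$ in $\mathcal C$ and $v$ in $\mathcal S$, of equal length and with no compatible pair between them. From $(u,v)$ a new pair $(i,j)$ leads to $\mathrm{step}((u,v),i,j)$: $i$ is matched with the first compatible server in $v$, $j$ with the first compatible customer in $u$; if neither finds a match and $(i,j)\in\mathcal E$, they are matched with each other; matched items are removed and an unmatched newcomer is appended at the end of its list. The chain's transition law uses independent $i\sim\alpha$, $j\sim\beta$. A *stationary version* driven by the two sequences, with stationary law $\pi$,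 is a family of random states $(O_N)_{N\in\mathbb Z}$ on $\Omega$ such that, for each $N$, $O_N$ has law $\pi$ and is independent of $(c^k,s^k)_{k>N}$, and almost surely $O_{N+1}=\mathrm{step}(O_N,c^{N+1},s^{N+1})$ for all $N$. **Theorem.** There is a random set $A\subset\mathbb Z\times\mathbb Z$ (each event $\{(m,n)\in A\}$ is measurable) such that: 1. Almost surely, $A$ is a perfect, balanced recurrent FCFS matching of $(c^m)_{m\in\mathbb Z}$, $(s^n)_{n\in\mathbb Z}$, and it is the only FCFS matching of these sequences over $\mathbb Z$ that is balanced recurrent. 2. (Loynes' scheme) Almost surely, for each $K\in\mathbb N$ there is a unique FCFS matching $L_K$ of $(c^m)_{m>-K}$, $(s^n)_{n>-K}$, it is perfect, and $L_K\to A$ as $K\to\infty$: for every $N\in\mathbb Z$ there is $K_0$ such that for all $K\ge K_0$ and all $(m,n)$ with $m>N$ or $n>N$, $(m,n)\in L_K\iff(m,n)\in A$. 3. The pair-by-pair chain has a unique stationary distribution $\pi$; a stationary version driven by the two sequences exists on $\Omega$; and for every such stationary version $(O_N)$, almost surely for all $N\in\mathbb Z$ the sets $U_N(A)$, $V_N(A)$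 are finite and $O_N$ consists of the types of the customers in $U_N(A)$ and of the servers in $V_N(A)$, in the order of their positions. -/

import Mathlib

open MeasureTheory ProbabilityTheory Filter

namespace BipartiteFCFS

variable {𝒞 𝒮 : Type*}

/-! ## The model -/

/-- The bipartite graph on the disjoint union of customer types and server types whose edges are
the compatible pairs. -/
def compatGraph (E : 𝒞 → 𝒮 → Prop) : SimpleGraph (𝒞 ⊕ 𝒮) where
  Adj x y :=
    (∃ i j, x = Sum.inl i ∧ y = Sum.inr j ∧ E i j) ∨
    (∃ i j, y = Sum.inl i ∧ x = Sum.inr j ∧ E i j)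
  symm := ⟨fun _ _ h => h.symm⟩
  loopless := ⟨by
    rintro x (⟨i, j, h, h', -⟩ | ⟨i, j, h, h', -⟩) <;> simp [h] at h'⟩

open Classical in
/-- The set `𝒮(C)` of server types compatible with at least one customer type in `C`. -/
noncomputable def compatServers [Fintype 𝒮] (E : 𝒞 → 𝒮 → Prop) (C : Finset 𝒞) : Finset 𝒮 :=
  Finset.univ.filter fun j => ∃ i ∈ C, E i j

/-- Complete resource pooling: `α_C < β_{𝒮(C)}` for every nonempty proper set `C` of customer
types. -/
def CompleteResourcePooling [Fintype 𝒞] [Fintype 𝒮] (E : 𝒞 → 𝒮 → Prop)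
    (α : PMF 𝒞) (β : PMF 𝒮) : Prop :=
  ∀ C : Finset 𝒞, C ≠ ∅ → C ≠ Finset.univ → ∑ i ∈ C, α i < ∑ j ∈ compatServers E C, β j

/-! ## FCFS matchings -/

/-- `A` is a partial matching of the customers `(c m)`, `m ∈ T₁`, with the servers `(s n)`,
`n ∈ T₂`. -/
structure IsPartialMatching (E : 𝒞 → 𝒮 → Prop) (c : ℤ → 𝒞) (s : ℤ → 𝒮) (T₁ T₂ : Set ℤ)
    (A : Set (ℤ × ℤ)) : Prop where
  subset : A ⊆ T₁ ×ˢ T₂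
  compatible : ∀ m n, (m, n) ∈ A → E (c m) (s n)
  server_unique : ∀ m n n', (m, n) ∈ A → (m, n') ∈ A → n = n'
  customer_unique : ∀ m m' n, (m, n) ∈ A → (m', n) ∈ A → m = m'

/-- `A` is a (complete) matching: no two compatible items are both left unmatched. -/
structure IsMatching (E : 𝒞 → 𝒮 → Prop) (c : ℤ → 𝒞) (s : ℤ → 𝒮) (T₁ T₂ : Set ℤ)
    (A : Set (ℤ × ℤ)) : Prop extends IsPartialMatching E c s T₁ T₂ A where
  complete : ∀ m ∈ T₁, ∀ n ∈ T₂, (∀ n', (m, n') ∉ A) → (∀ m', (m', n) ∉ A) → ¬ E (c m) (s n)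

/-- `A` is a first come first served (complete) matching. -/
structure IsFCFSMatching (E : 𝒞 → 𝒮 → Prop) (c : ℤ → 𝒞) (s : ℤ → 𝒮) (T₁ T₂ : Set ℤ)
    (A : Set (ℤ × ℤ)) : Prop extends IsMatching E c s T₁ T₂ A where
  fcfs_server : ∀ m n, (m, n) ∈ A → ∀ l ∈ T₂, l < n → E (c m) (s l) → ∃ k < m, (k, l) ∈ A
  fcfs_customer : ∀ m n, (m, n) ∈ A → ∀ k ∈ T₁, k < m → E (c k) (s n) → ∃ l < n, (k, l) ∈ A

/-- Every customer and every server with position in `T` is matched by `A`. -/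
def IsPerfect (T : Set ℤ) (A : Set (ℤ × ℤ)) : Prop :=
  (∀ m ∈ T, ∃ n, (m, n) ∈ A) ∧ (∀ n ∈ T, ∃ m, (m, n) ∈ A)

/-- Positions `≤ N` of the customers that are not matched to a server at a position `≤ N`. -/
def unmatchedCustomers (A : Set (ℤ × ℤ)) (N : ℤ) : Set ℤ :=
  {m | m ≤ N ∧ ∀ n ≤ N, (m, n) ∉ A}

/-- Positions `≤ N` of the servers that are not matched to a customer at a position `≤ N`. -/
def unmatchedServers (A : Set (ℤ × ℤ)) (N : ℤ) : Set ℤ :=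
  {n | n ≤ N ∧ ∀ m ≤ N, (m, n) ∉ A}

/-- The queues left by `A` up to time `N` are balanced (as many customers as servers) and stay
below some fixed finite bound for arbitrarily early times `N`. -/
def IsBalancedRecurrent (A : Set (ℤ × ℤ)) : Prop :=
  ∃ B : ℕ, ∃ᶠ N : ℤ in atBot,
    (unmatchedCustomers A N).encard = (unmatchedServers A N).encard ∧
    (unmatchedCustomers A N).encard ≤ B

/-! ## The pair by pair Markov chain -/

/-- A state of the pair by pair chain: the ordered lists of the (types of the) unmatched customers
and of the unmatched servers, equally many and pairwise incompatible. -/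
@[ext]
structure PairState (E : 𝒞 → 𝒮 → Prop) where
  customers : List 𝒞
  servers : List 𝒮
  length_eq : customers.length = servers.length
  incompatible : ∀ x ∈ customers, ∀ y ∈ servers, ¬ E x y

/-- The state space is countable and carries the discrete σ-algebra. -/
instance (E : 𝒞 → 𝒮 → Prop) : MeasurableSpace (PairState E) := ⊤

open Classical in
/-- One step of pair by pair matching. The new customer `i` takes the earliest compatible waiting
server, the new server `j` takes the earliest compatible waiting customer; if neither finds one
and they are compatible, they are matched to each other; whoever remains unmatched joins the end
of its list. -/
noncomputable def PairState.step {E : 𝒞 → 𝒮 → Prop} (z : PairState E) (i : 𝒞) (j : 𝒮) :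
    PairState E where
  customers := z.customers.eraseP (fun x => decide (E x j)) ++
    if (∃ y ∈ z.servers, E i y) ∨ (E i j ∧ ∀ x ∈ z.customers, ¬ E x j) then [] else [i]
  servers := z.servers.eraseP (fun y => decide (E i y)) ++
    if (∃ x ∈ z.customers, E x j) ∨ (E i j ∧ ∀ y ∈ z.servers, ¬ E i y) then [] else [j]
  length_eq := by
    have hl := z.length_eq
    by_cases hy : ∃ y ∈ z.servers, E i y
    · obtain ⟨y, hy1, hy2⟩ := hy
      have h1 := List.length_eraseP_of_mem (p := fun y => decide (E i y)) hy1 (by simpa using hy2)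
      have hpos := List.length_pos_of_mem hy1
      by_cases hx : ∃ x ∈ z.customers, E x j
      · obtain ⟨x, hx1, hx2⟩ := hx
        have h2 := List.length_eraseP_of_mem (p := fun x => decide (E x j)) hx1
          (by simpa using hx2)
        rw [if_pos (Or.inl ⟨y, hy1, hy2⟩), if_pos (Or.inl ⟨x, hx1, hx2⟩)]
        simp [h1, h2, hl]
      · have hx' : ∀ x ∈ z.customers, ¬ E x j := fun x h h' => hx ⟨x, h, h'⟩
        rw [if_pos (Or.inl ⟨y, hy1, hy2⟩), if_neg (by
          rintro (h | ⟨_, h⟩)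
          · exact hx h
          · exact h y hy1 hy2), List.eraseP_of_forall_not (by simpa using hx')]
        simp [h1]
        omega
    · have hy' : ∀ y ∈ z.servers, ¬ E i y := fun y h h' => hy ⟨y, h, h'⟩
      rw [List.eraseP_of_forall_not (p := fun y => decide (E i y)) (by simpa using hy')]
      by_cases hx : ∃ x ∈ z.customers, E x j
      · obtain ⟨x, hx1, hx2⟩ := hx
        have h2 := List.length_eraseP_of_mem (p := fun x => decide (E x j)) hx1
          (by simpa using hx2)
        have hpos := List.length_pos_of_mem hx1
        have h3 : ¬ ((∃ y ∈ z.servers, E i y) ∨ (E i j ∧ ∀ x ∈ z.customers, ¬ E x j)) := by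
          rintro (h | ⟨_, h⟩)
          · exact hy h
          · exact h x hx1 hx2
        have h4 : (∃ x ∈ z.customers, E x j) ∨ (E i j ∧ ∀ y ∈ z.servers, ¬ E i y) :=
          Or.inl ⟨x, hx1, hx2⟩
        rw [if_neg h3, if_pos h4, List.length_append, h2, List.append_nil, ← hl,
          List.length_singleton]
        omega
      · have hx' : ∀ x ∈ z.customers, ¬ E x j := fun x h h' => hx ⟨x, h, h'⟩
        rw [List.eraseP_of_forall_not (by simpa using hx')]
        by_cases hE : E i j
        · rw [if_pos (Or.inr ⟨hE, hx'⟩), if_pos (Or.inr ⟨hE, hy'⟩)]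
          simp [hl]
        · rw [if_neg (by rintro (h | ⟨h, _⟩); exacts [hy h, hE h]),
            if_neg (by rintro (h | ⟨h, _⟩); exacts [hx h, hE h])]
          simp [hl]
  incompatible := by
    intro x hx y hy
    rw [List.mem_append] at hx hy
    rcases hx with hx | hx <;> rcases hy with hy | hy
    · exact z.incompatible x (List.mem_of_mem_eraseP hx) y (List.mem_of_mem_eraseP hy)
    · split_ifs at hy with h
      · simp at hy
      · obtain rfl : y = j := by simpa using hy
        exact fun hE => h (Or.inl ⟨x, List.mem_of_mem_eraseP hx, hE⟩)
    · split_ifs at hx with h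
      · simp at hx
      · obtain rfl : x = i := by simpa using hx
        exact fun hE => h (Or.inl ⟨y, List.mem_of_mem_eraseP hy, hE⟩)
    · split_ifs at hx with h
      · simp at hx
      split_ifs at hy with h'
      · simp at hy
      obtain rfl : x = i := by simpa using hx
      obtain rfl : y = j := by simpa using hy
      exact fun hE => h (Or.inr ⟨hE, fun x' hx' hE' => h' (Or.inl ⟨x', hx', hE'⟩)⟩)

/-- Transition law of the pair by pair chain from the state `z`: the types of the new customer and
of the new server are drawn independently from `α` and `β`. -/
noncomputable def pairTransition (E : 𝒞 → 𝒮 → Prop) (α : PMF 𝒞) (β : PMF 𝒮) (z : PairState E) :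
    PMF (PairState E) :=
  α.bind fun i => β.map fun j => z.step i j

/-- `π` is a stationary distribution of the pair by pair chain. -/
def IsStationaryLaw (E : 𝒞 → 𝒮 → Prop) (α : PMF 𝒞) (β : PMF 𝒮) (π : PMF (PairState E)) : Prop :=
  π.bind (pairTransition E α β) = π

/-- `O` is a stationary version, over all of `ℤ`, of the pair by pair chain driven by the customers
`c` and the servers `s`: at each time it has the same stationary law `π`, it is independent of the
items that arrive later, and each new pair is matched first come first served. -/
structure IsStationaryVersion {Ω : Type*} [MeasurableSpace Ω] [MeasurableSpace 𝒞]
    [MeasurableSpace 𝒮] (P : Measure Ω) (E : 𝒞 → 𝒮 → Prop) (c : ℤ → Ω → 𝒞) (s : ℤ → Ω → 𝒮)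
    (π : PMF (PairState E)) (O : ℤ → Ω → PairState E) : Prop where
  measurable : ∀ N, Measurable (O N)
  law : ∀ N, P.map (O N) = π.toMeasure
  indep : ∀ N, IndepFun (O N) (fun ω (k : Set.Ioi N) => (c k ω, s k ω)) P
  step : ∀ᵐ ω ∂P, ∀ N, O (N + 1) ω = (O N ω).step (c (N + 1) ω) (s (N + 1) ω)

/-- `z` is the state left by the matching `A` at time `N`: finitely many items at positions `≤ N`
are not matched among themselves, and the lists of `z` are their types, in the order of their
positions. -/
def IsStateAt {E : 𝒞 → 𝒮 → Prop} (c : ℤ → 𝒞) (s : ℤ → 𝒮) (A : Set (ℤ × ℤ)) (N : ℤ)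
    (z : PairState E) : Prop :=
  ∃ U V : Finset ℤ, (U : Set ℤ) = unmatchedCustomers A N ∧ (V : Set ℤ) = unmatchedServers A N ∧
    z.customers = (U.sort (· ≤ ·)).map c ∧ z.servers = (V.sort (· ≤ ·)).map s

end BipartiteFCFS

/-!
The pairs `ξ k = (c k, s k)` are independent and identically distributed, and the pair by pair
chain is driven by the random maps `z ↦ z.step i j`. The theorem follows from the fact that these
maps forget their starting point: almost surely, for all `N` and `B`, every run that reaches time
`N` from a state of size at most `B` at a sufficiently early time ends in one and the same state
(`ae_couplesFromPast`). Three facts give this.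

*Tightness.* While the system started empty runs, an item is written on its line, and whenever an
item is matched, the two partners exchange their places. A line thus becomes a list of waiting
items of its own side and of served items of the other side (`lines`). This exchange is injective
on words of pairs (`lines_injective`) and preserves the weight, the product of the probabilities
of all items (`weight_lines`). A line is valid when no served item on it is compatible with a
waiting item before it; leave out the lines on which all types of one side wait, which do not
occur, as then nobody would wait on the other side. Complete resource pooling makes the types in a
nonempty proper set and the types incompatible with all of it carry total mass less than one, so
that the total weight of these lines is bounded independently of their length, even if every
waiting item is given an additional factor slightly above one (`exists_tsum_lineWeight_le`). Hence
the number of waiting pairs is tight, uniformly in time (`exists_tsum_wordWeight_size_le`).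

*Non-expansiveness.* An additional waiting item can only displace one item at a later time, so
that a word which empties the empty system leaves in every other state at most as many pairs as
there were before (`PairState.size_run_le_of_run_empty`). As words of compatible pairs empty the
empty system, and as a chain of compatible types leads from any waiting customer to any waiting
server, some word of compatible pairs empties every state of size at most `B`
(`PairState.exists_word_forall_run_eq_empty`).

*Coupling.* By tightness the system started empty is below a fixed size, and hence empty after a
fixed number of further steps, with probability bounded below. Cutting a word at the blocks where
this happens shows that the probability that a window of length `n` is not coupling is summable in
`n` (`tsum_measure_not_isCoupling_ne_top`), and the Borel–Cantelli lemma applies.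

An FCFS matching of a half-line satisfies a recursion that determines it
(`IsFCFSMatching.eq_fcfs`), and the items it leaves unmatched follow the pair by pair dynamics
(`IsFCFSMatching.hasState_step`). Coupling from the past therefore makes the matchings started at
the times `-K` agree eventually beyond any given time. Their limit is the matching over `ℤ`; any
balanced recurrent FCFS matching passes through states of bounded size at arbitrarily early times,
so it agrees with the limit (`IsFCFSMatching.eq_limitMatching`). The limit states form the
stationary version of the chain, and every other stationary version, having tight sizes, equals it
(`ae_eq_limitState`).
-/

open scoped ENNReal

namespace BipartiteFCFS

/-! ### Single arrivals and the pair by pair chain -/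

section Arrivals

variable {A B : Type*}

open Classical in
/-- Arrival of one item `i` at a pair of queues (its own side first, the opposite side second): it
takes the first compatible item of the opposite queue, or else joins the end of its own queue. -/
noncomputable def arrive (R : A → B → Prop) (i : A) (q : List A × List B) : List A × List B :=
  if ∃ y ∈ q.2, R i y then (q.1, q.2.eraseP fun y => decide (R i y)) else (q.1 ++ [i], q.2)

/-- `q'` is obtained from `q` by one additional item on the first side, or by one item fewer on the
second side. -/
def OneExtra (q q' : List A × List B) : Prop :=
  (∃ l₁ x l₂, q.1 = l₁ ++ l₂ ∧ q'.1 = l₁ ++ x :: l₂ ∧ q'.2 = q.2) ∨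
  (∃ l₁ y l₂, q'.2 = l₁ ++ l₂ ∧ q.2 = l₁ ++ y :: l₂ ∧ q'.1 = q.1)

lemma OneExtra.swap {q q' : List A × List B} (h : OneExtra q q') : OneExtra q'.swap q.swap := by
  rcases h with ⟨l₁, x, l₂, h1, h2, h3⟩ | ⟨l₁, x, l₂, h1, h2, h3⟩
  · exact Or.inr ⟨l₁, x, l₂, h1, h2, h3.symm⟩
  · exact Or.inl ⟨l₁, x, l₂, h1, h2, h3.symm⟩

/-- A discrepancy of one item remains a discrepancy of one item after an arrival: if the arriving
item is matched to the additional one, then the other system is left with another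
additional item. -/
lemma OneExtra.arrive (R : A → B → Prop) (i : A) {q q' : List A × List B} (h : OneExtra q q') :
    OneExtra (arrive R i q) (arrive R i q') := by
  classical
  obtain ⟨u, v⟩ := q
  obtain ⟨u', v'⟩ := q'
  rcases h with ⟨l₁, x, l₂, h1, h2, h3⟩ | ⟨l₁, y, l₂, h1, h2, h3⟩
  · simp only at h1 h2 h3
    subst h1 h2 h3
    by_cases hv : ∃ y ∈ v', R i y
    · simp only [BipartiteFCFS.arrive, hv, if_true]
      exact Or.inl ⟨l₁, x, l₂, rfl, rfl, rfl⟩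
    · simp only [BipartiteFCFS.arrive, hv, if_false]
      exact Or.inl ⟨l₁, x, l₂ ++ [i], by simp, by simp, rfl⟩
  · simp only at h1 h2 h3
    subst h1 h2 h3
    by_cases hl : ∃ y ∈ l₁, R i y
    · obtain ⟨w, hw, hw'⟩ := hl
      have e1 : ∃ y' ∈ l₁ ++ y :: l₂, R i y' := ⟨w, by simp [hw], hw'⟩
      have e2 : ∃ y' ∈ l₁ ++ l₂, R i y' := ⟨w, by simp [hw], hw'⟩
      have hp : decide (R i w) = true := by simpa using hw'
      simp only [BipartiteFCFS.arrive, e1, e2, if_true]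
      refine Or.inr ⟨l₁.eraseP fun y => decide (R i y), y, l₂, ?_, ?_, rfl⟩
      · exact List.eraseP_append_left (p := fun y => decide (R i y)) hp _ hw
      · exact List.eraseP_append_left (p := fun y => decide (R i y)) hp _ hw
    · have hl' : ∀ y ∈ l₁, ¬ (decide (R i y) = true) := fun y hy hR => hl ⟨y, hy, by simpa using hR⟩
      have E1 : ∀ l : List B, (l₁ ++ l).eraseP (fun y => decide (R i y)) =
          l₁ ++ l.eraseP fun y => decide (R i y) := fun l => List.eraseP_append_right l hl'
      have E2 : ∀ l : List B, (∃ y' ∈ l₁ ++ l, R i y') ↔ ∃ y' ∈ l, R i y' := by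
        intro l
        constructor
        · rintro ⟨y', hy', hR⟩
          rcases List.mem_append.1 hy' with h | h
          · exact absurd ⟨y', h, hR⟩ hl
          · exact ⟨y', h, hR⟩
        · rintro ⟨y', hy', hR⟩
          exact ⟨y', by simp [hy'], hR⟩
      simp only [BipartiteFCFS.arrive, E1, E2]
      by_cases hy : R i y
      · have : ∃ y' ∈ y :: l₂, R i y' := ⟨y, by simp, hy⟩
        simp only [this, if_true, List.eraseP_cons, hy, decide_true, cond_true]
        by_cases h2 : ∃ y' ∈ l₂, R i y'
        · obtain ⟨w, hw, hw'⟩ := h2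
          obtain ⟨a, m, b, -, -, h5, h6⟩ := List.exists_of_eraseP (p := fun y => decide (R i y)) hw
            (by simpa using hw')
          rw [if_pos ⟨w, hw, hw'⟩]
          refine Or.inr ⟨l₁ ++ m, a, b, ?_, ?_, rfl⟩
          · simp [h6]
          · simp [h5]
        · rw [if_neg h2]
          exact Or.inl ⟨u', i, [], by simp, by simp, rfl⟩
      · have hiff : (∃ y' ∈ y :: l₂, R i y') ↔ ∃ y' ∈ l₂, R i y' := by simp [hy]
        simp only [hiff]
        by_cases h2 : ∃ y' ∈ l₂, R i y'
        · rw [if_pos h2, if_pos h2]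
          exact Or.inr ⟨l₁, y, l₂.eraseP fun y => decide (R i y), rfl, by simp [hy], rfl⟩
        · rw [if_neg h2, if_neg h2]
          exact Or.inr ⟨l₁, y, l₂, rfl, rfl, rfl⟩

/-- `Near k q q'`: the queues `q` and `q'` differ by `k` additional or missing items. -/
inductive Near : ℕ → List A × List B → List A × List B → Prop
  | refl (q) : Near 0 q q
  | up {k q q' q''} : Near k q q' → OneExtra q' q'' → Near (k + 1) q q''
  | down {k q q' q''} : Near k q q' → OneExtra q'' q' → Near (k + 1) q q''

lemma Near.swap {k : ℕ} {q q' : List A × List B} (h : Near k q q') : Near k q.swap q'.swap := by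
  induction h with
  | refl q => exact .refl _
  | up _ h ih => exact .down ih h.swap
  | down _ h ih => exact .up ih h.swap

lemma Near.arrive (R : A → B → Prop) (i : A) {k : ℕ} {q q' : List A × List B} (h : Near k q q') :
    Near k (arrive R i q) (arrive R i q') := by
  induction h with
  | refl q => exact .refl _
  | up _ h ih => exact .up ih (h.arrive R i)
  | down _ h ih => exact .down ih (h.arrive R i)

lemma Near.length_le {k : ℕ} {q q' : List A × List B} (h : Near k q q') :
    q'.1.length + q'.2.length ≤ q.1.length + q.2.length + k := by
  induction h with
  | refl q => simp
  | up _ h ih =>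
    rcases h with ⟨l₁, x, l₂, h1, h2, h3⟩ | ⟨l₁, x, l₂, h1, h2, h3⟩ <;>
    simp [h1, h2, h3] at ih ⊢ <;> omega
  | down _ h ih =>
    rcases h with ⟨l₁, x, l₂, h1, h2, h3⟩ | ⟨l₁, x, l₂, h1, h2, h3⟩ <;>
    simp [h1, h2, h3] at ih ⊢ <;> omega

lemma near_nil (u : List A) (v : List B) : Near (u.length + v.length) ([], []) (u, v) := by
  induction v with
  | nil =>
    induction u with
    | nil => exact .refl _
    | cons x u ih =>
      have : (x :: u).length + ([] : List B).length = u.length + ([] : List B).length + 1 := by simp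
      rw [this]
      exact .up ih (Or.inl ⟨[], x, u, rfl, rfl, rfl⟩)
  | cons y v ih =>
    rw [List.length_cons, ← add_assoc]
    exact .down ih (Or.inr ⟨[], y, v, rfl, rfl, rfl⟩)

end Arrivals

variable {𝒞 𝒮 : Type*} {E : 𝒞 → 𝒮 → Prop}

namespace PairState

/-- The empty state. -/
def empty (E : 𝒞 → 𝒮 → Prop) : PairState E := ⟨[], [], rfl, by simp⟩

/-- The number of waiting customers, which is also the number of waiting servers. -/
def size (z : PairState E) : ℕ := z.customers.length

/-- The two queues of a state, without the conditions that they satisfy. -/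
def queues (z : PairState E) : List 𝒞 × List 𝒮 := (z.customers, z.servers)

lemma queues_injective : Function.Injective (queues (E := E)) := by
  intro z z' h
  exact PairState.ext (congrArg Prod.fst h) (congrArg Prod.snd h)

lemma size_eq_zero_iff {z : PairState E} : z.size = 0 ↔ z = empty E := by
  constructor
  · intro h
    have h1 : z.customers = [] := List.length_eq_zero_iff.1 h
    have h2 : z.servers = [] := List.length_eq_zero_iff.1 (z.length_eq ▸ h)
    exact PairState.ext h1 h2
  · rintro rfl; rfl

@[simp] lemma size_empty : (empty E).size = 0 := rfl

/-- Pair by pair matching amounts to letting the new customer arrive first, and then the new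
server. -/
lemma queues_step (z : PairState E) (i : 𝒞) (j : 𝒮) :
    (z.step i j).queues = (arrive (fun j i => E i j) j (arrive E i z.queues).swap).swap := by
  classical
  have hL : ∀ (u : List 𝒞), (∃ y ∈ u ++ [i], E y j) ↔ (∃ y ∈ u, E y j) ∨ E i j := by
    intro u; simp [or_and_right, exists_or]
  by_cases hy : ∃ y ∈ z.servers, E i y
  · have hy' : ¬ ∀ y ∈ z.servers, ¬ E i y := by push Not; exact hy
    by_cases hx : ∃ x ∈ z.customers, E x j
    · simp [queues, arrive, step, hy, hx]
    · have : z.customers.eraseP (fun x => decide (E x j)) = z.customers :=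
        List.eraseP_of_forall_not (by simpa using hx)
      simp only [queues, arrive, step, hy, hx, hy', this, if_true, Prod.swap, if_false, true_or,
        and_false, or_self, List.append_nil]
  · have hy' : ∀ y ∈ z.servers, ¬ E i y := by push Not at hy; exact hy
    have h1 : z.servers.eraseP (fun x => decide (E i x)) = z.servers :=
        List.eraseP_of_forall_not (by simpa using hy)
    by_cases hx : ∃ x ∈ z.customers, E x j
    · obtain ⟨x, hx1, hx2⟩ := hx
      have hx' : ¬ ∀ x ∈ z.customers, ¬ E x j := by push Not; exact ⟨x, hx1, hx2⟩
      have h2 := List.eraseP_append_left (p := fun x => decide (E x j)) (a := x)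
        (by simpa using hx2) [i] hx1
      have hx : ∃ x ∈ z.customers, E x j := ⟨x, hx1, hx2⟩
      simp only [queues, arrive, step, hy, hx, hx', hL, h1, h2, if_true, Prod.swap, if_false,
        true_or, and_false, or_self, List.append_nil]
    · have hx' : ∀ x ∈ z.customers, ¬ E x j := by push Not at hx; exact hx
      have h2 : z.customers.eraseP (fun x => decide (E x j)) = z.customers :=
        List.eraseP_of_forall_not (by simpa using hx')
      have h3 := List.eraseP_append_right (p := fun x => decide (E x j)) [i] (l₁ := z.customers)
        (by simpa using hx')
      by_cases hE : E i j
      · simp only [queues, arrive, step, hy, hx, hL, h1, h2, h3, hE, if_true, Prod.swap, if_false,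
          or_true]
        simpa [hE] using ⟨hx', hy'⟩
      · simp only [queues, arrive, step, hy, hx, hL, h1, h2, h3, hE, Prod.swap, if_false, or_self,
          false_and]

/-- The state reached from `z` when the pairs of the word `w` arrive one after the other. -/
noncomputable def run (z : PairState E) (w : List (𝒞 × 𝒮)) : PairState E :=
  w.foldl (fun z x => z.step x.1 x.2) z

@[simp] lemma run_nil (z : PairState E) : z.run [] = z := rfl

@[simp] lemma run_append (z : PairState E) (w w' : List (𝒞 × 𝒮)) :
    z.run (w ++ w') = (z.run w).run w' := List.foldl_append

@[simp] lemma run_cons (z : PairState E) (x : 𝒞 × 𝒮) (w : List (𝒞 × 𝒮)) :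
    z.run (x :: w) = (z.step x.1 x.2).run w := rfl

lemma near_run (w : List (𝒞 × 𝒮)) {k : ℕ} : ∀ {z z' : PairState E}, Near k z.queues z'.queues →
    Near k (z.run w).queues (z'.run w).queues := by
  induction w with
  | nil => exact fun h => h
  | cons x w ih =>
    intro z z' h
    rw [run_cons, run_cons]
    refine ih ?_
    rw [queues_step, queues_step]
    exact ((h.arrive _ _).swap.arrive _ _).swap

/-- Matching is non-expansive: whenever the system started empty is empty again, the system started
from `z` has no more waiting items than `z`. -/
lemma size_run_le_of_run_empty {w : List (𝒞 × 𝒮)} (h : (empty E).run w = empty E)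
    (z : PairState E) : (z.run w).size ≤ z.size := by
  have h1 : Near (z.customers.length + z.servers.length) (empty E).queues z.queues := near_nil _ _
  have h2 := (near_run w h1).length_le
  rw [h] at h2
  have h3 := (z.run w).length_eq
  have h4 := z.length_eq
  simp only [queues, empty, size, List.length_nil] at h2 ⊢
  omega

lemma size_step_le (z : PairState E) (i : 𝒞) (j : 𝒮) : (z.step i j).size ≤ z.size + 1 := by
  classical
  simp only [size, step, List.length_append]
  have := List.length_eraseP_le (l := z.customers) (p := fun x => decide (E x j))
  split_ifs <;> simp <;> omega

lemma size_run_le (w : List (𝒞 × 𝒮)) : ∀ z : PairState E, (z.run w).size ≤ z.size + w.length := by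
  induction w with
  | nil => simp
  | cons x w ih =>
    intro z
    have h1 := ih (z.step x.1 x.2)
    have h2 := z.size_step_le x.1 x.2
    rw [run_cons, List.length_cons]
    omega

lemma run_empty_of_forall_compatible {w : List (𝒞 × 𝒮)} (hw : ∀ x ∈ w, E x.1 x.2) :
    (empty E).run w = empty E := by
  induction w with
  | nil => rfl
  | cons x w ih =>
    have h1 : (empty E).step x.1 x.2 = empty E := by
      have := hw x (by simp)
      ext1 <;> simp [step, empty, this]
    rw [run_cons, h1]
    exact ih fun y hy => hw y (by simp [hy])

lemma finite_size_le [Finite 𝒞] [Finite 𝒮] (B : ℕ) : {z : PairState E | z.size ≤ B}.Finite := by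
  have h : ((fun z : PairState E => z.queues) ''
      {z : PairState E | z.size ≤ B}).Finite := by
    refine ((List.finite_length_le 𝒞 B).prod (List.finite_length_le 𝒮 B)).subset ?_
    rintro _ ⟨z, hz, rfl⟩
    exact ⟨hz, show z.servers.length ≤ B from z.length_eq ▸ hz⟩
  exact h.of_finite_image queues_injective.injOn

instance [Countable 𝒞] [Countable 𝒮] : Countable (PairState E) := queues_injective.countable

end PairState

/-! ### Words that empty the system -/

/-- `ReachIn E k x y`: the customer type `x` is joined to the server type `y` by a path with `2k+1`
edges. -/
def ReachIn (E : 𝒞 → 𝒮 → Prop) : ℕ → 𝒞 → 𝒮 → Prop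
  | 0, x, y => E x y
  | k + 1, x, y => ∃ j i, E x j ∧ E i j ∧ ReachIn E k i y

lemma exists_reachIn_of_walk {a b : 𝒞 ⊕ 𝒮} (p : (compatGraph E).Walk a b) (y : 𝒮)
    (hb : b = Sum.inr y) :
    (∀ x, a = Sum.inl x → ∃ k, ReachIn E k x y) ∧
    (∀ j, a = Sum.inr j → ∀ x, E x j → ∃ k, ReachIn E k x y) := by
  induction p with
  | nil =>
    subst hb
    refine ⟨by simp, fun j hj x hx => ⟨0, ?_⟩⟩
    obtain rfl : y = j := by simpa using hj
    exact hx
  | cons h p ih =>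
    obtain ⟨ih1, ih2⟩ := ih hb
    refine ⟨fun x hx => ?_, fun j hj x hx => ?_⟩
    · rcases h with ⟨i, j, h1, h2, h3⟩ | ⟨i, j, h1, h2, h3⟩
      · obtain rfl : i = x := by simpa using h1.symm.trans hx
        exact ih2 j h2 _ h3
      · simp [hx] at h2
    · rcases h with ⟨i, j', h1, h2, h3⟩ | ⟨i, j', h1, h2, h3⟩
      · simp [hj] at h1
      · obtain rfl : j' = j := by simpa using h2.symm.trans hj
        obtain ⟨k, hk⟩ := ih1 i h1
        exact ⟨k + 1, j', i, hx, h3, hk⟩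

lemma exists_reachIn (hE : (compatGraph E).Connected) (x : 𝒞) (y : 𝒮) : ∃ k, ReachIn E k x y := by
  obtain ⟨p⟩ := hE.preconnected (Sum.inl x) (Sum.inr y)
  exact (exists_reachIn_of_walk p y rfl).1 x rfl

lemma ReachIn.exists_left {k : ℕ} {x : 𝒞} {y : 𝒮} (h : ReachIn E k x y) : ∃ j, E x j := by
  cases k with
  | zero => exact ⟨y, h⟩
  | succ k => obtain ⟨j, i, h1, -⟩ := h; exact ⟨j, h1⟩

lemma ReachIn.exists_right {k : ℕ} {x : 𝒞} {y : 𝒮} (h : ReachIn E k x y) : ∃ i, E i y := by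
  induction k generalizing x with
  | zero => exact ⟨x, h⟩
  | succ k ih => obtain ⟨j, i, -, -, h3⟩ := h; exact ih h3

namespace PairState

/-- Along a path from a waiting customer to a waiting server, the arrival of the next
server and the next customer of the path shortens the path until one more pair can be matched. -/
lemma exists_word_size_lt {k : ℕ} : ∀ {z : PairState E} {x : 𝒞} {y : 𝒮}, x ∈ z.customers →
    y ∈ z.servers → ReachIn E k x y →
    ∃ w : List (𝒞 × 𝒮), (∀ p ∈ w, E p.1 p.2) ∧ (z.run w).size < z.size := by
  classical
  induction k with
  | zero => exact fun hx hy h => absurd h (PairState.incompatible _ _ hx _ hy)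
  | succ k ih =>
    intro z x y hx hy h
    obtain ⟨j, i, h1, h2, h3⟩ := h
    have hl := List.length_eraseP_of_mem (p := fun x => decide (E x j)) hx (by simpa using h1)
    have hpos := List.length_pos_of_mem hx
    by_cases hv : ∃ y ∈ z.servers, E i y
    · refine ⟨[(i, j)], by simpa using h2, ?_⟩
      simp only [run_cons, run_nil, size, step, hv, true_or, if_true, List.append_nil]
      omega
    · have hc : (z.step i j).customers = z.customers.eraseP (fun x => decide (E x j)) ++ [i] := by
        have : ¬ ((∃ y ∈ z.servers, E i y) ∨ (E i j ∧ ∀ x ∈ z.customers, ¬ E x j)) := by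
          rintro (h | ⟨-, h⟩)
          · exact hv h
          · exact h x hx h1
        simp only [step, this, if_false]
      have hs : (z.step i j).servers = z.servers := by
        have h4 : z.servers.eraseP (fun x => decide (E i x)) = z.servers :=
          List.eraseP_of_forall_not (by simpa using hv)
        have h5 : ∃ x ∈ z.customers, E x j := ⟨x, hx, h1⟩
        simp only [step, h4, h5, true_or, if_true, List.append_nil]
      obtain ⟨w, hw1, hw2⟩ := ih (z := z.step i j) (x := i) (y := y) (by simp [hc])
        (by simpa [hs] using hy) h3
      refine ⟨(i, j) :: w, ?_, ?_⟩
      · rintro p hp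
        rcases List.mem_cons.1 hp with rfl | hp
        exacts [h2, hw1 p hp]
      · rw [run_cons]
        refine hw2.trans_le ?_
        simp only [size, hc, List.length_append, hl, List.length_singleton]
        omega

lemma exists_word_run_eq_empty (hE : (compatGraph E).Connected) (z : PairState E) :
    ∃ w : List (𝒞 × 𝒮), (∀ p ∈ w, E p.1 p.2) ∧ z.run w = empty E := by
  induction hn : z.size using Nat.strong_induction_on generalizing z with
  | _ n ih =>
    rcases hz : z.customers with _ | ⟨x, u⟩
    · exact ⟨[], by simp, size_eq_zero_iff.1 (by simp [size, hz])⟩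
    rcases hz' : z.servers with _ | ⟨y, v⟩
    · have := z.length_eq
      simp [hz, hz'] at this
    obtain ⟨k, hk⟩ := exists_reachIn hE x y
    obtain ⟨w, hw, hlt⟩ := exists_word_size_lt (z := z) (by simp [hz]) (by simp [hz']) hk
    obtain ⟨w', hw', he⟩ := ih _ (hn ▸ hlt) (z.run w) rfl
    refine ⟨w ++ w', ?_, by rw [run_append, he]⟩
    intro p hp
    rcases List.mem_append.1 hp with hp | hp
    exacts [hw p hp, hw' p hp]

/-- One word of compatible pairs empties the system from all states with at most `B` waiting
pairs. -/
lemma exists_word_forall_run_eq_empty [Finite 𝒞] [Finite 𝒮] (hE : (compatGraph E).Connected)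
    (B : ℕ) : ∃ w : List (𝒞 × 𝒮), (∀ p ∈ w, E p.1 p.2) ∧
      ∀ z : PairState E, z.size ≤ B → z.run w = empty E := by
  have key : ∀ s : Set (PairState E), s.Finite →
      ∃ w : List (𝒞 × 𝒮), (∀ p ∈ w, E p.1 p.2) ∧ ∀ z ∈ s, z.run w = empty E := by
    intro s hs
    induction s, hs using Set.Finite.induction_on with
    | empty => exact ⟨[], by simp, by simp⟩
    | @insert z s _ _ ih =>
      obtain ⟨w, hw, hz⟩ := ih
      obtain ⟨w', hw', hz'⟩ := exists_word_run_eq_empty hE (z.run w)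
      refine ⟨w ++ w', ?_, ?_⟩
      · intro p hp
        rcases List.mem_append.1 hp with hp | hp
        exacts [hw p hp, hw' p hp]
      · intro y hy
        rcases hy with rfl | hy
        · rw [run_append, hz']
        · rw [run_append, hz y hy, run_empty_of_forall_compatible hw']
  exact key _ (finite_size_le B)

end PairState

/-! ### The exchange transformation -/

section Exchange

variable {A B : Type*}

/-- The waiting items of a line: the entry `inl x` is an item that is still waiting, the entry
`inr y` records the partner of an item that has been matched. -/
def waiting (l : List (A ⊕ B)) : List A := l.filterMap Sum.getLeft?

@[simp] lemma waiting_nil : waiting ([] : List (A ⊕ B)) = [] := rfl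

@[simp] lemma waiting_inl (x : A) (l : List (A ⊕ B)) :
    waiting (Sum.inl x :: l) = x :: waiting l := rfl

@[simp] lemma waiting_inr (y : B) (l : List (A ⊕ B)) : waiting (Sum.inr y :: l) = waiting l := rfl

@[simp] lemma waiting_append (l l' : List (A ⊕ B)) :
    waiting (l ++ l') = waiting l ++ waiting l' := List.filterMap_append

lemma mem_waiting {l : List (A ⊕ B)} {x : A} : x ∈ waiting l ↔ Sum.inl x ∈ l := by
  simp [waiting, Sum.getLeft?_eq_some_iff]

/-- `IsFirst R i opp t`: the line `opp` splits as `t` around its first waiting item that is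
compatible with `i`. -/
def IsFirst (R : A → B → Prop) (i : A) (opp : List (B ⊕ A))
    (t : List (B ⊕ A) × B × List (B ⊕ A)) : Prop :=
  opp = t.1 ++ Sum.inl t.2.1 :: t.2.2 ∧ R i t.2.1 ∧ ∀ y, Sum.inl y ∈ t.1 → ¬ R i y

lemma exists_isFirst {R : A → B → Prop} {i : A} {opp : List (B ⊕ A)} {y : B}
    (hy : Sum.inl y ∈ opp) (hR : R i y) : ∃ t, IsFirst R i opp t := by
  induction opp with
  | nil => simp at hy
  | cons e l ih =>
    by_cases he : ∃ y', e = Sum.inl y' ∧ R i y'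
    · obtain ⟨y', rfl, h⟩ := he
      exact ⟨⟨[], y', l⟩, rfl, h, by simp⟩
    · have hl : Sum.inl y ∈ l := by
        rcases List.mem_cons.1 hy with h | h
        · exact absurd ⟨y, h.symm, hR⟩ he
        · exact h
      obtain ⟨⟨l₁, y', l₂⟩, h1, h2, h3⟩ := ih hl
      refine ⟨⟨e :: l₁, y', l₂⟩, by simpa using h1, h2, ?_⟩
      intro y'' h
      rcases List.mem_cons.1 h with h | h
      · exact fun hR' => he ⟨y'', h.symm, hR'⟩
      · exact h3 y'' h

open Classical in
/-- Arrival of one item at a pair of lines. If the item is matched, then it trades places with its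
partner: the partner's type is recorded at the end of the item's own line, and the item's type at
the place of the partner. -/
noncomputable def lineArrive (R : A → B → Prop) (i : A) (q : List (A ⊕ B) × List (B ⊕ A)) :
    List (A ⊕ B) × List (B ⊕ A) :=
  if h : ∃ t, IsFirst R i q.2 t then
    (q.1 ++ [Sum.inr h.choose.2.1], h.choose.1 ++ Sum.inr i :: h.choose.2.2)
  else (q.1 ++ [Sum.inl i], q.2)

/-- The two possible outcomes of an arrival. -/
lemma lineArrive_cases (R : A → B → Prop) (i : A) (q : List (A ⊕ B) × List (B ⊕ A)) :
    (∃ l₁ y l₂, q.2 = l₁ ++ Sum.inl y :: l₂ ∧ R i y ∧ (∀ y, Sum.inl y ∈ l₁ → ¬ R i y) ∧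
      lineArrive R i q = (q.1 ++ [Sum.inr y], l₁ ++ Sum.inr i :: l₂)) ∨
    ((∀ y, Sum.inl y ∈ q.2 → ¬ R i y) ∧ lineArrive R i q = (q.1 ++ [Sum.inl i], q.2)) := by
  by_cases h : ∃ t, IsFirst R i q.2 t
  · obtain ⟨h1, h2, h3⟩ := h.choose_spec
    exact Or.inl ⟨_, _, _, h1, h2, h3, dif_pos h⟩
  · exact Or.inr ⟨fun y hy hR => h (exists_isFirst hy hR), dif_neg h⟩

lemma waiting_lineArrive (R : A → B → Prop) (i : A) (q : List (A ⊕ B) × List (B ⊕ A)) :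
    (waiting (lineArrive R i q).1, waiting (lineArrive R i q).2) =
      arrive R i (waiting q.1, waiting q.2) := by
  classical
  rcases lineArrive_cases R i q with ⟨l₁, y, l₂, h1, h2, h3, h4⟩ | ⟨h1, h2⟩
  · have : ∃ y ∈ waiting q.2, R i y := ⟨y, by simp [h1], h2⟩
    rw [h4, arrive, if_pos this, h1]
    have h5 : ∀ y ∈ waiting l₁, ¬ (decide (R i y) = true) := fun y hy => by
      simpa using h3 y (mem_waiting.1 hy)
    simp only [waiting_append, waiting_inl, waiting_inr, waiting_nil, List.append_nil]
    rw [List.eraseP_append_right _ h5]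
    simp [h2]
  · have : ¬ ∃ y ∈ waiting q.2, R i y := fun ⟨y, hy, hR⟩ => h1 y (mem_waiting.1 hy) hR
    rw [h2, arrive, if_neg this]
    simp

/-- In a line produced by FCFS matching, an item that is still waiting is incompatible with the
partners recorded after it. -/
def IsValidLine (R : A → B → Prop) (l : List (A ⊕ B)) : Prop :=
  l.Pairwise fun e e' => ∀ x y, e = Sum.inl x → e' = Sum.inr y → ¬ R x y

/-- The pairs of lines produced by FCFS matching. -/
structure IsValid (R : A → B → Prop) (q : List (A ⊕ B) × List (B ⊕ A)) : Prop where
  left : IsValidLine R q.1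
  right : IsValidLine (fun y x => R x y) q.2
  cross : ∀ x y, Sum.inl x ∈ q.1 → Sum.inl y ∈ q.2 → ¬ R x y

lemma IsValid.swap {R : A → B → Prop} {q : List (A ⊕ B) × List (B ⊕ A)} (h : IsValid R q) :
    IsValid (fun y x => R x y) q.swap :=
  ⟨h.right, h.left, fun x y hx hy => h.cross y x hy hx⟩

lemma IsValid.lineArrive {R : A → B → Prop} {q : List (A ⊕ B) × List (B ⊕ A)} (h : IsValid R q)
    (i : A) : IsValid R (lineArrive R i q) := by
  obtain ⟨hl, hr, hc⟩ := h
  rcases lineArrive_cases R i q with ⟨l₁, y, l₂, h1, h2, h3, h4⟩ | ⟨h1, h2⟩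
  · rw [h4]
    rw [h1] at hr hc
    refine ⟨?_, ?_, ?_⟩
    · refine List.pairwise_append.2 ⟨hl, List.pairwise_singleton _ _, ?_⟩
      rintro e he e' he' x y' rfl rfl
      obtain rfl : y' = y := by simpa using he'
      exact hc x y' he (by simp)
    · obtain ⟨hr1, hr2, hr3⟩ := List.pairwise_append.1 hr
      obtain ⟨hr4, hr5⟩ := List.pairwise_cons.1 hr2
      refine List.pairwise_append.2 ⟨hr1, List.pairwise_cons.2 ⟨?_, hr5⟩, ?_⟩
      · rintro e he x y' h
        simp at h
      · rintro e he e' he' x y' rfl rfl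
        rcases List.mem_cons.1 he' with h | h
        · obtain rfl : y' = i := by simpa using h
          exact h3 x he
        · exact hr3 _ he _ (List.mem_cons_of_mem _ h) x y' rfl rfl
    · intro x y' hx hy
      refine hc x y' (by simpa using hx) ?_
      simp only [List.mem_append, List.mem_cons] at hy ⊢
      rcases hy with hy | hy | hy
      · exact Or.inl hy
      · simp at hy
      · exact Or.inr (Or.inr hy)
  · rw [h2]
    refine ⟨?_, hr, ?_⟩
    · refine List.pairwise_append.2 ⟨hl, List.pairwise_singleton _ _, ?_⟩
      rintro e he e' he' x y' rfl rfl
      simp at he'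
    · intro x y' hx hy
      rcases List.mem_append.1 hx with hx | hx
      · exact hc x y' hx hy
      · obtain rfl : x = i := by simpa using hx
        exact h1 y' hy

lemma append_cons_inj_of_forall_not {X : Type*} {p : X → Prop} {l₁ l₂ l₁' l₂' : List X} {a a' : X}
    (h : l₁ ++ a :: l₂ = l₁' ++ a' :: l₂') (ha : p a) (ha' : p a') (hl : ∀ e ∈ l₂, ¬ p e)
    (hl' : ∀ e ∈ l₂', ¬ p e) : l₁ = l₁' ∧ a = a' ∧ l₂ = l₂' := by
  rcases List.append_eq_append_iff.1 h with ⟨as, h1, h2⟩ | ⟨as, h1, h2⟩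
  · rcases as with _ | ⟨b, as⟩
    · simp at h1 h2
      exact ⟨h1.symm, h2⟩
    · simp at h2
      exact absurd ha' (hl a' (by simp [h2.2]))
  · rcases as with _ | ⟨b, as⟩
    · simp at h1 h2
      exact ⟨h1, h2.1.symm, h2.2.symm⟩
    · simp at h2
      exact absurd ha (hl' a (by simp [h2.2]))

/-- An arrival can be undone: read backwards in time, the partner recorded last is matched
to the last compatible item recorded on the opposite line. -/
lemma lineArrive_injective {R : A → B → Prop} {i i' : A} {q q' : List (A ⊕ B) × List (B ⊕ A)}
    (hq : IsValid R q) (hq' : IsValid R q') (h : lineArrive R i q = lineArrive R i' q') :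
    i = i' ∧ q = q' := by
  have key : ∀ {q : List (A ⊕ B) × List (B ⊕ A)} {l₁ y l₂}, IsValid R q →
      q.2 = l₁ ++ Sum.inl y :: l₂ → ∀ e ∈ l₂, ¬ ∃ x, e = Sum.inr x ∧ R x y := by
    rintro q l₁ y l₂ hq h e he ⟨x, rfl, hx⟩
    have h1 := hq.right
    rw [h] at h1
    have h2 := (List.pairwise_cons.1 (List.pairwise_append.1 h1).2.1).1 _ he y x rfl rfl
    exact h2 hx
  rcases lineArrive_cases R i q with ⟨l₁, y, l₂, h1, h2, h3, h4⟩ | ⟨h1, h2⟩ <;>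
  rcases lineArrive_cases R i' q' with ⟨l₁', y', l₂', h1', h2', h3', h4'⟩ | ⟨h1', h2'⟩
  · rw [h4, h4', Prod.mk.injEq] at h
    obtain ⟨ha, hb⟩ := h
    obtain ⟨hc, hd⟩ := List.append_inj' ha rfl
    obtain rfl : y = y' := by simpa using hd
    obtain ⟨e1, e2, e3⟩ := append_cons_inj_of_forall_not (p := fun e => ∃ x, e = Sum.inr x ∧ R x y)
      hb ⟨i, rfl, h2⟩ ⟨i', rfl, h2'⟩ (key hq h1) (key hq' h1')
    refine ⟨by simpa using e2, Prod.ext hc ?_⟩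
    rw [h1, h1', e1, e3]
  · rw [h4, h2', Prod.mk.injEq] at h
    have := (List.append_inj' h.1 rfl).2
    simp at this
  · rw [h2, h4', Prod.mk.injEq] at h
    have := (List.append_inj' h.1 rfl).2
    simp at this
  · rw [h2, h2', Prod.mk.injEq] at h
    obtain ⟨hc, hd⟩ := List.append_inj' h.1 rfl
    exact ⟨by simpa using hd, Prod.ext hc h.2⟩

/-- The product of the probabilities of the types recorded on a line. -/
noncomputable def weight (a : A → ℝ≥0∞) (b : B → ℝ≥0∞) (l : List (A ⊕ B)) : ℝ≥0∞ :=
  (l.map (Sum.elim a b)).prod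

lemma weight_lineArrive (R : A → B → Prop) (a : A → ℝ≥0∞) (b : B → ℝ≥0∞) (i : A)
    (q : List (A ⊕ B) × List (B ⊕ A)) :
    weight a b (lineArrive R i q).1 * weight b a (lineArrive R i q).2 =
      weight a b q.1 * weight b a q.2 * a i := by
  rcases lineArrive_cases R i q with ⟨l₁, y, l₂, h1, h2, h3, h4⟩ | ⟨h1, h2⟩
  · rw [h4, h1]
    simp only [weight, List.map_append, List.map_cons, List.map_nil, List.prod_append,
      List.prod_cons, List.prod_nil, Sum.elim_inl, Sum.elim_inr]
    ring
  · rw [h2]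
    simp only [weight, List.map_append, List.map_cons, List.map_nil, List.prod_append,
      List.prod_cons, List.prod_nil, Sum.elim_inl]
    ring

lemma length_lineArrive (R : A → B → Prop) (i : A) (q : List (A ⊕ B) × List (B ⊕ A)) :
    (lineArrive R i q).1.length = q.1.length + 1 ∧ (lineArrive R i q).2.length = q.2.length := by
  rcases lineArrive_cases R i q with ⟨l₁, y, l₂, h1, h2, h3, h4⟩ | ⟨h1, h2⟩
  · rw [h4, h1]; simp
  · rw [h2]; simp

end Exchange

section Lines

variable {𝒞 𝒮 : Type*}

/-- Arrival of a pair at the customer line and the server line. -/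
noncomputable def lineStep (E : 𝒞 → 𝒮 → Prop) (q : List (𝒞 ⊕ 𝒮) × List (𝒮 ⊕ 𝒞)) (x : 𝒞 × 𝒮) :
    List (𝒞 ⊕ 𝒮) × List (𝒮 ⊕ 𝒞) :=
  (lineArrive (fun j i => E i j) x.2 (lineArrive E x.1 q).swap).swap

/-- The exchange transformation: the two lines obtained from a word of pairs when every matched
item trades places with its partner. -/
noncomputable def lines (E : 𝒞 → 𝒮 → Prop) (w : List (𝒞 × 𝒮)) :
    List (𝒞 ⊕ 𝒮) × List (𝒮 ⊕ 𝒞) :=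
  w.foldl (lineStep E) ([], [])

lemma lines_concat (E : 𝒞 → 𝒮 → Prop) (w : List (𝒞 × 𝒮)) (x : 𝒞 × 𝒮) :
    lines E (w ++ [x]) = lineStep E (lines E w) x := by
  simp [lines]

lemma isValid_lines (E : 𝒞 → 𝒮 → Prop) (w : List (𝒞 × 𝒮)) : IsValid E (lines E w) := by
  induction w using List.reverseRecOn with
  | nil => exact ⟨List.Pairwise.nil, List.Pairwise.nil, by simp [lines]⟩
  | append_singleton w x ih =>
    rw [lines_concat]
    exact ((ih.lineArrive x.1).swap.lineArrive x.2).swap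

lemma length_lines (E : 𝒞 → 𝒮 → Prop) (w : List (𝒞 × 𝒮)) :
    (lines E w).1.length = w.length ∧ (lines E w).2.length = w.length := by
  induction w using List.reverseRecOn with
  | nil => exact ⟨rfl, rfl⟩
  | append_singleton w x ih =>
    rw [lines_concat]
    have h1 := length_lineArrive E x.1 (lines E w)
    have h2 := length_lineArrive (fun j i => E i j) x.2 (lineArrive E x.1 (lines E w)).swap
    simp only [Prod.fst_swap, Prod.snd_swap] at h2
    simp only [lineStep, Prod.fst_swap, Prod.snd_swap, List.length_append, List.length_singleton]
    omega

lemma lines_injective (E : 𝒞 → 𝒮 → Prop) : Function.Injective (lines E) := by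
  intro w
  induction w using List.reverseRecOn with
  | nil =>
    intro w' h
    have h1 := (length_lines E w').1
    rw [← h] at h1
    exact (List.length_eq_zero_iff.1 h1.symm).symm
  | append_singleton w x ih =>
    intro w' h
    rcases List.eq_nil_or_concat' w' with rfl | ⟨w', x', rfl⟩
    · have h1 := (length_lines E (w ++ [x])).1
      rw [h] at h1
      simp [lines] at h1
    · rw [lines_concat, lines_concat] at h
      obtain ⟨h1, h2⟩ := lineArrive_injective ((isValid_lines E w).lineArrive x.1).swap
        ((isValid_lines E w').lineArrive x'.1).swap (Prod.swap_injective h)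
      obtain ⟨h3, h4⟩ := lineArrive_injective (isValid_lines E w) (isValid_lines E w')
        (Prod.swap_injective h2)
      rw [ih h4, Prod.ext h3 h1]

lemma waiting_lines (E : 𝒞 → 𝒮 → Prop) (w : List (𝒞 × 𝒮)) :
    (waiting (lines E w).1, waiting (lines E w).2) =
      ((PairState.empty E).run w).queues := by
  induction w using List.reverseRecOn with
  | nil => rfl
  | append_singleton w x ih =>
    have h1 := waiting_lineArrive E x.1 (lines E w)
    have h2 := waiting_lineArrive (fun j i => E i j) x.2 (lineArrive E x.1 (lines E w)).swap
    rw [lines_concat, PairState.run_append, PairState.run_cons, PairState.run_nil,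
      PairState.queues_step, ← ih, ← h1]
    exact congrArg Prod.swap h2

/-- The probability of a word of independent pairs. -/
noncomputable def wordWeight (a : 𝒞 → ℝ≥0∞) (b : 𝒮 → ℝ≥0∞) (w : List (𝒞 × 𝒮)) : ℝ≥0∞ :=
  (w.map fun x => a x.1 * b x.2).prod

@[simp] lemma wordWeight_append (a : 𝒞 → ℝ≥0∞) (b : 𝒮 → ℝ≥0∞) (w w' : List (𝒞 × 𝒮)) :
    wordWeight a b (w ++ w') = wordWeight a b w * wordWeight a b w' := by
  simp [wordWeight]

lemma weight_lines (E : 𝒞 → 𝒮 → Prop) (a : 𝒞 → ℝ≥0∞) (b : 𝒮 → ℝ≥0∞) (w : List (𝒞 × 𝒮)) :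
    weight a b (lines E w).1 * weight b a (lines E w).2 = wordWeight a b w := by
  induction w using List.reverseRecOn with
  | nil => simp [lines, weight, wordWeight]
  | append_singleton w x ih =>
    have h1 := weight_lineArrive E a b x.1 (lines E w)
    have h2 := weight_lineArrive (fun j i => E i j) b a x.2 (lineArrive E x.1 (lines E w)).swap
    rw [lines_concat, wordWeight_append, ← ih]
    simp only [lineStep, Prod.fst_swap, Prod.snd_swap] at h2 ⊢
    rw [mul_comm, h2, mul_comm (weight b a _), h1]
    simp [wordWeight, mul_assoc]

end Lines

/-! ### Summing the weights of the lines -/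

section LineSum

variable {A B : Type*} [Fintype A] [Fintype B]

lemma tsum_list {X : Type*} (f : List X → ℝ≥0∞) :
    ∑' l, f l = f [] + ∑' x, ∑' l, f (x :: l) := by
  let e : Unit ⊕ (X × List X) ≃ List X :=
    { toFun := fun o => o.elim (fun _ => []) fun p => p.1 :: p.2
      invFun := fun l => match l with
        | [] => .inl ()
        | x :: l => .inr (x, l)
      left_inv := by rintro (_ | ⟨x, l⟩) <;> rfl
      right_inv := by rintro (_ | ⟨x, l⟩) <;> rfl }
  rw [← e.tsum_eq, Summable.tsum_sum (f := fun o => f (e o)) ENNReal.summable ENNReal.summable,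
    ENNReal.tsum_prod', tsum_fintype]
  simp [e]

open Classical in
/-- The weight of a line of length `n` whose types are added to the set `U` of types already
waiting, with an additional factor `r` for each waiting item; it is zero if the line is not valid
or if all types end up waiting. -/
noncomputable def lineWeight (E : A → B → Prop) (a : A → ℝ≥0∞) (b : B → ℝ≥0∞) (r : ℝ≥0∞) :
    ℕ → Finset A → List (A ⊕ B) → ℝ≥0∞
  | 0, U, [] => if U = Finset.univ then 0 else 1
  | 0, _, _ :: _ => 0
  | _ + 1, _, [] => 0
  | n + 1, U, Sum.inl x :: l => a x * r * lineWeight E a b r n (insert x U) l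
  | n + 1, U, Sum.inr y :: l =>
      (if ∃ x ∈ U, E x y then 0 else b y) * lineWeight E a b r n U l

omit [Fintype B] in
open Classical in
/-- On a valid line on which some type does not end up waiting, `lineWeight` is the weight of the
line with a factor `r` for each waiting item. -/
lemma lineWeight_eq {E : A → B → Prop} (a : A → ℝ≥0∞) (b : B → ℝ≥0∞) (r : ℝ≥0∞)
    (l : List (A ⊕ B)) : ∀ (U : Finset A), IsValidLine E l →
    (∀ x ∈ U, ∀ y, Sum.inr y ∈ l → ¬ E x y) → (∃ x, x ∉ U ∧ x ∉ waiting l) →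
    lineWeight E a b r l.length U l = r ^ (waiting l).length * weight a b l := by
  induction l with
  | nil =>
    rintro U - - ⟨x, hx, -⟩
    have : U ≠ Finset.univ := fun h => hx (h ▸ Finset.mem_univ x)
    simp [lineWeight, this, weight]
  | cons e l ih =>
    intro U hl hU hx
    obtain ⟨h1, h2⟩ := List.pairwise_cons.1 hl
    rcases e with x | y
    · rw [List.length_cons, lineWeight, ih (insert x U) h2]
      · simp only [waiting_inl, List.length_cons, weight, List.map_cons, List.prod_cons,
          Sum.elim_inl]
        ring
      · intro x' hx' y hy
        rcases Finset.mem_insert.1 hx' with rfl | hx'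
        · exact h1 _ hy _ _ rfl rfl
        · exact hU x' hx' y (by simp [hy])
      · obtain ⟨x', h3, h4⟩ := hx
        simp only [waiting_inl, List.mem_cons, not_or] at h4
        exact ⟨x', by simp [h3, h4.1], h4.2⟩
    · have : ¬ ∃ x ∈ U, E x y := fun ⟨x, hx, hE⟩ => hU x hx y (by simp) hE
      rw [List.length_cons, lineWeight, ih U h2 (fun x hx y' hy' => hU x hx y' (by simp [hy'])) hx,
        if_neg this]
      simp only [waiting_inr, weight, List.map_cons, List.prod_cons, Sum.elim_inr]
      ring

open Classical in
/-- The total probability of the types incompatible with all of `U`. -/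
noncomputable def idleWeight (E : A → B → Prop) (b : B → ℝ≥0∞) (U : Finset A) : ℝ≥0∞ :=
  ∑ y, if ∃ x ∈ U, E x y then 0 else b y

open Classical in
lemma tsum_lineWeight_succ (E : A → B → Prop) (a : A → ℝ≥0∞) (b : B → ℝ≥0∞) (r : ℝ≥0∞) (n : ℕ)
    (U : Finset A) : ∑' l, lineWeight E a b r (n + 1) U l =
      (∑ x, a x * r * ∑' l, lineWeight E a b r n (insert x U) l) +
      idleWeight E b U * ∑' l, lineWeight E a b r n U l := by
  rw [tsum_list, tsum_fintype, Fintype.sum_sum_type]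
  simp only [lineWeight, zero_add, ENNReal.tsum_mul_left, idleWeight, Finset.sum_mul]

/-- Under the subcriticality condition `h`, the total weight of the lines of a given length remains
bounded, even with a factor `r > 1` for each waiting item: while the set `U` of
waiting types does not grow, each entry contributes at most a factor `r (a(U) + idle(U)) < 1`. -/
lemma exists_tsum_lineWeight_le {E : A → B → Prop} {a : A → ℝ≥0∞} {b : B → ℝ≥0∞}
    (ha : ∑ x, a x = 1) (hb : ∑ y, b y = 1)
    (h : ∀ U : Finset A, U ≠ ∅ → U ≠ Finset.univ → ∑ x ∈ U, a x + idleWeight E b U < 1) :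
    ∃ r : ℝ≥0∞, 1 < r ∧ ∃ K : ℝ≥0∞, K ≠ ∞ ∧
      ∀ n, ∑' l, lineWeight E a b r n ∅ l ≤ K := by
  classical
  obtain ⟨m, hm1, hm⟩ : ∃ m : ℝ≥0∞, m < 1 ∧ ∀ U : Finset A, U ≠ ∅ → U ≠ Finset.univ →
      ∑ x ∈ U, a x + idleWeight E b U ≤ m := by
    refine ⟨(Finset.univ.filter fun U : Finset A => U ≠ ∅ ∧ U ≠ Finset.univ).sup
      fun U => ∑ x ∈ U, a x + idleWeight E b U, ?_, ?_⟩
    · rw [Finset.sup_lt_iff (by simp)]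
      intro U hU
      simp only [Finset.mem_filter, Finset.mem_univ, true_and] at hU
      exact h U hU.1 hU.2
    · intro U h1 h2
      exact Finset.le_sup (f := fun U => ∑ x ∈ U, a x + idleWeight E b U) (by simp [h1, h2])
  obtain ⟨c, hc1, hc2⟩ := exists_between hm1
  have hc0 : c ≠ 0 := (bot_le.trans_lt hc1).ne'
  have hct : c ≠ ∞ := (hc2.trans ENNReal.one_lt_top).ne
  set r := c⁻¹ with hr
  have hr1 : 1 < r := ENNReal.one_lt_inv.2 hc2
  have hrt : r ≠ ∞ := ENNReal.inv_ne_top.2 hc0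
  have hr0 : r ≠ 0 := (zero_lt_one.trans hr1).ne'
  have hθ : r * m < 1 := by
    rw [mul_comm, ← div_eq_mul_inv]
    exact (ENNReal.div_lt_iff (Or.inl hc0) (Or.inl hct)).2 (by simpa using hc1)
  obtain ⟨θ, hθ1, hθ2⟩ := exists_between hθ
  -- the factor `lam` is paid back each time the set of waiting types grows
  set lam := (θ - r * m) / r with hlam
  have hlam0 : lam ≠ 0 := ENNReal.div_ne_zero.2 ⟨(tsub_pos_of_lt hθ1).ne', hrt⟩
  have hlam1 : lam ≤ 1 := by
    refine ENNReal.div_le_of_le_mul ?_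
    rw [one_mul]
    exact tsub_le_self.trans (hθ2.le.trans hr1.le)
  have hsum : r * m + r * lam = θ := by
    rw [hlam, ENNReal.mul_div_cancel hr0 hrt, add_tsub_cancel_of_le hθ1.le]
  set K := (lam ^ Fintype.card A)⁻¹ with hK
  have hKt : K ≠ ∞ := ENNReal.inv_ne_top.2 (pow_ne_zero _ hlam0)
  have h0 : ∀ U, ∑' l, lineWeight E a b r 0 U l ≤ 1 := by
    intro U
    rw [tsum_list]
    simp only [lineWeight, tsum_zero, add_zero]
    split_ifs <;> simp
  have huniv : ∀ n, ∑' l, lineWeight E a b r n Finset.univ l = 0 := by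
    intro n
    induction n with
    | zero => rw [tsum_list]; simp [lineWeight]
    | succ n ih => rw [tsum_lineWeight_succ]; simp [ih]
  have hbound : ∀ n, ∀ U : Finset A, U ≠ ∅ →
      ∑' l, lineWeight E a b r n U l ≤ K * lam ^ U.card * θ ^ n := by
    intro n
    induction n with
    | zero =>
      intro U _
      refine (h0 U).trans ?_
      rw [pow_zero, mul_one]
      calc (1 : ℝ≥0∞) = K * lam ^ Fintype.card A :=
            (ENNReal.inv_mul_cancel (pow_ne_zero _ hlam0)
              (ENNReal.pow_ne_top (hlam1.trans_lt ENNReal.one_lt_top).ne)).symm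
        _ ≤ K * lam ^ U.card := by
            exact mul_le_mul_right (pow_le_pow_right_of_le_one' hlam1 (Finset.card_le_univ U)) K
    | succ n ih =>
      intro U hU
      by_cases hU' : U = Finset.univ
      · rw [hU', huniv]; simp
      rw [tsum_lineWeight_succ]
      have hx : ∀ x, a x * r * ∑' l, lineWeight E a b r n (insert x U) l ≤
          (if x ∈ U then a x else 0) * (r * (K * lam ^ U.card * θ ^ n)) +
            a x * (r * lam * (K * lam ^ U.card * θ ^ n)) := by
        intro x
        by_cases hxU : x ∈ U
        · rw [if_pos hxU, Finset.insert_eq_of_mem hxU, mul_assoc]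
          exact le_add_right (by gcongr; exact ih U hU)
        · refine le_add_left ?_
          calc a x * r * ∑' l, lineWeight E a b r n (insert x U) l
              ≤ a x * r * (K * lam ^ (insert x U).card * θ ^ n) := by
                gcongr; exact ih _ (Finset.insert_ne_empty _ _)
            _ = _ := by rw [Finset.card_insert_of_notMem hxU, pow_succ]; ring
      calc _ ≤ (∑ x, ((if x ∈ U then a x else 0) * (r * (K * lam ^ U.card * θ ^ n)) +
            a x * (r * lam * (K * lam ^ U.card * θ ^ n)))) +
            idleWeight E b U * (r * (K * lam ^ U.card * θ ^ n)) := by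
              gcongr with x
              · exact hx x
              · refine (ih U hU).trans ?_
                exact le_mul_of_one_le_left' hr1.le
        _ = (r * (∑ x ∈ U, a x + idleWeight E b U) + r * lam) * (K * lam ^ U.card * θ ^ n) := by
              rw [Finset.sum_add_distrib, ← Finset.sum_mul, ← Finset.sum_mul, ha,
                Finset.sum_ite_mem, Finset.univ_inter]
              ring
        _ ≤ (r * m + r * lam) * (K * lam ^ U.card * θ ^ n) := by
              gcongr; exact hm U hU hU'
        _ = K * lam ^ U.card * θ ^ (n + 1) := by rw [hsum, pow_succ]; ring
  refine ⟨r, hr1, 1 + r * K * (1 - θ)⁻¹, ?_, fun n => ?_⟩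
  · have : (1 - θ)⁻¹ ≠ ∞ := ENNReal.inv_ne_top.2 (tsub_pos_of_lt hθ2).ne'
    exact ENNReal.add_ne_top.2 ⟨ENNReal.one_ne_top, ENNReal.mul_ne_top (ENNReal.mul_ne_top hrt hKt)
      this⟩
  · have hn : ∑' l, lineWeight E a b r n ∅ l ≤ 1 + r * K * ∑ k ∈ Finset.range n, θ ^ k := by
      induction n with
      | zero => simpa using h0 ∅
      | succ n ih =>
        rw [tsum_lineWeight_succ]
        have hidle : idleWeight E b ∅ = 1 := by simp [idleWeight, hb]
        calc _ ≤ (∑ x, a x * r * (K * θ ^ n)) + 1 * (1 + r * K * ∑ k ∈ Finset.range n, θ ^ k) := by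
              rw [hidle]
              gcongr with x
              refine (hbound n _ (Finset.insert_ne_empty x ∅)).trans ?_
              gcongr
              exact mul_le_of_le_one_right' (pow_le_one' hlam1 _)
          _ = _ := by
              rw [← Finset.sum_mul, ← Finset.sum_mul, ha, Finset.sum_range_succ]
              ring
    refine hn.trans ?_
    gcongr
    rw [← ENNReal.tsum_geometric]
    exact ENNReal.sum_le_tsum _

end LineSum

/-! ### Tightness of the number of waiting pairs -/

section Tail

variable {𝒞 𝒮 : Type*} [Fintype 𝒞] [Fintype 𝒮] {E : 𝒞 → 𝒮 → Prop}

/-- Complete resource pooling says that the customer types in `U` and the server types incompatible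
with all of `U` have total mass less than one. -/
lemma sum_add_idleWeight_lt_one {α : PMF 𝒞} {β : PMF 𝒮} (hcrp : CompleteResourcePooling E α β)
    (U : Finset 𝒞) (h : U ≠ ∅) (h' : U ≠ Finset.univ) :
    ∑ x ∈ U, α x + idleWeight E β U < 1 := by
  classical
  have h1 : ∑ j ∈ compatServers E U, β j + idleWeight E β U = 1 := by
    rw [idleWeight, compatServers, Finset.sum_filter, ← Finset.sum_add_distrib,
      ← β.tsum_coe, tsum_fintype]
    refine Finset.sum_congr rfl fun y _ => ?_
    by_cases hy : ∃ x ∈ U, E x y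
    · simp only [hy, if_true, add_zero]
    · simp only [hy, if_false, zero_add]
  rw [← h1]
  refine ENNReal.add_lt_add_right ?_ (hcrp U h h')
  intro ht
  rw [ht, add_top] at h1
  simp at h1

/-- Complete resource pooling is symmetric in customers and servers. -/
lemma sum_add_idleWeight_lt_one' (hE : (compatGraph E).Connected) {α : PMF 𝒞} {β : PMF 𝒮}
    (hβ : ∀ j, β j ≠ 0) (hcrp : CompleteResourcePooling E α β)
    (V : Finset 𝒮) (h : V ≠ ∅) (h' : V ≠ Finset.univ) :
    ∑ y ∈ V, β y + idleWeight (fun y x => E x y) α V < 1 := by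
  classical
  have hβ1 : ∑ y, β y = 1 := by rw [← β.tsum_coe, tsum_fintype]
  have hα1 : ∑ x, α x = 1 := by rw [← α.tsum_coe, tsum_fintype]
  -- the customer types that are incompatible with all of `V`
  set C := Finset.univ.filter fun x => ¬ ∃ y ∈ V, E x y with hC
  have hidle : idleWeight (fun y x => E x y) α V = ∑ x ∈ C, α x := by
    rw [idleWeight, hC, Finset.sum_filter]
    refine Finset.sum_congr rfl fun x _ => ?_
    by_cases hx : ∃ y ∈ V, E x y
    · rw [if_pos hx, if_neg (not_not.2 hx)]
    · rw [if_neg hx, if_pos hx]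
  have hdisj : Disjoint V (compatServers E C) := by
    rw [Finset.disjoint_left]
    intro y hy hy'
    simp only [compatServers, Finset.mem_filter, Finset.mem_univ, true_and] at hy'
    obtain ⟨x, hx, hxy⟩ := hy'
    rw [hC, Finset.mem_filter] at hx
    exact hx.2 ⟨y, hy, hxy⟩
  have hfin : ∑ y ∈ V, β y ≠ ∞ := ENNReal.sum_ne_top.2 fun y _ => β.apply_ne_top y
  rw [hidle]
  by_cases hC0 : C = ∅
  · rw [hC0, Finset.sum_empty, add_zero]
    obtain ⟨y, hy⟩ : ∃ y, y ∉ V := by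
      by_contra! hall
      exact h' (Finset.eq_univ_iff_forall.2 hall)
    calc ∑ y ∈ V, β y < ∑ y ∈ V, β y + β y := ENNReal.lt_add_right hfin (hβ y)
      _ = ∑ y ∈ insert y V, β y := by rw [Finset.sum_insert hy, add_comm]
      _ ≤ ∑ y, β y := Finset.sum_le_sum_of_subset (Finset.subset_univ _)
      _ = 1 := hβ1
  · have hC1 : C ≠ Finset.univ := by
      intro hu
      obtain ⟨y, hy⟩ := Finset.nonempty_iff_ne_empty.2 h
      obtain ⟨x₀⟩ : Nonempty 𝒞 := α.support_nonempty.to_type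
      obtain ⟨k, hk⟩ := exists_reachIn hE x₀ y
      obtain ⟨x, hx⟩ := hk.exists_right
      have : x ∈ C := hu ▸ Finset.mem_univ x
      rw [hC, Finset.mem_filter] at this
      exact this.2 ⟨y, hy, hx⟩
    calc ∑ y ∈ V, β y + ∑ x ∈ C, α x < ∑ y ∈ V, β y + ∑ y ∈ compatServers E C, β y :=
          ENNReal.add_lt_add_left hfin (hcrp C hC0 hC1)
      _ = ∑ y ∈ V ∪ compatServers E C, β y := (Finset.sum_union hdisj).symm
      _ ≤ ∑ y, β y := Finset.sum_le_sum_of_subset (Finset.subset_univ _)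
      _ = 1 := hβ1

open Classical in
/-- The number of waiting pairs, for the system started empty, is tight uniformly in time. The
exchange transformation is injective and preserves probabilities, so the probability of a
set of words is at most the sum of the weights of the corresponding pairs of lines. -/
lemma exists_tsum_wordWeight_size_le (hE : (compatGraph E).Connected) {α : PMF 𝒞} {β : PMF 𝒮}
    (hβ : ∀ j, β j ≠ 0) (hcrp : CompleteResourcePooling E α β)
    {ε : ℝ≥0∞} (hε : ε ≠ 0) :
    ∃ B : ℕ, ∀ n, (∑' w : List (𝒞 × 𝒮), if w.length = n ∧ B < ((PairState.empty E).run w).size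
      then wordWeight α β w else 0) ≤ ε := by
  have hβ1 : ∑ y, β y = 1 := by rw [← β.tsum_coe, tsum_fintype]
  have hα1 : ∑ x, α x = 1 := by rw [← α.tsum_coe, tsum_fintype]
  obtain ⟨r, hr, K, hK, hKn⟩ := exists_tsum_lineWeight_le hα1 hβ1 (sum_add_idleWeight_lt_one hcrp)
  obtain ⟨r', hr', K', hK', hKn'⟩ := exists_tsum_lineWeight_le hβ1 hα1
    (sum_add_idleWeight_lt_one' hE hβ hcrp)
  obtain ⟨B, hB⟩ : ∃ B : ℕ, K * K' / ε ≤ r ^ B := by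
    have ht : K * K' / ε < ∞ :=
      ENNReal.div_lt_top (ENNReal.mul_ne_top hK hK') hε
    have := ENNReal.tendsto_pow_atTop_nhds_top_iff.2 hr
    exact ((this.eventually (lt_mem_nhds ht)).exists).imp fun _ h => h.le
  refine ⟨B, fun n => ?_⟩
  set f : List (𝒞 ⊕ 𝒮) × List (𝒮 ⊕ 𝒞) → ℝ≥0∞ := fun q =>
    lineWeight E α β r n ∅ q.1 * lineWeight (fun y x => E x y) β α r' n ∅ q.2 with hf
  have hle : ∀ w : List (𝒞 × 𝒮), r ^ B * (if w.length = n ∧ B < ((PairState.empty E).run w).size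
      then wordWeight α β w else 0) ≤ f (lines E w) := by
    intro w
    split_ifs with hw
    swap
    · simp
    obtain ⟨rfl, hw⟩ := hw
    have hq := waiting_lines E w
    have hval := isValid_lines E w
    set z := (PairState.empty E).run w
    have hq1 : waiting (lines E w).1 = z.customers := congrArg Prod.fst hq
    have hq2 : waiting (lines E w).2 = z.servers := congrArg Prod.snd hq
    have hpos : 0 < z.customers.length := lt_of_le_of_lt (Nat.zero_le _) hw
    -- isolated vertex
    obtain ⟨x, hx⟩ := List.exists_mem_of_length_pos hpos
    obtain ⟨y, hy⟩ := List.exists_mem_of_length_pos (z.length_eq ▸ hpos)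
    obtain ⟨k, hk⟩ := exists_reachIn hE x y
    obtain ⟨j, hj⟩ := hk.exists_left
    obtain ⟨i, hi⟩ := hk.exists_right
    have h1 : lineWeight E α β r w.length ∅ (lines E w).1 = _ :=
      (length_lines E w).1 ▸ lineWeight_eq α β r (lines E w).1 ∅ hval.left (by simp)
      ⟨i, by simp, by rw [hq1]; exact fun h => z.incompatible i h y hy hi⟩
    have h2 : lineWeight (fun y x => E x y) β α r' w.length ∅ (lines E w).2 = _ :=
      (length_lines E w).2 ▸ lineWeight_eq β α r' (lines E w).2 ∅ hval.right (by simp)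
      ⟨j, by simp, by rw [hq2]; exact fun h => z.incompatible x hx j h hj⟩
    rw [hf]
    simp only
    rw [h1, h2, ← weight_lines E, hq1]
    calc _ = r ^ B * weight α β (lines E w).1 * (1 * weight β α (lines E w).2) := by ring
      _ ≤ _ := by
        gcongr
        · exact hr.le
        · exact hw.le
        · exact one_le_pow_of_one_le' hr'.le _
  have hsum : r ^ B * (∑' w : List (𝒞 × 𝒮), if w.length = n ∧ B < ((PairState.empty E).run w).size
      then wordWeight α β w else 0) ≤ K * K' := by
    rw [← ENNReal.tsum_mul_left]
    calc _ ≤ ∑' w, f (lines E w) := ENNReal.tsum_le_tsum hle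
      _ ≤ ∑' q, f q := ENNReal.tsum_comp_le_tsum_of_injective (lines_injective E) f
      _ = (∑' l, lineWeight E α β r n ∅ l) *
            ∑' l, lineWeight (fun y x => E x y) β α r' n ∅ l := by
          rw [ENNReal.tsum_prod']
          simp only [hf, ENNReal.tsum_mul_left, ENNReal.tsum_mul_right]
      _ ≤ K * K' := by gcongr; exacts [hKn n, hKn' n]
  -- `r` may be infinite, in which case the bound on the sum forces it to vanish
  rcases eq_or_ne ε ∞ with rfl | hεt
  · exact le_top
  have hr0 : r ^ B ≠ 0 := pow_ne_zero _ (zero_lt_one.trans hr).ne'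
  have h3 : K * K' ≤ r ^ B * ε := by
    rwa [ENNReal.div_le_iff hε hεt] at hB
  by_cases hrt : r ^ B = ∞
  · by_contra hcon
    have : (∑' w : List (𝒞 × 𝒮), if w.length = n ∧ B < ((PairState.empty E).run w).size
      then wordWeight α β w else 0) ≠ 0 := fun h0 => hcon (by rw [h0]; exact zero_le)
    rw [hrt, ENNReal.top_mul this] at hsum
    exact ENNReal.mul_ne_top hK hK' (top_le_iff.1 hsum)
  · exact (ENNReal.mul_le_mul_iff_right hr0 hrt).1 (hsum.trans h3)

end Tail

/-! ### FCFS matchings of half-lines -/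

section Matching

variable {𝒞 𝒮 : Type*} {E : 𝒞 → 𝒮 → Prop} {c : ℤ → 𝒞} {s : ℤ → 𝒮}

/-- The pairs of the FCFS matching of the items at positions `> a`, by recursion on the positions:
`m` and `n` are matched when both have been refused by all earlier compatible items of the
other side, because those were matched to items arriving before `m`, respectively `n`. -/
def IsFCFSPair (E : 𝒞 → 𝒮 → Prop) (c : ℤ → 𝒞) (s : ℤ → 𝒮) (a m n : ℤ) : Prop :=
  a < m ∧ a < n ∧ E (c m) (s n) ∧
    (∀ l, ∀ (_ : a < l) (_ : l < n), E (c m) (s l) →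
      ∃ k, ∃ (_ : a < k) (_ : k < m), IsFCFSPair E c s a k l) ∧
    (∀ k, ∀ (_ : a < k) (_ : k < m), E (c k) (s n) →
      ∃ l, ∃ (_ : a < l) (_ : l < n), IsFCFSPair E c s a k l)
termination_by (m - a).toNat + (n - a).toNat
decreasing_by all_goals omega

/-- The FCFS matching of the items at positions `> a`. -/
def fcfs (E : 𝒞 → 𝒮 → Prop) (c : ℤ → 𝒞) (s : ℤ → 𝒮) (a : ℤ) : Set (ℤ × ℤ) :=
  {p | IsFCFSPair E c s a p.1 p.2}

lemma mem_fcfs_iff {a m n : ℤ} : (m, n) ∈ fcfs E c s a ↔ a < m ∧ a < n ∧ E (c m) (s n) ∧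
    (∀ l, a < l → l < n → E (c m) (s l) → ∃ k, a < k ∧ k < m ∧ (k, l) ∈ fcfs E c s a) ∧
    (∀ k, a < k → k < m → E (c k) (s n) → ∃ l, a < l ∧ l < n ∧ (k, l) ∈ fcfs E c s a) := by
  conv_lhs => rw [fcfs, Set.mem_ofPred_eq, IsFCFSPair]
  simp only [exists_prop, fcfs, Set.mem_ofPred_eq]

/-- The matching with the roles of customers and servers exchanged. -/
def swapMatching (A : Set (ℤ × ℤ)) : Set (ℤ × ℤ) := {p | p.swap ∈ A}

@[simp] lemma mem_swapMatching {A : Set (ℤ × ℤ)} {m n : ℤ} :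
    (m, n) ∈ swapMatching A ↔ (n, m) ∈ A := Iff.rfl

lemma IsFCFSMatching.swap {T : Set ℤ} {A : Set (ℤ × ℤ)} (h : IsFCFSMatching E c s T T A) :
    IsFCFSMatching (fun j i => E i j) s c T T (swapMatching A) where
  subset := fun p hp => ⟨(h.subset hp).2, (h.subset hp).1⟩
  compatible := fun m n hA => h.compatible n m hA
  server_unique := fun m n n' h1 h2 => h.customer_unique n n' m h1 h2
  customer_unique := fun m m' n h1 h2 => h.server_unique n m m' h1 h2
  complete := fun m hm n hn h1 h2 => h.complete n hn m hm h2 h1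
  fcfs_server := fun m n hA l hl hln hE => by
    obtain ⟨k, hk, h'⟩ := h.fcfs_customer n m hA l hl hln hE
    exact ⟨k, hk, h'⟩
  fcfs_customer := fun m n hA l hl hln hE => by
    obtain ⟨k, hk, h'⟩ := h.fcfs_server n m hA l hl hln hE
    exact ⟨k, hk, h'⟩

lemma swapMatching_fcfs (a : ℤ) :
    swapMatching (fcfs E c s a) = fcfs (fun j i => E i j) s c a := by
  have key : ∀ N : ℕ, ∀ m n, (m - a).toNat + (n - a).toNat < N →
      ((m, n) ∈ swapMatching (fcfs E c s a) ↔ (m, n) ∈ fcfs (fun j i => E i j) s c a) := by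
    intro N
    induction N with
    | zero => intro m n h; omega
    | succ N ih =>
      intro m n hN
      rw [mem_swapMatching, mem_fcfs_iff, mem_fcfs_iff]
      constructor
      · rintro ⟨h1, h2, h3, h4, h5⟩
        refine ⟨h2, h1, h3, fun l hl hl' hE => ?_, fun k hk hk' hE => ?_⟩
        · obtain ⟨k, hk, hk', hm⟩ := h5 l hl hl' hE
          exact ⟨k, hk, hk', (ih k l (by omega)).1 hm⟩
        · obtain ⟨l, hl, hl', hm⟩ := h4 k hk hk' hE
          exact ⟨l, hl, hl', (ih k l (by omega)).1 hm⟩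
      · rintro ⟨h1, h2, h3, h4, h5⟩
        refine ⟨h2, h1, h3, fun l hl hl' hE => ?_, fun k hk hk' hE => ?_⟩
        · obtain ⟨k, hk, hk', hm⟩ := h5 l hl hl' hE
          exact ⟨k, hk, hk', (ih l k (by omega)).2 hm⟩
        · obtain ⟨l, hl, hl', hm⟩ := h4 k hk hk' hE
          exact ⟨l, hl, hl', (ih l k (by omega)).2 hm⟩
  ext ⟨m, n⟩
  exact key _ m n (Nat.lt_succ_self _)

/-- A customer has at most one server in `fcfs`: two servers for one customer would produce two
servers for an earlier customer. -/
lemma fcfs_server_unique (a : ℤ) : ∀ m n n', (m, n) ∈ fcfs E c s a → (m, n') ∈ fcfs E c s a →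
    n = n' := by
  have key : ∀ N : ℕ, ∀ m n n', (m - a).toNat < N → n < n' → (m, n) ∈ fcfs E c s a →
      (m, n') ∉ fcfs E c s a := by
    intro N
    induction N with
    | zero => intro m n n' h; omega
    | succ N ih =>
      intro m n n' hN hlt h1 h2
      obtain ⟨a1, a2, a3, a4, a5⟩ := mem_fcfs_iff.1 h1
      obtain ⟨b1, b2, b3, b4, b5⟩ := mem_fcfs_iff.1 h2
      obtain ⟨k, hk, hkm, hkn⟩ := b4 n a2 hlt a3
      obtain ⟨l, hl, hln, hkl⟩ := a5 k hk hkm (mem_fcfs_iff.1 hkn).2.2.1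
      exact ih k l n (by omega) hln hkl hkn
  intro m n n' h1 h2
  rcases lt_trichotomy n n' with h | h | h
  · exact absurd h2 (key _ m n n' (Nat.lt_succ_self _) h h1)
  · exact h
  · exact absurd h1 (key _ m n' n (Nat.lt_succ_self _) h h2)

lemma fcfs_customer_unique (a : ℤ) : ∀ m m' n, (m, n) ∈ fcfs E c s a → (m', n) ∈ fcfs E c s a →
    m = m' := by
  intro m m' n h1 h2
  refine fcfs_server_unique (E := fun j i => E i j) (c := s) (s := c) a n m m' ?_ ?_ <;>
  rw [← swapMatching_fcfs] <;> assumption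

lemma isFCFSMatching_fcfs (a : ℤ) :
    IsFCFSMatching E c s (Set.Ioi a) (Set.Ioi a) (fcfs E c s a) where
  subset := fun p hp => ⟨(mem_fcfs_iff.1 hp).1, (mem_fcfs_iff.1 hp).2.1⟩
  compatible := fun m n h => (mem_fcfs_iff.1 h).2.2.1
  server_unique := fcfs_server_unique a
  customer_unique := fcfs_customer_unique a
  complete := by
    have key : ∀ N : ℕ, ∀ m n, (m - a).toNat + (n - a).toNat < N → a < m → a < n →
        (∀ n', (m, n') ∉ fcfs E c s a) → (∀ m', (m', n) ∉ fcfs E c s a) →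
        ¬ E (c m) (s n) := by
      intro N
      induction N with
      | zero => intro m n h; omega
      | succ N ih =>
        intro m n hN hm hn h1 h2 hE
        -- a compatible earlier item on either side was matched to an earlier partner, for otherwise
        -- it would form with `m` or `n` an unmatched compatible pair at earlier positions
        refine h1 n (mem_fcfs_iff.2 ⟨hm, hn, hE, ?_, ?_⟩)
        · intro l hl hln hml
          by_contra hcon
          push Not at hcon
          refine ih m l (by omega) hm hl h1 (fun k hkl => ?_) hml
          rcases lt_trichotomy k m with hk | rfl | hk
          · exact hcon k (mem_fcfs_iff.1 hkl).1 hk hkl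
          · exact h1 l hkl
          · obtain ⟨l', -, -, h⟩ := (mem_fcfs_iff.1 hkl).2.2.2.2 m hm hk hml
            exact h1 l' h
        · intro k hk hkm hkn
          by_contra hcon
          push Not at hcon
          refine ih k n (by omega) hk hn (fun l hkl => ?_) h2 hkn
          rcases lt_trichotomy l n with hl | rfl | hl
          · exact hcon l (mem_fcfs_iff.1 hkl).2.1 hl hkl
          · exact h2 k hkl
          · obtain ⟨k', -, -, h⟩ := (mem_fcfs_iff.1 hkl).2.2.2.1 n hn hl hkn
            exact h2 k' h
    exact fun m hm n hn => key _ m n (Nat.lt_succ_self _) hm hn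
  fcfs_server := fun m n h l hl hln hE => by
    obtain ⟨k, -, hk, h'⟩ := (mem_fcfs_iff.1 h).2.2.2.1 l hl hln hE
    exact ⟨k, hk, h'⟩
  fcfs_customer := fun m n h k hk hkm hE => by
    obtain ⟨l, -, hl, h'⟩ := (mem_fcfs_iff.1 h).2.2.2.2 k hk hkm hE
    exact ⟨l, hl, h'⟩

/-- The FCFS matching of a half-line is unique, since an FCFS matching satisfies the recursion that
defines `fcfs`. -/
lemma IsFCFSMatching.eq_fcfs {a : ℤ} {A : Set (ℤ × ℤ)}
    (h : IsFCFSMatching E c s (Set.Ioi a) (Set.Ioi a) A) : A = fcfs E c s a := by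
  have key : ∀ N : ℕ, ∀ m n, (m - a).toNat + (n - a).toNat < N →
      ((m, n) ∈ A ↔ (m, n) ∈ fcfs E c s a) := by
    intro N
    induction N with
    | zero => intro m n h; omega
    | succ N ih =>
      intro m n hN
      rw [mem_fcfs_iff]
      constructor
      · intro hA
        have hm : a < m := (h.subset hA).1
        have hn : a < n := (h.subset hA).2
        refine ⟨hm, hn, h.compatible _ _ hA, fun l hl hln hE => ?_, fun k hk hkm hE => ?_⟩
        · obtain ⟨k, hk, h'⟩ := h.fcfs_server m n hA l hl hln hE
          have : a < k := (h.subset h').1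
          exact ⟨k, this, hk, (ih k l (by omega)).1 h'⟩
        · obtain ⟨l, hl, h'⟩ := h.fcfs_customer m n hA k hk hkm hE
          have : a < l := (h.subset h').2
          exact ⟨l, this, hl, (ih k l (by omega)).1 h'⟩
      · rintro ⟨hm, hn, hE, h1, h2⟩
        have h1' : ∀ l, a < l → l < n → E (c m) (s l) → ∃ k < m, (k, l) ∈ A := by
          intro l hl hln hml
          obtain ⟨k, hk, hkm, h'⟩ := h1 l hl hln hml
          exact ⟨k, hkm, (ih k l (by omega)).2 h'⟩
        have h2' : ∀ k, a < k → k < m → E (c k) (s n) → ∃ l < n, (k, l) ∈ A := by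
          intro k hk hkm hkn
          obtain ⟨l, hl, hln, h'⟩ := h2 k hk hkm hkn
          exact ⟨l, hln, (ih k l (by omega)).2 h'⟩
        by_contra hA
        by_cases hex : ∃ n', (m, n') ∈ A
        · obtain ⟨n', hn'⟩ := hex
          rcases lt_trichotomy n' n with hlt | rfl | hlt
          · obtain ⟨k, hk, hkA⟩ := h1' n' (h.subset hn').2 hlt (h.compatible _ _ hn')
            exact hk.ne (h.customer_unique _ _ _ hkA hn')
          · exact hA hn'
          · obtain ⟨k, hk, hkA⟩ := h.fcfs_server m n' hn' n hn hlt hE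
            obtain ⟨l, hl, hlA⟩ := h2' k (h.subset hkA).1 hk (h.compatible _ _ hkA)
            exact hl.ne (h.server_unique _ _ _ hlA hkA)
        · push Not at hex
          by_cases hex' : ∃ m', (m', n) ∈ A
          · obtain ⟨m', hm'⟩ := hex'
            rcases lt_trichotomy m' m with hlt | rfl | hlt
            · obtain ⟨l, hl, hlA⟩ := h2' m' (h.subset hm').1 hlt (h.compatible _ _ hm')
              exact hl.ne (h.server_unique _ _ _ hlA hm')
            · exact hA hm'
            · obtain ⟨l, hl, hlA⟩ := h.fcfs_customer m' n hm' m hm hlt hE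
              exact hex l hlA
          · push Not at hex'
            exact h.complete m hm n hn hex hex' hE
  ext ⟨m, n⟩
  exact key _ m n (Nat.lt_succ_self _)

/-! ### The states left by a matching -/

/-- `HasState T A N z`: among the items with positions in `T`, those at positions `≤ N` that the
matching `A` does not match among themselves form the state `z`. -/
def HasState (c : ℤ → 𝒞) (s : ℤ → 𝒮) (T : Set ℤ) (A : Set (ℤ × ℤ)) (N : ℤ) (z : PairState E) :
    Prop :=
  ∃ lu lv : List ℤ, lu.Pairwise (· < ·) ∧ lv.Pairwise (· < ·) ∧
    (∀ m, m ∈ lu ↔ m ∈ T ∧ m ∈ unmatchedCustomers A N) ∧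
    (∀ n, n ∈ lv ↔ n ∈ T ∧ n ∈ unmatchedServers A N) ∧
    z.customers = lu.map c ∧ z.servers = lv.map s

/-- In an increasing list, `eraseP p` erases the least entry with `p`. -/
lemma mem_eraseP_of_pairwise_lt {p : ℤ → Bool} {l : List ℤ} (hl : l.Pairwise (· < ·)) {m : ℤ} :
    m ∈ l.eraseP p ↔ m ∈ l ∧ ¬ (p m = true ∧ ∀ k ∈ l, k < m → ¬ p k = true) := by
  induction l with
  | nil => simp
  | cons x l ih =>
    obtain ⟨h1, h2⟩ := List.pairwise_cons.1 hl
    rw [List.eraseP_cons]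
    by_cases hx : p x = true
    · rw [hx, cond_true]
      constructor
      · intro hm
        refine ⟨List.mem_cons_of_mem _ hm, fun h => h.2 x (by simp) (h1 m hm) hx⟩
      · rintro ⟨hm, h⟩
        rcases List.mem_cons.1 hm with rfl | hm
        · refine absurd ⟨hx, fun k hk hkm => ?_⟩ h
          rcases List.mem_cons.1 hk with rfl | hk
          · exact absurd hkm (lt_irrefl _)
          · exact absurd hkm (h1 k hk).not_gt
        · exact hm
    · have hx' : p x = false := by simpa using hx
      rw [hx', cond_false, List.mem_cons, List.mem_cons, ih h2]
      constructor
      · rintro (rfl | ⟨hm, h⟩)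
        · exact ⟨Or.inl rfl, fun h => hx h.1⟩
        · exact ⟨Or.inr hm, fun h' => h ⟨h'.1, fun k hk => h'.2 k (List.mem_cons_of_mem _ hk)⟩⟩
      · rintro ⟨rfl | hm, h⟩
        · exact Or.inl rfl
        · refine Or.inr ⟨hm, fun h' => h ⟨h'.1, fun k hk hkm => ?_⟩⟩
          rcases List.mem_cons.1 hk with rfl | hk
          · exact hx
          · exact h'.2 k hk hkm

namespace IsFCFSMatching

variable {T : Set ℤ} {A : Set (ℤ × ℤ)}

lemma not_compatible_of_unmatched (h : IsFCFSMatching E c s T T A) {N m n : ℤ} (hm : m ∈ T)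
    (hn : n ∈ T) (hm' : m ∈ unmatchedCustomers A N) (hn' : n ∈ unmatchedServers A N) :
    ¬ E (c m) (s n) := by
  intro hE
  by_cases h1 : ∃ n', (m, n') ∈ A
  · obtain ⟨n', h1⟩ := h1
    have hlt : N < n' := by
      by_contra hcon
      exact hm'.2 n' (not_lt.1 hcon) h1
    obtain ⟨k, hk, hkA⟩ := h.fcfs_server m n' h1 n hn (hn'.1.trans_lt hlt) hE
    exact hn'.2 k (hk.le.trans hm'.1) hkA
  · push Not at h1
    by_cases h2 : ∃ m', (m', n) ∈ A
    · obtain ⟨m', h2⟩ := h2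
      have hlt : N < m' := by
        by_contra hcon
        exact hn'.2 m' (not_lt.1 hcon) h2
      obtain ⟨l, hl, hlA⟩ := h.fcfs_customer m' n h2 m hm (hm'.1.trans_lt hlt) hE
      exact h1 l hlA
    · push Not at h2
      exact h.complete m hm n hn h1 h2 hE

/-- The new server takes the earliest compatible waiting customer. -/
lemma mem_iff_of_unmatched (h : IsFCFSMatching E c s T T A) {N m : ℤ} (hN : N + 1 ∈ T)
    (hm : m ∈ T) (hm' : m ∈ unmatchedCustomers A N) :
    (m, N + 1) ∈ A ↔ E (c m) (s (N + 1)) ∧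
      ∀ k ∈ T, k ∈ unmatchedCustomers A N → k < m → ¬ E (c k) (s (N + 1)) := by
  have hun : ∀ k, k ≤ N → (k, N + 1) ∈ A → k ∈ unmatchedCustomers A N := by
    refine fun k hk hA => ⟨hk, fun n hn hA' => ?_⟩
    have := h.server_unique _ _ _ hA hA'
    omega
  constructor
  · intro hA
    refine ⟨h.compatible _ _ hA, fun k hk hk' hkm hE => ?_⟩
    obtain ⟨l, hl, hlA⟩ := h.fcfs_customer m (N + 1) hA k hk hkm hE
    exact hk'.2 l (by omega) hlA
  · rintro ⟨hE, hall⟩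
    by_contra hA
    by_cases h1 : ∃ n', (m, n') ∈ A
    · obtain ⟨n', h1⟩ := h1
      have hlt : N + 1 < n' := by
        by_contra hcon
        rcases (not_lt.1 hcon).eq_or_lt with rfl | hlt
        · exact hA h1
        · exact hm'.2 n' (by omega) h1
      obtain ⟨k, hk, hkA⟩ := h.fcfs_server m n' h1 (N + 1) hN hlt hE
      exact hall k (h.subset hkA).1 (hun k (hk.le.trans hm'.1) hkA) hk (h.compatible _ _ hkA)
    · push Not at h1
      by_cases h2 : ∃ m', (m', N + 1) ∈ A
      · obtain ⟨m', h2⟩ := h2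
        rcases lt_trichotomy m' m with hlt | rfl | hlt
        · exact hall m' (h.subset h2).1 (hun m' (hlt.le.trans hm'.1) h2) hlt
            (h.compatible _ _ h2)
        · exact hA h2
        · obtain ⟨l, hl, hlA⟩ := h.fcfs_customer m' _ h2 m hm hlt hE
          exact h1 l hlA
      · push Not at h2
        exact h.complete m hm _ hN h1 h2 hE

/-- The new customer is matched on its arrival if it finds a compatible waiting server, or if it is
compatible with the new server and no waiting customer precedes it there. -/
lemma exists_mem_iff_new (h : IsFCFSMatching E c s T T A) {N : ℤ} (hN : N + 1 ∈ T) :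
    (∃ n ≤ N + 1, (N + 1, n) ∈ A) ↔
      (∃ n ∈ T, n ∈ unmatchedServers A N ∧ E (c (N + 1)) (s n)) ∨
      (E (c (N + 1)) (s (N + 1)) ∧
        ∀ k ∈ T, k ∈ unmatchedCustomers A N → ¬ E (c k) (s (N + 1))) := by
  constructor
  · rintro ⟨n, hn, hA⟩
    rcases hn.eq_or_lt with rfl | hlt
    · refine Or.inr ⟨h.compatible _ _ hA, fun k hk hk' hE => ?_⟩
      have hkN : k < N + 1 := by have := hk'.1; omega
      obtain ⟨l, hl, hlA⟩ := h.fcfs_customer _ _ hA k hk hkN hE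
      exact hk'.2 l (by omega) hlA
    · refine Or.inl ⟨n, (h.subset hA).2, ⟨by omega, fun m hm hA' => ?_⟩, h.compatible _ _ hA⟩
      have := h.customer_unique _ _ _ hA hA'
      omega
  · intro hor
    by_contra hcon
    push Not at hcon
    by_cases h1 : ∃ n', (N + 1, n') ∈ A
    · obtain ⟨n', h1⟩ := h1
      have hlt : N + 1 < n' := by
        by_contra hc
        exact hcon n' (not_lt.1 hc) h1
      rcases hor with ⟨n, hn, hn', hE⟩ | ⟨hE, hall⟩
      · have hnN : n ≤ N := hn'.1
        obtain ⟨k, hk, hkA⟩ := h.fcfs_server _ _ h1 n hn (by omega) hE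
        exact hn'.2 k (by omega) hkA
      · obtain ⟨k, hk, hkA⟩ := h.fcfs_server _ _ h1 _ hN hlt hE
        refine hall k (h.subset hkA).1 ⟨by omega, fun n hn hA' => ?_⟩ (h.compatible _ _ hkA)
        have := h.server_unique _ _ _ hkA hA'
        omega
    · push Not at h1
      rcases hor with ⟨n, hn, hn', hE⟩ | ⟨hE, hall⟩
      · by_cases h2 : ∃ m', (m', n) ∈ A
        · obtain ⟨m', h2⟩ := h2
          have hlt : N + 1 < m' := by
            by_contra hc
            rcases (not_lt.1 hc).eq_or_lt with rfl | hlt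
            · exact h1 n h2
            · exact hn'.2 m' (by omega) h2
          obtain ⟨l, hl, hlA⟩ := h.fcfs_customer _ _ h2 _ hN hlt hE
          exact h1 l hlA
        · push Not at h2
          exact h.complete _ hN n hn h1 h2 hE
      · by_cases h2 : ∃ m', (m', N + 1) ∈ A
        · obtain ⟨m', h2⟩ := h2
          rcases lt_trichotomy m' (N + 1) with hlt | rfl | hlt
          · refine hall m' (h.subset h2).1 ⟨by omega, fun n hn hA' => ?_⟩ (h.compatible _ _ h2)
            have := h.server_unique _ _ _ h2 hA'
            omega
          · exact h1 _ h2
          · obtain ⟨l, hl, hlA⟩ := h.fcfs_customer _ _ h2 _ hN hlt hE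
            exact h1 l hlA
        · push Not at h2
          exact h.complete _ hN _ hN h1 h2 hE

open Classical in
/-- The customers waiting at time `N + 1` are given by the customer half of `PairState.step`; the
server half is this statement for the matching with exchanged roles. -/
lemma exists_customers_step (h : IsFCFSMatching E c s T T A) {N : ℤ} (hN : N + 1 ∈ T)
    {lu lv : List ℤ} (hlu : lu.Pairwise (· < ·))
    (hu : ∀ m, m ∈ lu ↔ m ∈ T ∧ m ∈ unmatchedCustomers A N)
    (hv : ∀ n, n ∈ lv ↔ n ∈ T ∧ n ∈ unmatchedServers A N) :
    ∃ lu' : List ℤ, lu'.Pairwise (· < ·) ∧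
      (∀ m, m ∈ lu' ↔ m ∈ T ∧ m ∈ unmatchedCustomers A (N + 1)) ∧
      lu'.map c = (lu.map c).eraseP (fun x => decide (E x (s (N + 1)))) ++
        if (∃ y ∈ lv.map s, E (c (N + 1)) y) ∨
          (E (c (N + 1)) (s (N + 1)) ∧ ∀ x ∈ lu.map c, ¬ E x (s (N + 1))) then []
        else [c (N + 1)] := by
  set p : ℤ → Bool := fun m => decide (E (c m) (s (N + 1))) with hp
  have hcond : ((∃ y ∈ lv.map s, E (c (N + 1)) y) ∨
      (E (c (N + 1)) (s (N + 1)) ∧ ∀ x ∈ lu.map c, ¬ E x (s (N + 1)))) ↔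
      ∃ n ≤ N + 1, (N + 1, n) ∈ A := by
    rw [h.exists_mem_iff_new hN]
    have he : (∃ y ∈ lv.map s, E (c (N + 1)) y) ↔ ∃ n ∈ lv, E (c (N + 1)) (s n) := by simp
    simp only [he, List.forall_mem_map, hu, hv, and_assoc, and_imp]
  have hle : ∀ m ∈ lu, m ≤ N := fun m hm => ((hu m).1 hm).2.1
  have hmem : ∀ m, m ≤ N → (m ∈ lu.eraseP p ↔ m ∈ T ∧ m ∈ unmatchedCustomers A (N + 1)) := by
    intro m hm
    rw [mem_eraseP_of_pairwise_lt hlu, hu]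
    constructor
    · rintro ⟨⟨h1, h2⟩, h3⟩
      refine ⟨h1, by omega, fun n hn hA => ?_⟩
      rcases hn.eq_or_lt with rfl | hlt
      · obtain ⟨h4, h5⟩ := (h.mem_iff_of_unmatched hN h1 h2).1 hA
        refine h3 ⟨by simpa [hp] using h4, fun k hk hkm => ?_⟩
        simpa [hp] using h5 k ((hu k).1 hk).1 ((hu k).1 hk).2 hkm
      · exact h2.2 n (by omega) hA
    · rintro ⟨h1, h2⟩
      have h3 : m ∈ unmatchedCustomers A N := ⟨hm, fun n hn => h2.2 n (by omega)⟩
      refine ⟨⟨h1, h3⟩, fun ⟨h4, h5⟩ => ?_⟩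
      refine h2.2 (N + 1) le_rfl ((h.mem_iff_of_unmatched hN h1 h3).2
        ⟨by simpa [hp] using h4, fun k hk hk' hkm => ?_⟩)
      simpa [hp] using h5 k ((hu k).2 ⟨hk, hk'⟩) hkm
  refine ⟨lu.eraseP p ++ if ∃ n ≤ N + 1, (N + 1, n) ∈ A then [] else [N + 1], ?_, ?_, ?_⟩
  · refine List.pairwise_append.2 ⟨hlu.sublist List.eraseP_sublist, ?_, ?_⟩
    · split_ifs <;> simp
    · intro m hm n hn
      have h1 := hle m (List.mem_of_mem_eraseP hm)
      split_ifs at hn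
      · simp at hn
      · have : n = N + 1 := by simpa using hn
        omega
  · intro m
    rw [List.mem_append]
    rcases le_or_gt m N with hm | hm
    · rw [← hmem m hm]
      refine or_iff_left fun h' => ?_
      split_ifs at h'
      · simp at h'
      · have : m = N + 1 := by simpa using h'
        omega
    · have h1 : m ∉ lu.eraseP p := fun h' => by
        have := hle m (List.mem_of_mem_eraseP h')
        omega
      simp only [h1, false_or]
      split_ifs with h2
      · simp only [List.not_mem_nil, false_iff, not_and]
        intro hmT hmU
        have hmN : m = N + 1 := by have := hmU.1; omega
        subst hmN
        obtain ⟨n, hn, hA⟩ := h2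
        exact hmU.2 n hn hA
      · rw [List.mem_singleton]
        constructor
        · rintro rfl
          push Not at h2
          exact ⟨hN, le_rfl, h2⟩
        · rintro ⟨-, hmU⟩
          have := hmU.1
          omega
  · simp only [hcond]
    rw [List.map_append, List.eraseP_map]
    congr 1
    split_ifs <;> rfl

/-- The states left by an FCFS matching follow the pair by pair dynamics. -/
lemma hasState_step (h : IsFCFSMatching E c s T T A) {N : ℤ} (hN : N + 1 ∈ T) {z : PairState E}
    (hz : HasState c s T A N z) :
    HasState c s T A (N + 1) (z.step (c (N + 1)) (s (N + 1))) := by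
  obtain ⟨lu, lv, hlu, hlv, hu, hv, hzc, hzs⟩ := hz
  obtain ⟨lu', h1, h2, h3⟩ := h.exists_customers_step hN hlu hu hv
  obtain ⟨lv', h1', h2', h3'⟩ := h.swap.exists_customers_step hN hlv hv hu
  refine ⟨lu', lv', h1, h1', h2, h2', ?_, ?_⟩
  · rw [h3, ← hzc, ← hzs]
    rfl
  · rw [h3', ← hzc, ← hzs]
    rfl

end IsFCFSMatching

lemma hasState_empty_self (a : ℤ) (A : Set (ℤ × ℤ)) :
    HasState c s (Set.Ioi a) A a (PairState.empty E) := by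
  refine ⟨[], [], List.Pairwise.nil, List.Pairwise.nil, fun m => ?_, fun m => ?_, rfl, rfl⟩
  · simp only [List.not_mem_nil, false_iff, not_and]
    exact fun hm hm' => absurd hm'.1 (not_le.2 hm)
  · simp only [List.not_mem_nil, false_iff, not_and]
    exact fun hm hm' => absurd hm'.1 (not_le.2 hm)

lemma HasState.isStateAt {A : Set (ℤ × ℤ)} {N : ℤ} {z : PairState E}
    (h : HasState c s Set.univ A N z) : IsStateAt c s A N z := by
  obtain ⟨lu, lv, hlu, hlv, hu, hv, hzc, hzs⟩ := h
  refine ⟨lu.toFinset, lv.toFinset, ?_, ?_, ?_, ?_⟩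
  · ext m; simp [hu]
  · ext m; simp [hv]
  · rw [hzc, (List.toFinset_sort (· ≤ ·) (hlu.imp fun h => h.ne)).2 (hlu.imp fun h => h.le)]
  · rw [hzs, (List.toFinset_sort (· ≤ ·) (hlv.imp fun h => h.ne)).2 (hlv.imp fun h => h.le)]

lemma HasState.encard {A : Set (ℤ × ℤ)} {N : ℤ} {z : PairState E}
    (h : HasState c s Set.univ A N z) :
    (unmatchedCustomers A N).encard = z.size ∧ (unmatchedServers A N).encard = z.size := by
  obtain ⟨lu, lv, hlu, hlv, hu, hv, hzc, hzs⟩ := h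
  have key : ∀ (l : List ℤ) (U : Set ℤ), l.Pairwise (· < ·) → (∀ m, m ∈ l ↔ m ∈ Set.univ ∧ m ∈ U) →
      U.encard = l.length := by
    intro l U hl hm
    have : U = (l.toFinset : Set ℤ) := by ext m; simp [hm]
    rw [this, Set.encard_coe_eq_coe_finsetCard,
      List.toFinset_card_of_nodup (hl.imp fun h => h.ne)]
  refine ⟨?_, ?_⟩
  · rw [key lu _ hlu hu, PairState.size, hzc, List.length_map]
  · rw [key lv _ hlv hv, PairState.size, z.length_eq, hzs, List.length_map]

/-- A balanced queue of bounded size at time `N` is described by a state. -/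
lemma IsFCFSMatching.exists_hasState {A : Set (ℤ × ℤ)}
    (h : IsFCFSMatching E c s Set.univ Set.univ A) {N : ℤ} {B : ℕ}
    (heq : (unmatchedCustomers A N).encard = (unmatchedServers A N).encard)
    (hle : (unmatchedCustomers A N).encard ≤ B) :
    ∃ z : PairState E, z.size ≤ B ∧ HasState c s Set.univ A N z := by
  have hU : (unmatchedCustomers A N).Finite := Set.finite_of_encard_le_coe hle
  have hV : (unmatchedServers A N).Finite := Set.finite_of_encard_le_coe (heq ▸ hle)
  have hcard : hU.toFinset.card = hV.toFinset.card := by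
    have h1 := hU.encard_eq_coe_toFinset_card
    have h2 := hV.encard_eq_coe_toFinset_card
    rw [h1, h2] at heq
    exact_mod_cast heq
  have hmemU : ∀ m, m ∈ hU.toFinset.sort (· ≤ ·) ↔ m ∈ unmatchedCustomers A N := by simp
  have hmemV : ∀ m, m ∈ hV.toFinset.sort (· ≤ ·) ↔ m ∈ unmatchedServers A N := by simp
  let z : PairState E :=
    { customers := (hU.toFinset.sort (· ≤ ·)).map c
      servers := (hV.toFinset.sort (· ≤ ·)).map s
      length_eq := by simp [hcard]
      incompatible := by
        intro x hx y hy
        obtain ⟨m, hm, rfl⟩ := List.mem_map.1 hx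
        obtain ⟨n, hn, rfl⟩ := List.mem_map.1 hy
        exact h.not_compatible_of_unmatched (Set.mem_univ m) (Set.mem_univ n) ((hmemU m).1 hm)
          ((hmemV n).1 hn) }
  have hz : HasState c s Set.univ A N z :=
    ⟨_, _, (Finset.sortedLT_sort _).pairwise, (Finset.sortedLT_sort _).pairwise,
      fun m => by simp [hmemU], fun m => by simp [hmemV], rfl, rfl⟩
  refine ⟨z, ?_, hz⟩
  rw [hz.encard.1] at hle
  exact_mod_cast hle

end Matching

/-! ### Windows of the driving sequence and coupling -/

section Window

variable {X : Type*}

/-- The word `ξ (a+1), …, ξ (a+n)`. -/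
def window (ξ : ℤ → X) (a : ℤ) (n : ℕ) : List X :=
  (List.range n).map fun i : ℕ => ξ (a + 1 + i)

@[simp] lemma length_window (ξ : ℤ → X) (a : ℤ) (n : ℕ) : (window ξ a n).length = n := by
  simp [window]

@[simp] lemma window_zero (ξ : ℤ → X) (a : ℤ) : window ξ a 0 = [] := rfl

lemma window_add (ξ : ℤ → X) (a : ℤ) (n m : ℕ) :
    window ξ a (n + m) = window ξ a n ++ window ξ (a + n) m := by
  simp only [window, List.range_add, List.map_append, List.map_map]
  congr 1
  refine List.map_congr_left fun i _ => ?_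
  simp only [Function.comp_apply, Nat.cast_add]
  congr 1
  ring

lemma window_one (ξ : ℤ → X) (a : ℤ) : window ξ a 1 = [ξ (a + 1)] := by
  simp [window]

lemma window_succ (ξ : ℤ → X) (a : ℤ) (n : ℕ) :
    window ξ a (n + 1) = window ξ a n ++ [ξ (a + n + 1)] := by
  rw [window_add, window_one]

lemma window_succ' (ξ : ℤ → X) (a : ℤ) (n : ℕ) :
    window ξ a (n + 1) = ξ (a + 1) :: window ξ (a + 1) n := by
  rw [add_comm, window_add, window_one]
  simp

lemma exists_eq_window_of_prefix {ξ : ℤ → X} {a : ℤ} {n : ℕ} {w : List X}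
    (h : w <+: window ξ a n) : ∃ j ≤ n, w = window ξ a j := by
  obtain ⟨v, hv⟩ := h
  have hl := congrArg List.length hv
  rw [List.length_append, length_window] at hl
  refine ⟨w.length, by omega, ?_⟩
  have : n = w.length + (n - w.length) := by omega
  rw [this, window_add] at hv
  exact (List.append_inj hv (by simp)).1

end Window

variable {𝒞 𝒮 : Type*} {E : 𝒞 → 𝒮 → Prop}

/-- A word that couples all starting states with at most `B` waiting pairs: at some time during the
word, the systems started from all these states are simultaneously empty. -/
def IsCoupling (E : 𝒞 → 𝒮 → Prop) (B : ℕ) (w : List (𝒞 × 𝒮)) : Prop :=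
  ∃ w₁, w₁ <+: w ∧ ∀ z : PairState E, z.size ≤ B → z.run w₁ = PairState.empty E

lemma IsCoupling.exists_le {B : ℕ} {ξ : ℤ → 𝒞 × 𝒮} {a : ℤ} {n : ℕ}
    (h : IsCoupling E B (window ξ a n)) :
    ∃ j ≤ n, ∀ z : PairState E, z.size ≤ B → z.run (window ξ a j) = PairState.empty E := by
  obtain ⟨w, hw, hz⟩ := h
  obtain ⟨j, hj, rfl⟩ := exists_eq_window_of_prefix hw
  exact ⟨j, hj, hz⟩

lemma IsCoupling.run_eq {B : ℕ} {w : List (𝒞 × 𝒮)} (h : IsCoupling E B w) {z : PairState E}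
    (hz : z.size ≤ B) : z.run w = (PairState.empty E).run w := by
  obtain ⟨w₁, ⟨w₂, rfl⟩, h⟩ := h
  rw [PairState.run_append, PairState.run_append, h z hz, h _ (by simp)]

/-- The driving sequence of pairs. -/
def pairs (c : ℤ → 𝒞) (s : ℤ → 𝒮) (k : ℤ) : 𝒞 × 𝒮 := (c k, s k)

variable {c : ℤ → 𝒞} {s : ℤ → 𝒮}

lemma IsFCFSMatching.hasState_run {T : Set ℤ} {A : Set (ℤ × ℤ)}
    (h : IsFCFSMatching E c s T T A) {a : ℤ} (hT : ∀ k, a < k → k ∈ T) {z : PairState E}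
    (hz : HasState c s T A a z) (n : ℕ) :
    HasState c s T A (a + n) (z.run (window (pairs c s) a n)) := by
  induction n with
  | zero => simpa using hz
  | succ n ih =>
    rw [window_succ, PairState.run_append]
    have := h.hasState_step (hT _ (by omega)) ih
    push_cast
    rw [← add_assoc]
    exact this

lemma hasState_fcfs (a : ℤ) (n : ℕ) :
    HasState c s (Set.Ioi a) (fcfs E c s a) (a + n)
      ((PairState.empty E).run (window (pairs c s) a n)) :=
  (isFCFSMatching_fcfs a).hasState_run (fun _ h => h) (hasState_empty_self a _) n

lemma HasState.exists_of_empty {T : Set ℤ} {A : Set (ℤ × ℤ)} {t : ℤ}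
    (h : HasState c s T A t (PairState.empty E)) :
    (∀ m ∈ T, m ≤ t → ∃ n ≤ t, (m, n) ∈ A) ∧ (∀ n ∈ T, n ≤ t → ∃ m ≤ t, (m, n) ∈ A) := by
  obtain ⟨lu, lv, -, -, hu, hv, hzc, hzs⟩ := h
  have hu0 : lu = [] := List.map_eq_nil_iff.1 hzc.symm
  have hv0 : lv = [] := List.map_eq_nil_iff.1 hzs.symm
  subst hu0 hv0
  constructor
  · intro m hm hmt
    by_contra! hcon
    simpa using (hu m).2 ⟨hm, hmt, hcon⟩
  · intro m hm hmt
    by_contra! hcon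
    simpa using (hv m).2 ⟨hm, hmt, hcon⟩

/-- After a time at which nobody is waiting, an FCFS matching coincides with the FCFS matching of
the later items. -/
lemma IsFCFSMatching.mem_iff_mem_fcfs {T : Set ℤ} {A : Set (ℤ × ℤ)}
    (h : IsFCFSMatching E c s T T A) {t : ℤ} (hT : ∀ k, t < k → k ∈ T)
    (h0 : HasState c s T A t (PairState.empty E)) {m n : ℤ} (hmn : t < m ∨ t < n) :
    (m, n) ∈ A ↔ (m, n) ∈ fcfs E c s t := by
  obtain ⟨hc, hs⟩ := h0.exists_of_empty
  have key : ∀ m n, (m, n) ∈ A → (t < m ↔ t < n) := by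
    intro m n hA
    constructor
    · intro hm
      by_contra hn
      obtain ⟨m', hm', hA'⟩ := hs n (h.subset hA).2 (not_lt.1 hn)
      have := h.customer_unique _ _ _ hA hA'
      omega
    · intro hn
      by_contra hm
      obtain ⟨n', hn', hA'⟩ := hc m (h.subset hA).1 (not_lt.1 hm)
      have := h.server_unique _ _ _ hA hA'
      omega
  have hmem : ∀ m n, (m, n) ∈ A ∩ Set.Ioi t ×ˢ Set.Ioi t ↔ (m, n) ∈ A ∧ t < m := by
    intro m n
    constructor
    · rintro ⟨hA, hm, -⟩
      exact ⟨hA, hm⟩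
    · rintro ⟨hA, hm⟩
      exact ⟨hA, hm, (key m n hA).1 hm⟩
  have hF : IsFCFSMatching E c s (Set.Ioi t) (Set.Ioi t) (A ∩ Set.Ioi t ×ˢ Set.Ioi t) :=
    { subset := Set.inter_subset_right
      compatible := fun m n hA => h.compatible m n hA.1
      server_unique := fun m n n' hA hA' => h.server_unique m n n' hA.1 hA'.1
      customer_unique := fun m m' n hA hA' => h.customer_unique m m' n hA.1 hA'.1
      complete := by
        intro m hm n hn h1 h2
        refine h.complete m (hT m hm) n (hT n hn) (fun n' hA => ?_) fun m' hA => ?_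
        · exact h1 n' ((hmem _ _).2 ⟨hA, hm⟩)
        · exact h2 m' ((hmem _ _).2 ⟨hA, (key _ _ hA).2 hn⟩)
      fcfs_server := by
        intro m n hA l hl hln hE
        obtain ⟨k, hk, hkA⟩ := h.fcfs_server m n hA.1 l (hT l hl) hln hE
        exact ⟨k, hk, (hmem _ _).2 ⟨hkA, (key _ _ hkA).2 hl⟩⟩
      fcfs_customer := by
        intro m n hA k hk hkm hE
        obtain ⟨l, hl, hlA⟩ := h.fcfs_customer m n hA.1 k (hT k hk) hkm hE
        exact ⟨l, hl, (hmem _ _).2 ⟨hlA, hk⟩⟩ }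
  rw [← hF.eq_fcfs, hmem]
  refine ⟨fun hA => ⟨hA, ?_⟩, fun hA => hA.1⟩
  rcases hmn with hm | hn
  exacts [hm, (key m n hA).2 hn]

/-! ### The limit of Loynes' scheme -/

/-- The pairs that belong to the FCFS matchings started at `-K` for all large `K`. -/
def limitMatching (E : 𝒞 → 𝒮 → Prop) (c : ℤ → 𝒞) (s : ℤ → 𝒮) : Set (ℤ × ℤ) :=
  {p | ∀ᶠ K : ℕ in atTop, p ∈ fcfs E c s (-(K : ℤ))}

/-- Coupling from the past: for every `B`, all systems started sufficiently far in the past with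
at most `B` waiting pairs coincide with the one started empty. -/
def CouplesFromPast (E : 𝒞 → 𝒮 → Prop) (ξ : ℤ → 𝒞 × 𝒮) : Prop :=
  ∀ (M : ℤ) (B : ℕ), ∀ᶠ n : ℕ in atTop, IsCoupling E B (window ξ (M - n) n)

/-- Coupling in the future: all systems with at most `B` waiting pairs at time `M` are
simultaneously empty at some later time. -/
def CouplesInFuture (E : 𝒞 → 𝒮 → Prop) (ξ : ℤ → 𝒞 × 𝒮) : Prop :=
  ∀ (M : ℤ) (B : ℕ), ∃ n : ℕ, IsCoupling E B (window ξ M n)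

lemma CouplesFromPast.eventually_nat {ξ : ℤ → 𝒞 × 𝒮} (h : CouplesFromPast E ξ) (N : ℤ) (B : ℕ) :
    ∀ᶠ K : ℕ in atTop, -(K : ℤ) ≤ N ∧ ∃ j : ℕ, -(K : ℤ) + j ≤ N ∧
      ∀ z : PairState E, z.size ≤ B → z.run (window ξ (-(K : ℤ)) j) = PairState.empty E := by
  obtain ⟨n₀, hn₀⟩ := eventually_atTop.1 (h N B)
  filter_upwards [eventually_ge_atTop (n₀ + N.natAbs)] with K hK
  have h1 := hn₀ (N + K).toNat (by omega)
  have h2 : N - ((N + K).toNat : ℤ) = -K := by omega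
  rw [h2] at h1
  obtain ⟨j, hj, hz⟩ := h1.exists_le
  exact ⟨by omega, j, by omega, hz⟩

/-- Starting one step earlier adds at most one waiting pair at time `-K`, so that both matchings
agree once all states with at most one waiting pair have been emptied. -/
lemma eventually_mem_fcfs_iff_succ (h : CouplesFromPast E (pairs c s)) (N : ℤ) :
    ∀ᶠ K : ℕ in atTop, ∀ m n, N < m ∨ N < n →
      ((m, n) ∈ fcfs E c s (-((K + 1 : ℕ) : ℤ)) ↔ (m, n) ∈ fcfs E c s (-(K : ℤ))) := by
  filter_upwards [h.eventually_nat N 1] with K hK m n hmn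
  obtain ⟨-, j, hj, hz⟩ := hK
  have h1 : HasState c s (Set.Ioi (-(K : ℤ))) (fcfs E c s (-(K : ℤ))) (-(K : ℤ) + j)
      (PairState.empty E) := by
    rw [← hz (PairState.empty E) (by simp)]
    exact hasState_fcfs _ j
  have h2 : HasState c s (Set.Ioi (-((K + 1 : ℕ) : ℤ))) (fcfs E c s (-((K + 1 : ℕ) : ℤ)))
      (-(K : ℤ) + j) (PairState.empty E) := by
    have h3 := hasState_fcfs (E := E) (c := c) (s := s) (-((K + 1 : ℕ) : ℤ)) 1
    have h4 : -((K + 1 : ℕ) : ℤ) + (1 : ℕ) = -(K : ℤ) := by push_cast; ring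
    rw [h4] at h3
    rw [← hz _ (show ((PairState.empty E).run (window (pairs c s) (-((K + 1 : ℕ) : ℤ)) 1)).size ≤ 1
      from (PairState.size_run_le _ _).trans (by simp))]
    refine (isFCFSMatching_fcfs _).hasState_run (fun k hk => ?_) h3 j
    show -((K + 1 : ℕ) : ℤ) < k
    push_cast
    omega
  have hmn' : -(K : ℤ) + j < m ∨ -(K : ℤ) + j < n := by omega
  rw [(isFCFSMatching_fcfs _).mem_iff_mem_fcfs (fun k hk => ?_) h1 hmn',
    (isFCFSMatching_fcfs _).mem_iff_mem_fcfs (fun k hk => ?_) h2 hmn']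
  · show -((K + 1 : ℕ) : ℤ) < k
    push_cast
    omega
  · show -(K : ℤ) < k
    omega

lemma eventually_mem_fcfs_iff (h : CouplesFromPast E (pairs c s)) (N : ℤ) :
    ∀ᶠ K : ℕ in atTop, ∀ m n, N < m ∨ N < n →
      ((m, n) ∈ fcfs E c s (-(K : ℤ)) ↔ (m, n) ∈ limitMatching E c s) := by
  obtain ⟨K₀, hK₀⟩ := eventually_atTop.1 (eventually_mem_fcfs_iff_succ h N)
  have key : ∀ K ≥ K₀, ∀ m n, N < m ∨ N < n →
      ((m, n) ∈ fcfs E c s (-(K : ℤ)) ↔ (m, n) ∈ fcfs E c s (-(K₀ : ℤ))) := by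
    intro K hK m n hmn
    induction K, hK using Nat.le_induction with
    | base => rfl
    | succ K hK ih => rw [hK₀ K hK m n hmn, ih]
  filter_upwards [eventually_ge_atTop K₀] with K hK m n hmn
  rw [key K hK m n hmn]
  constructor
  · intro hm
    filter_upwards [eventually_ge_atTop K₀] with K' hK'
    exact (key K' hK' m n hmn).2 hm
  · intro hm
    obtain ⟨K', hK', hm'⟩ := ((eventually_ge_atTop K₀).and hm).exists
    exact (key K' hK' m n hmn).1 hm'

/-- The FCFS matching of a half-line is perfect, since the system is empty again after any time. -/
lemma isPerfect_fcfs (h : CouplesInFuture E (pairs c s)) (a : ℤ) :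
    IsPerfect (Set.Ioi a) (fcfs E c s a) := by
  have key : ∀ M, a < M → ∃ t, M ≤ t ∧
      HasState c s (Set.Ioi a) (fcfs E c s a) t (PairState.empty E) := by
    intro M hM
    obtain ⟨n, hn⟩ := h M (M - a).toNat
    obtain ⟨j, -, hz⟩ := hn.exists_le
    have h1 := hasState_fcfs (E := E) (c := c) (s := s) a (M - a).toNat
    have h2 : a + ((M - a).toNat : ℤ) = M := by omega
    rw [h2] at h1
    refine ⟨M + j, by omega, ?_⟩
    rw [← hz _ ((PairState.size_run_le (window (pairs c s) a (M - a).toNat)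
      (PairState.empty E)).trans (by simp))]
    exact (isFCFSMatching_fcfs a).hasState_run (fun k hk => hM.trans hk) h1 j
  constructor
  · intro m hm
    obtain ⟨t, ht, h0⟩ := key m hm
    obtain ⟨n, -, hn⟩ := h0.exists_of_empty.1 m hm ht
    exact ⟨n, hn⟩
  · intro m hm
    obtain ⟨t, ht, h0⟩ := key m hm
    obtain ⟨n, -, hn⟩ := h0.exists_of_empty.2 m hm ht
    exact ⟨n, hn⟩

lemma isPerfect_limitMatching (hp : CouplesFromPast E (pairs c s))
    (hf : CouplesInFuture E (pairs c s)) : IsPerfect Set.univ (limitMatching E c s) := by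
  constructor
  · intro m _
    obtain ⟨K, h1, h2⟩ := ((eventually_mem_fcfs_iff hp (m - 1)).and
      (eventually_gt_atTop m.natAbs)).exists
    obtain ⟨n, hn⟩ := (isPerfect_fcfs hf (-(K : ℤ))).1 m (show -(K : ℤ) < m by omega)
    exact ⟨n, (h1 m n (Or.inl (by omega))).1 hn⟩
  · intro n _
    obtain ⟨K, h1, h2⟩ := ((eventually_mem_fcfs_iff hp (n - 1)).and
      (eventually_gt_atTop n.natAbs)).exists
    obtain ⟨m, hm⟩ := (isPerfect_fcfs hf (-(K : ℤ))).2 n (show -(K : ℤ) < n by omega)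
    exact ⟨m, (h1 m n (Or.inr (by omega))).1 hm⟩

lemma isFCFSMatching_limitMatching (hp : CouplesFromPast E (pairs c s))
    (hf : CouplesInFuture E (pairs c s)) :
    IsFCFSMatching E c s Set.univ Set.univ (limitMatching E c s) where
  subset := fun p _ => ⟨Set.mem_univ _, Set.mem_univ _⟩
  compatible := fun m n h => by
    obtain ⟨K, hK⟩ := Eventually.exists h
    exact (isFCFSMatching_fcfs _).compatible m n hK
  server_unique := fun m n n' h h' => by
    obtain ⟨K, hK, hK'⟩ := (Eventually.and h h').exists
    exact (isFCFSMatching_fcfs _).server_unique m n n' hK hK'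
  customer_unique := fun m n n' h h' => by
    obtain ⟨K, hK, hK'⟩ := (Eventually.and h h').exists
    exact (isFCFSMatching_fcfs _).customer_unique m n n' hK hK'
  complete := fun m _ n _ h1 => by
    obtain ⟨n', hn'⟩ := (isPerfect_limitMatching hp hf).1 m (Set.mem_univ m)
    exact absurd hn' (h1 n')
  fcfs_server := fun m n h l _ hln hE => by
    obtain ⟨K, ⟨hK, h1⟩, h2⟩ := ((Eventually.and h (eventually_mem_fcfs_iff hp (l - 1))).and
      (eventually_gt_atTop l.natAbs)).exists
    obtain ⟨k, hk, hkA⟩ := (isFCFSMatching_fcfs _).fcfs_server m n hK l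
      (show -(K : ℤ) < l by omega) hln hE
    exact ⟨k, hk, (h1 k l (Or.inr (by omega))).1 hkA⟩
  fcfs_customer := fun m n h k _ hkm hE => by
    obtain ⟨K, ⟨hK, h1⟩, h2⟩ := ((Eventually.and h (eventually_mem_fcfs_iff hp (k - 1))).and
      (eventually_gt_atTop k.natAbs)).exists
    obtain ⟨l, hl, hlA⟩ := (isFCFSMatching_fcfs _).fcfs_customer m n hK k
      (show -(K : ℤ) < k by omega) hkm hE
    exact ⟨l, hl, (h1 k l (Or.inl (by omega))).1 hlA⟩

/-- The state at time `N` of the system started empty far in the past is the state left by the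
limit matching. -/
lemma eventually_hasState_limitMatching (hp : CouplesFromPast E (pairs c s))
    (hf : CouplesInFuture E (pairs c s)) (N : ℤ) :
    ∀ᶠ n : ℕ in atTop, HasState c s Set.univ (limitMatching E c s) N
      ((PairState.empty E).run (window (pairs c s) (N - n) n)) := by
  obtain ⟨K₀, hK₀⟩ := eventually_atTop.1 (eventually_mem_fcfs_iff hp N)
  filter_upwards [eventually_ge_atTop (K₀ + N.natAbs)] with n hn
  set K : ℕ := (n - N).toNat with hK
  have hKN : N - (n : ℤ) = -(K : ℤ) := by omega
  have hiff := hK₀ K (by omega)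
  have h1 := hasState_fcfs (E := E) (c := c) (s := s) (-(K : ℤ)) n
  have h2 : -(K : ℤ) + n = N := by omega
  rw [h2] at h1
  rw [hKN]
  have hA := isFCFSMatching_limitMatching hp hf
  have hL := isFCFSMatching_fcfs (E := E) (c := c) (s := s) (-(K : ℤ))
  obtain ⟨lu, lv, hlu, hlv, hu, hv, hz1, hz2⟩ := h1
  refine ⟨lu, lv, hlu, hlv, fun m => ?_, fun m => ?_, hz1, hz2⟩
  · rw [hu]
    constructor
    · rintro ⟨hmT, hm, hm'⟩
      refine ⟨Set.mem_univ m, hm, fun k hk hkA => ?_⟩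
      obtain ⟨k', hk'⟩ := (isPerfect_fcfs hf (-(K : ℤ))).1 m hmT
      have hlt : N < k' := by
        by_contra hcon
        exact hm' k' (not_lt.1 hcon) hk'
      have := hA.server_unique _ _ _ hkA ((hiff m k' (Or.inr hlt)).1 hk')
      omega
    · rintro ⟨-, hm, hm'⟩
      obtain ⟨k', hk'⟩ := (isPerfect_limitMatching hp hf).1 m (Set.mem_univ m)
      have hlt : N < k' := by
        by_contra hcon
        exact hm' k' (not_lt.1 hcon) hk'
      have hk'' := (hiff m k' (Or.inr hlt)).2 hk'
      refine ⟨(hL.subset hk'').1, hm, fun k hk hkA => ?_⟩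
      have := hL.server_unique _ _ _ hkA hk''
      omega
  · rw [hv]
    constructor
    · rintro ⟨hmT, hm, hm'⟩
      refine ⟨Set.mem_univ m, hm, fun k hk hkA => ?_⟩
      obtain ⟨k', hk'⟩ := (isPerfect_fcfs hf (-(K : ℤ))).2 m hmT
      have hlt : N < k' := by
        by_contra hcon
        exact hm' k' (not_lt.1 hcon) hk'
      have := hA.customer_unique _ _ _ hkA ((hiff k' m (Or.inl hlt)).1 hk')
      omega
    · rintro ⟨-, hm, hm'⟩
      obtain ⟨k', hk'⟩ := (isPerfect_limitMatching hp hf).2 m (Set.mem_univ m)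
      have hlt : N < k' := by
        by_contra hcon
        exact hm' k' (not_lt.1 hcon) hk'
      have hk'' := (hiff k' m (Or.inl hlt)).2 hk'
      refine ⟨(hL.subset hk'').2, hm, fun k hk hkA => ?_⟩
      have := hL.customer_unique _ _ _ hkA hk''
      omega

/-- A balanced recurrent FCFS matching over `ℤ` is the limit matching: from a time in the far past
at which it has few waiting items, it couples with Loynes' scheme. -/
lemma IsFCFSMatching.eq_limitMatching (hp : CouplesFromPast E (pairs c s)) {A : Set (ℤ × ℤ)}
    (hA : IsFCFSMatching E c s Set.univ Set.univ A) (hb : IsBalancedRecurrent A) :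
    A = limitMatching E c s := by
  obtain ⟨B, hB⟩ := hb
  ext ⟨m, n⟩
  obtain ⟨K₀, hK₀⟩ := eventually_atTop.1
    ((eventually_mem_fcfs_iff hp (m - 1)).and (hp.eventually_nat (m - 1) B))
  obtain ⟨N, hN, ⟨heq, hle⟩⟩ := frequently_atBot.1 hB (-(K₀ : ℤ))
  obtain ⟨z, hzB, hz⟩ := hA.exists_hasState heq hle
  obtain ⟨K, rfl⟩ : ∃ K : ℕ, N = -(K : ℤ) := ⟨(-N).toNat, by omega⟩
  obtain ⟨h1, -, j, hj, h2⟩ := hK₀ K (by omega)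
  have hmn : -(K : ℤ) + j < m ∨ -(K : ℤ) + j < n := Or.inl (by omega)
  have h3 := hA.hasState_run (fun _ _ => Set.mem_univ _) hz j
  rw [h2 z hzB] at h3
  have h4 := hasState_fcfs (E := E) (c := c) (s := s) (-(K : ℤ)) j
  rw [h2 _ (by simp)] at h4
  rw [← h1 m n (Or.inl (by omega)), hA.mem_iff_mem_fcfs (fun _ _ => Set.mem_univ _) h3 hmn,
    (isFCFSMatching_fcfs _).mem_iff_mem_fcfs (fun k hk => ?_) h4 hmn]
  show -(K : ℤ) < k
  omega

/-! ### Independent pairs -/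

section Independence

lemma measurable_comap_apply {ι Ω X : Type*} [MeasurableSpace X] (f : ι → Ω → X) (k : ι) :
    Measurable[MeasurableSpace.comap (fun ω i => f i ω) inferInstance] (f k) := by
  have : f k = (fun g : ι → X => g k) ∘ fun ω i => f i ω := rfl
  rw [this]
  exact (measurable_pi_apply k).comp (comap_measurable _)

lemma comap_pairs_le {ι Ω X Y : Type*} [MeasurableSpace X] [MeasurableSpace Y]
    {m : MeasurableSpace Ω} {f : ι → Ω → X} {g : ι → Ω → Y} (hf : ∀ k, Measurable (f k))
    (hg : ∀ k, Measurable (g k)) :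
    MeasurableSpace.comap (fun ω i => (f i ω, g i ω)) inferInstance ≤ m :=
  (measurable_pi_iff.2 fun k => (hf k).prodMk (hg k)).comap_le

variable {Ω : Type*} [MeasurableSpace Ω] {P : Measure Ω}

/-- Independence of the two sequences and of the entries of each of them makes the pairs up to time
`N` independent of the later ones. -/
lemma indepFun_pairs {𝒞 𝒮 : Type*} [MeasurableSpace 𝒞] [MeasurableSpace 𝒮] {c : ℤ → Ω → 𝒞}
    {s : ℤ → Ω → 𝒮} (hc : ∀ m, Measurable (c m)) (hs : ∀ n, Measurable (s n))
    (hc_indep : iIndepFun c P) (hs_indep : iIndepFun s P)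
    (hcs_indep : IndepFun (fun ω m => c m ω) (fun ω n => s n ω) P) (N : ℤ) :
    IndepFun (fun ω (k : Set.Iic N) => (c k ω, s k ω)) (fun ω (k : Set.Ioi N) => (c k ω, s k ω))
      P := by
  set m : ℤ ⊕ ℤ → MeasurableSpace Ω :=
    Sum.elim (fun k => MeasurableSpace.comap (c k) inferInstance)
      (fun k => MeasurableSpace.comap (s k) inferInstance) with hm
  have hle : ∀ i, m i ≤ ‹MeasurableSpace Ω› := by
    rintro (k | k)
    · exact (hc k).comap_le
    · exact (hs k).comap_le
  have hind : iIndep m P := by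
    rw [iIndep_iff]
    intro S f hf
    have hS : ⋂ i ∈ S, f i = (⋂ k ∈ S.toLeft, f (Sum.inl k)) ∩ ⋂ k ∈ S.toRight, f (Sum.inr k) := by
      ext ω
      simp [Sum.forall]
    have hprod : ∏ i ∈ S, P (f i) =
        (∏ k ∈ S.toLeft, P (f (Sum.inl k))) * ∏ k ∈ S.toRight, P (f (Sum.inr k)) := by
      conv_lhs => rw [← Finset.toLeft_disjSum_toRight (u := S)]
      rw [Finset.prod_disjSum]
    have hl : ∀ k ∈ S.toLeft, MeasurableSet[MeasurableSpace.comap (c k) inferInstance]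
        (f (Sum.inl k)) := fun k hk => hf (Sum.inl k) (Finset.mem_toLeft.1 hk)
    have hr : ∀ k ∈ S.toRight, MeasurableSet[MeasurableSpace.comap (s k) inferInstance]
        (f (Sum.inr k)) := fun k hk => hf (Sum.inr k) (Finset.mem_toRight.1 hk)
    rw [hS, hprod, ← hc_indep.meas_biInter hl, ← hs_indep.meas_biInter hr]
    refine (Indep_iff _ _ _).1 hcs_indep _ _ ?_ ?_
    · refine Finset.measurableSet_biInter _ fun k hk => ?_
      have h1 : MeasurableSpace.comap (c k) inferInstance ≤
          MeasurableSpace.comap (fun ω m => c m ω) inferInstance :=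
        (measurable_comap_apply c k).comap_le
      exact h1 _ (hl k hk)
    · refine Finset.measurableSet_biInter _ fun k hk => ?_
      have h1 : MeasurableSpace.comap (s k) inferInstance ≤
          MeasurableSpace.comap (fun ω m => s m ω) inferInstance :=
        (measurable_comap_apply s k).comap_le
      exact h1 _ (hr k hk)
  have hdisj : Disjoint {i : ℤ ⊕ ℤ | Sum.elim id id i ≤ N} {i : ℤ ⊕ ℤ | N < Sum.elim id id i} := by
    rw [Set.disjoint_left]
    exact fun i (h1 : _ ≤ N) h2 => absurd h1 (not_le.2 h2)
  have hI := indep_iSup_of_disjoint hle hind hdisj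
  refine indep_of_indep_of_le_left (indep_of_indep_of_le_right hI ?_) ?_
  · refine comap_pairs_le (f := fun (k : Set.Ioi N) ω => c k ω)
      (g := fun (k : Set.Ioi N) ω => s k ω)
      (fun k => ?_) fun k => ?_
    · exact Measurable.of_comap_le (le_iSup₂_of_le (Sum.inl k.1) k.2 le_rfl)
    · exact Measurable.of_comap_le (le_iSup₂_of_le (Sum.inr k.1) k.2 le_rfl)
  · refine comap_pairs_le (f := fun (k : Set.Iic N) ω => c k ω)
      (g := fun (k : Set.Iic N) ω => s k ω)
      (fun k => ?_) fun k => ?_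
    · exact Measurable.of_comap_le (le_iSup₂_of_le (Sum.inl k.1) k.2 le_rfl)
    · exact Measurable.of_comap_le (le_iSup₂_of_le (Sum.inr k.1) k.2 le_rfl)

end Independence

/-- Words over a countable alphabet carry the discrete σ-algebra. -/
instance {X : Type*} : MeasurableSpace (List X) := ⊤

instance {X : Type*} : DiscreteMeasurableSpace (List X) := ⟨fun _ => trivial⟩

instance {𝒞 𝒮 : Type*} {E : 𝒞 → 𝒮 → Prop} : DiscreteMeasurableSpace (PairState E) :=
  ⟨fun _ => trivial⟩

lemma measurable_window {X Ω : Type*} [Countable X] [MeasurableSpace X]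
    [MeasurableSingletonClass X] {mΩ : MeasurableSpace Ω} {ξ : ℤ → Ω → X} {a : ℤ} {n : ℕ}
    (h : ∀ k, a < k → k ≤ a + n → Measurable (ξ k)) :
    Measurable fun ω => window (fun k => ξ k ω) a n := by
  induction n with
  | zero => exact measurable_const
  | succ n ih =>
    simp only [window_succ]
    have h1 := ih fun k hk hk' => h k hk (by push_cast; omega)
    have h2 := h (a + n + 1) (by omega) (by push_cast; omega)
    exact (Measurable.of_discrete (f := fun p : List X × X => p.1 ++ [p.2])).comp (h1.prodMk h2)

/-- A sequence of independent pairs with law `α ⊗ β`. -/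
structure IsIIDPairs {𝒞 𝒮 Ω : Type*} [MeasurableSpace 𝒞] [MeasurableSpace 𝒮] [MeasurableSpace Ω]
    (P : Measure Ω) (α : PMF 𝒞) (β : PMF 𝒮) (ξ : ℤ → Ω → 𝒞 × 𝒮) : Prop where
  measurable : ∀ k, Measurable (ξ k)
  law : ∀ k x, P {ω | ξ k ω = x} = α x.1 * β x.2
  indep : ∀ N : ℤ, IndepFun (fun ω (k : Set.Iic N) => ξ k ω) (fun ω (k : Set.Ioi N) => ξ k ω) P

section IID

variable {𝒞 𝒮 Ω : Type*} [MeasurableSpace 𝒞] [MeasurableSpace 𝒮] [MeasurableSpace Ω]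
  {P : Measure Ω} {α : PMF 𝒞} {β : PMF 𝒮}

lemma isIIDPairs_of_indep [MeasurableSingletonClass 𝒞] [MeasurableSingletonClass 𝒮]
    {c : ℤ → Ω → 𝒞} {s : ℤ → Ω → 𝒮}
    (hc : ∀ m, Measurable (c m)) (hs : ∀ n, Measurable (s n))
    (hc_law : ∀ m, P.map (c m) = α.toMeasure) (hs_law : ∀ n, P.map (s n) = β.toMeasure)
    (hc_indep : iIndepFun c P) (hs_indep : iIndepFun s P)
    (hcs_indep : IndepFun (fun ω m => c m ω) (fun ω n => s n ω) P) :
    IsIIDPairs P α β fun k ω => (c k ω, s k ω) where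
  measurable k := (hc k).prodMk (hs k)
  law := by
    rintro k ⟨i, j⟩
    have h1 : IndepFun (c k) (s k) P :=
      hcs_indep.comp (measurable_pi_apply k) (measurable_pi_apply k)
    have h2 := h1.measure_inter_preimage_eq_mul {i} {j} (measurableSet_singleton i)
      (measurableSet_singleton j)
    have h3 : P (c k ⁻¹' {i}) = α i := by
      rw [← Measure.map_apply (hc k) (measurableSet_singleton i), hc_law,
        PMF.toMeasure_apply_singleton _ _ (measurableSet_singleton i)]
    have h4 : P (s k ⁻¹' {j}) = β j := by
      rw [← Measure.map_apply (hs k) (measurableSet_singleton j), hs_law,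
        PMF.toMeasure_apply_singleton _ _ (measurableSet_singleton j)]
    rw [← h3, ← h4, ← h2]
    congr 1
    ext ω
    simp [Prod.ext_iff]
  indep := indepFun_pairs hc hs hc_indep hs_indep hcs_indep

namespace IsIIDPairs

variable {ξ : ℤ → Ω → 𝒞 × 𝒮}

/-- Functions of the pairs up to time `N` are independent of functions of the later ones. -/
lemma indepFun_of_measurable (h : IsIIDPairs P α β ξ) (N : ℤ) {β₁ β₂ : Type*}
    [MeasurableSpace β₁] [MeasurableSpace β₂] {f : Ω → β₁} {g : Ω → β₂}
    (hf : Measurable[MeasurableSpace.comap (fun ω (k : Set.Iic N) => ξ k ω) inferInstance] f)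
    (hg : Measurable[MeasurableSpace.comap (fun ω (k : Set.Ioi N) => ξ k ω) inferInstance] g) :
    IndepFun f g P :=
  indep_of_indep_of_le_left (indep_of_indep_of_le_right (h.indep N) hg.comap_le) hf.comap_le

omit [MeasurableSpace Ω] in
lemma measurable_past (N k : ℤ) (hk : k ≤ N) :
    Measurable[MeasurableSpace.comap (fun ω (k : Set.Iic N) => ξ k ω) inferInstance] (ξ k) :=
  measurable_comap_apply (fun (k : Set.Iic N) ω => ξ k ω) ⟨k, hk⟩

omit [MeasurableSpace Ω] in
lemma measurable_future (N k : ℤ) (hk : N < k) :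
    Measurable[MeasurableSpace.comap (fun ω (k : Set.Ioi N) => ξ k ω) inferInstance] (ξ k) :=
  measurable_comap_apply (fun (k : Set.Ioi N) ω => ξ k ω) ⟨k, hk⟩

variable [Finite 𝒞] [Finite 𝒮] [MeasurableSingletonClass 𝒞] [MeasurableSingletonClass 𝒮]

lemma measurable_word (h : IsIIDPairs P α β ξ) (a : ℤ) (n : ℕ) :
    Measurable fun ω => window (fun k => ξ k ω) a n :=
  measurable_window fun k _ _ => h.measurable k

lemma measurableSet_word (h : IsIIDPairs P α β ξ) (a : ℤ) (n : ℕ) (S : Set (List (𝒞 × 𝒮))) :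
    MeasurableSet {ω | window (fun k => ξ k ω) a n ∈ S} :=
  h.measurable_word a n (MeasurableSet.of_discrete (s := S))

/-- Consecutive words are independent. -/
lemma measure_inter_word (h : IsIIDPairs P α β ξ) (a : ℤ) (n m : ℕ) (S S' : Set (List (𝒞 × 𝒮))) :
    P ({ω | window (fun k => ξ k ω) a n ∈ S} ∩ {ω | window (fun k => ξ k ω) (a + n) m ∈ S'}) =
      P {ω | window (fun k => ξ k ω) a n ∈ S} *
        P {ω | window (fun k => ξ k ω) (a + n) m ∈ S'} := by
  refine (h.indepFun_of_measurable (a + n) (f := fun ω => window (fun k => ξ k ω) a n)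
    (g := fun ω => window (fun k => ξ k ω) (a + n) m) ?_ ?_).measure_inter_preimage_eq_mul S S'
    MeasurableSet.of_discrete MeasurableSet.of_discrete
  · exact measurable_window fun k _ hk => measurable_past _ k hk
  · exact measurable_window fun k hk _ => measurable_future _ k hk

lemma measure_word_eq [IsProbabilityMeasure P] (h : IsIIDPairs P α β ξ) (a : ℤ) :
    ∀ w : List (𝒞 × 𝒮), P {ω | window (fun k => ξ k ω) a w.length = w} = wordWeight α β w := by
  intro w
  induction w using List.reverseRecOn with
  | nil => simp [wordWeight]
  | append_singleton w x ih =>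
    have h1 := h.measure_inter_word a w.length 1 {w} {[x]}
    simp only [Set.mem_singleton_iff] at h1
    rw [wordWeight_append, ← ih]
    have h2 : P {ω | window (fun k => ξ k ω) (a + w.length) 1 = [x]} = wordWeight α β [x] := by
      simp only [window_one, List.cons.injEq, and_true, h.law]
      simp [wordWeight]
    rw [← h2, ← h1]
    congr 1
    ext ω
    simp only [List.length_append, List.length_singleton, window_add, Set.mem_ofPred_eq,
      Set.mem_inter_iff]
    constructor
    · intro h'
      exact List.append_inj h' (by simp)
    · rintro ⟨h', h''⟩
      rw [h', h'']

/-- The law of a word does not depend on its position. -/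
lemma measure_word_shift [IsProbabilityMeasure P] (h : IsIIDPairs P α β ξ) (a b : ℤ) (n : ℕ)
    (S : Set (List (𝒞 × 𝒮))) : P {ω | window (fun k => ξ k ω) a n ∈ S} =
      P {ω | window (fun k => ξ k ω) b n ∈ S} := by
  have hmap : P.map (fun ω => window (fun k => ξ k ω) a n) =
      P.map (fun ω => window (fun k => ξ k ω) b n) := by
    refine Measure.ext_of_singleton fun w => ?_
    rw [Measure.map_apply (h.measurable_word a n) MeasurableSet.of_discrete,
      Measure.map_apply (h.measurable_word b n) MeasurableSet.of_discrete]
    by_cases hw : w.length = n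
    · subst hw
      exact (h.measure_word_eq a w).trans (h.measure_word_eq b w).symm
    · have : ∀ a, (fun ω => window (fun k => ξ k ω) a n) ⁻¹' {w} = ∅ := by
        intro a
        refine Set.eq_empty_of_forall_notMem fun ω hω => hw ?_
        rw [← show window (fun k => ξ k ω) a n = w from hω, length_window]
      rw [this, this]
  have h1 := DFunLike.congr_fun hmap S
  rw [Measure.map_apply (h.measurable_word a n) MeasurableSet.of_discrete,
    Measure.map_apply (h.measurable_word b n) MeasurableSet.of_discrete] at h1
  exact h1

end IsIIDPairs

end IID

/-! ### Coupling -/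

lemma wordWeight_ne_zero {𝒞 𝒮 : Type*} {α : PMF 𝒞} {β : PMF 𝒮} (hα : ∀ i, α i ≠ 0)
    (hβ : ∀ j, β j ≠ 0) (w : List (𝒞 × 𝒮)) :
    wordWeight α β w ≠ 0 := by
  induction w with
  | nil => simp [wordWeight]
  | cons x w ih =>
    rw [wordWeight] at ih ⊢
    rw [List.map_cons, List.prod_cons]
    exact mul_ne_zero (mul_ne_zero (hα _) (hβ _)) ih

section Coupling

variable {𝒞 𝒮 Ω : Type*} [Fintype 𝒞] [Fintype 𝒮] [MeasurableSpace 𝒞] [MeasurableSpace 𝒮]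
  [MeasurableSingletonClass 𝒞] [MeasurableSingletonClass 𝒮] [MeasurableSpace Ω]
  {P : Measure Ω} [IsProbabilityMeasure P] {E : 𝒞 → 𝒮 → Prop} {α : PMF 𝒞} {β : PMF 𝒮}
  {ξ : ℤ → Ω → 𝒞 × 𝒮}

lemma exists_measure_size_le (h : IsIIDPairs P α β ξ) (hE : (compatGraph E).Connected)
    (hβ : ∀ j, β j ≠ 0) (hcrp : CompleteResourcePooling E α β) {ε : ℝ≥0∞} (hε : ε ≠ 0) :
    ∃ B : ℕ, ∀ a n, P {ω | B < ((PairState.empty E).run (window (fun k => ξ k ω) a n)).size} ≤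
      ε := by
  classical
  obtain ⟨B, hB⟩ := exists_tsum_wordWeight_size_le hE hβ hcrp hε
  refine ⟨B, fun a n => le_trans ?_ (hB n)⟩
  have hsub : {ω | B < ((PairState.empty E).run (window (fun k => ξ k ω) a n)).size} ⊆
      ⋃ w : List (𝒞 × 𝒮), {ω | window (fun k => ξ k ω) a n = w ∧
        (w.length = n ∧ B < ((PairState.empty E).run w).size)} := by
    intro ω hω
    exact Set.mem_iUnion.2 ⟨_, rfl, length_window _ _ _, hω⟩
  refine (measure_mono hsub).trans ((measure_iUnion_le _).trans (ENNReal.tsum_le_tsum fun w => ?_))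
  split_ifs with hw
  · rw [← h.measure_word_eq a w]
    refine measure_mono fun ω hω => ?_
    rw [Set.mem_ofPred_eq, hw.1]
    exact hω.1
  · simp [hw]

/-- The system started empty is empty again with a probability bounded away from `0`. -/
lemma exists_le_measure_run_eq_empty (h : IsIIDPairs P α β ξ) (hE : (compatGraph E).Connected)
    (hα : ∀ i, α i ≠ 0) (hβ : ∀ j, β j ≠ 0) (hcrp : CompleteResourcePooling E α β) :
    ∃ p : ℝ≥0∞, p ≠ 0 ∧ ∃ n₁ : ℕ, ∀ a : ℤ, ∀ n ≥ n₁,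
      p ≤ P {ω | (PairState.empty E).run (window (fun k => ξ k ω) a n) = PairState.empty E} := by
  obtain ⟨B, hB⟩ := exists_measure_size_le h hE hβ hcrp (ε := 2⁻¹) (by simp)
  obtain ⟨w, -, hwz⟩ := PairState.exists_word_forall_run_eq_empty (E := E) hE B
  refine ⟨2⁻¹ * wordWeight α β w, mul_ne_zero (by simp) (wordWeight_ne_zero hα hβ w), w.length,
    fun a n hn => ?_⟩
  obtain ⟨m, rfl⟩ : ∃ m, n = m + w.length := ⟨n - w.length, by omega⟩
  have h1 : (2⁻¹ : ℝ≥0∞) ≤ P {ω | window (fun k => ξ k ω) a m ∈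
      {v | ((PairState.empty E).run v).size ≤ B}} := by
    have h2 : {ω | window (fun k => ξ k ω) a m ∈ {v | ((PairState.empty E).run v).size ≤ B}} =
        {ω | window (fun k => ξ k ω) a m ∈ {v | B < ((PairState.empty E).run v).size}}ᶜ := by
      ext ω; simp
    rw [h2, prob_compl_eq_one_sub (h.measurableSet_word _ _ _)]
    have h3 := hB a m
    calc (2⁻¹ : ℝ≥0∞) = 1 - 2⁻¹ := ENNReal.one_sub_inv_two.symm
      _ ≤ _ := tsub_le_tsub_left h3 1
  rw [← h.measure_word_eq (a + m) w]
  refine (mul_le_mul_left h1 _).trans ?_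
  have h4 := h.measure_inter_word a m w.length {v | ((PairState.empty E).run v).size ≤ B} {w}
  simp only [Set.mem_singleton_iff] at h4
  rw [← h4]
  refine measure_mono ?_
  rintro ω ⟨hω1, hω2⟩
  simp only [Set.mem_ofPred_eq] at hω1 hω2 ⊢
  rw [window_add, PairState.run_append, hω2, hwz _ hω1]

/-- The coupling time of all systems with at most `B` waiting pairs has finite expectation. Cut time
into blocks of the length of a word `w` that empties all these systems, and call a block good if
the system started empty is empty at its beginning and the word `w` arrives during the block.
Decomposing according to the last good block, and since each block is good with a probability
bounded away from `0`, the probabilities that no block is good are summable. -/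
lemma tsum_measure_not_isCoupling_ne_top (h : IsIIDPairs P α β ξ)
    (hE : (compatGraph E).Connected) (hα : ∀ i, α i ≠ 0) (hβ : ∀ j, β j ≠ 0)
    (hcrp : CompleteResourcePooling E α β) (B : ℕ) :
    ∑' n, P {ω | ¬ IsCoupling E B (window (fun k => ξ k ω) 0 n)} ≠ ∞ := by
  obtain ⟨p, hp, n₁, hn₁⟩ := exists_le_measure_run_eq_empty h hE hα hβ hcrp
  -- a nonempty word of compatible pairs that empties all systems with at most `B` waiting pairs
  obtain ⟨w, hw0, hwB⟩ : ∃ w : List (𝒞 × 𝒮), 0 < w.length ∧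
      ∀ z : PairState E, z.size ≤ B → z.run w = PairState.empty E := by
    obtain ⟨w, -, hwz⟩ := PairState.exists_word_forall_run_eq_empty (E := E) hE B
    obtain ⟨i⟩ : Nonempty 𝒞 := α.support_nonempty.to_type
    obtain ⟨j⟩ : Nonempty 𝒮 := β.support_nonempty.to_type
    obtain ⟨k, hk⟩ := exists_reachIn hE i j
    obtain ⟨j', hj'⟩ := hk.exists_left
    refine ⟨w ++ [(i, j')], by simp, fun z hz => ?_⟩
    rw [PairState.run_append, hwz z hz]
    exact PairState.run_empty_of_forall_compatible (by simpa using hj')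
  set ℓ := w.length with hℓ
  set hit : List (𝒞 × 𝒮) → Prop := fun v => ∃ v₁, v₁ ++ w <+: v ∧ ℓ ∣ v₁.length ∧
    (PairState.empty E).run v₁ = PairState.empty E with hhit
  have hit_coupling : ∀ v, hit v → IsCoupling E B v := by
    rintro v ⟨v₁, h1, -, h2⟩
    refine ⟨v₁ ++ w, h1, fun z hz => ?_⟩
    rw [PairState.run_append]
    exact hwB _ ((PairState.size_run_le_of_run_empty h2 z).trans hz)
  set g : ℕ → ℝ≥0∞ := fun i => P {ω | ¬ hit (window (fun k => ξ k ω) 0 (i * ℓ))} with hg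
  set q := p * wordWeight α β w with hq
  have hq0 : q ≠ 0 := mul_ne_zero hp (wordWeight_ne_zero hα hβ w)
  -- the sum over `i` of the probabilities that the last good block is followed by `i` blocks
  have hsum : ∀ m, ∑ i ∈ Finset.range m, q * g i ≤ 1 := by
    intro m
    set j : ℕ → ℕ := fun i => n₁ + m - 1 - i with hj
    -- the block with `i` blocks left is the last good one
    set F : ℕ → Set Ω := fun i =>
      ({ω | window (fun k => ξ k ω) 0 (j i * ℓ) ∈
          {v | (PairState.empty E).run v = PairState.empty E}} ∩
        {ω | window (fun k => ξ k ω) (0 + (j i * ℓ : ℕ)) (ℓ + i * ℓ) ∈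
          {v | ∃ v₂, v = w ++ v₂ ∧ ¬ hit v₂}}) with hF
    have hFm : ∀ i, MeasurableSet (F i) := fun i =>
      (h.measurableSet_word _ _ _).inter (h.measurableSet_word _ _ _)
    have hFP : ∀ i < m, q * g i ≤ P (F i) := by
      intro i hi
      have hji : n₁ ≤ j i * ℓ := by
        have : n₁ ≤ j i := by simp only [hj]; omega
        nlinarith
      rw [hF]
      simp only
      rw [h.measure_inter_word, hq, mul_assoc]
      refine mul_le_mul' (hn₁ 0 _ hji) ?_
      have h1 := h.measure_inter_word (0 + (j i * ℓ : ℕ)) ℓ (i * ℓ) {w} {v | ¬ hit v}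
      simp only [Set.mem_singleton_iff] at h1
      rw [h.measure_word_eq, h.measure_word_shift _ 0 (i * ℓ)] at h1
      refine le_of_eq_of_le h1.symm (measure_mono ?_)
      rintro ω ⟨h2, h3⟩
      exact ⟨_, by rw [window_add]; exact congrArg (· ++ _) h2, h3⟩
    have hdisj : ∀ i i', i < i' → i' < m → Disjoint (F i) (F i') := by
      intro i i' hii him
      rw [Set.disjoint_left]
      rintro ω ⟨h1, v, hv, -⟩ ⟨h1', v', hv', hv''⟩
      simp only [Set.mem_ofPred_eq] at h1 h1' hv hv'
      refine hv'' ?_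
      obtain ⟨d, rfl⟩ : ∃ d, i' = i + 1 + d := ⟨i' - i - 1, by omega⟩
      have hji : j i = j (i + 1 + d) + 1 + d := by simp only [hj]; omega
      have e1 : j i * ℓ = (j (i + 1 + d) * ℓ + ℓ) + d * ℓ := by rw [hji]; ring
      have e2 : ℓ + (i + 1 + d) * ℓ = (ℓ + d * ℓ) + (ℓ + i * ℓ) := by ring
      rw [e2, window_add, window_add] at hv'
      have e3 : (0 : ℤ) + (j (i + 1 + d) * ℓ : ℕ) + (ℓ + d * ℓ : ℕ) = 0 + (j i * ℓ : ℕ) := by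
        rw [e1]; push_cast; ring
      rw [e3, hv, List.append_assoc] at hv'
      obtain ⟨e4, e5⟩ := List.append_inj hv' (by simp [hℓ])
      have e6 : (PairState.empty E).run w = PairState.empty E := hwB _ (by simp)
      refine ⟨window (fun k => ξ k ω) (0 + (j (i + 1 + d) * ℓ : ℕ) + (ℓ : ℕ)) (d * ℓ), ?_, ?_, ?_⟩
      · rw [← e5, ← List.append_assoc]
        exact List.prefix_append _ _
      · simp
      · rw [e1, window_add, window_add, PairState.run_append, PairState.run_append, h1', e4, e6,
          Nat.cast_add, ← add_assoc] at h1
        exact h1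
    calc ∑ i ∈ Finset.range m, q * g i ≤ ∑ i ∈ Finset.range m, P (F i) :=
          Finset.sum_le_sum fun i hi => hFP i (Finset.mem_range.1 hi)
      _ = P (⋃ i ∈ Finset.range m, F i) := by
          refine (measure_biUnion_finset ?_ fun i _ => hFm i).symm
          intro i hi i' hi' hne
          have hi := Finset.mem_range.1 hi
          have hi' := Finset.mem_range.1 hi'
          rcases lt_or_gt_of_ne hne with hlt | hlt
          · exact hdisj i i' hlt hi'
          · exact (hdisj i' i hlt hi).symm
      _ ≤ 1 := prob_le_one
  have hgsum : ∑' i, g i ≠ ∞ := by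
    have h1 : q * ∑' i, g i ≤ 1 := by
      rw [← ENNReal.tsum_mul_left]
      exact ENNReal.tsum_le_of_sum_range_le hsum
    intro htop
    rw [htop, ENNReal.mul_top hq0] at h1
    exact absurd h1 (by simp)
  have hle : ∀ n, P {ω | ¬ IsCoupling E B (window (fun k => ξ k ω) 0 n)} ≤ g (n / ℓ) := by
    intro n
    refine measure_mono fun ω hω hcon => hω (hit_coupling _ ?_)
    obtain ⟨v₁, h1, h2⟩ := hcon
    refine ⟨v₁, h1.trans ?_, h2⟩
    conv_rhs => rw [← Nat.div_add_mod' n ℓ, window_add]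
    exact List.prefix_append _ _
  have : NeZero ℓ := ⟨hw0.ne'⟩
  have hdiv : ∑' n, g (n / ℓ) = ∑' i, ℓ * g i := by
    have h1 := (Nat.divModEquiv ℓ).symm.tsum_eq fun n => g (n / ℓ)
    rw [← h1, ENNReal.tsum_prod']
    refine tsum_congr fun i => ?_
    rw [tsum_fintype, Finset.sum_congr rfl fun r _ => ?_]
    · rw [Finset.sum_const, Finset.card_univ, Fintype.card_fin, nsmul_eq_mul]
    · simp only [Nat.divModEquiv_symm_apply]
      congr 1
      rw [mul_comm, Nat.mul_add_div hw0, Nat.div_eq_of_lt r.2, add_zero]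
  refine ((ENNReal.tsum_le_tsum hle).trans_lt ?_).ne
  rw [hdiv, ENNReal.tsum_mul_left]
  exact ENNReal.mul_lt_top (ENNReal.natCast_lt_top _) hgsum.lt_top

/-- Borel–Cantelli, applied to the windows that end at a given time. -/
lemma ae_couplesFromPast (h : IsIIDPairs P α β ξ)
    (hE : (compatGraph E).Connected) (hα : ∀ i, α i ≠ 0) (hβ : ∀ j, β j ≠ 0)
    (hcrp : CompleteResourcePooling E α β) :
    ∀ᵐ ω ∂P, CouplesFromPast E fun k => ξ k ω := by
  refine ae_all_iff.2 fun M => ae_all_iff.2 fun B => ?_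
  have h1 : ∑' n : ℕ, P {ω | ¬ IsCoupling E B (window (fun k => ξ k ω) (M - n) n)} ≠ ∞ := by
    have h2 := tsum_measure_not_isCoupling_ne_top h hE hα hβ hcrp B
    refine fun ht => h2 ((tsum_congr fun n => ?_).trans ht)
    exact h.measure_word_shift 0 (M - n) n {v | ¬ IsCoupling E B v}
  filter_upwards [ae_eventually_notMem h1] with ω hω
  filter_upwards [hω] with n hn
  simpa using hn

lemma tendsto_measure_not_isCoupling (h : IsIIDPairs P α β ξ)
    (hE : (compatGraph E).Connected) (hα : ∀ i, α i ≠ 0) (hβ : ∀ j, β j ≠ 0)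
    (hcrp : CompleteResourcePooling E α β) (B : ℕ) (a : ℕ → ℤ) :
    Tendsto (fun n => P {ω | ¬ IsCoupling E B (window (fun k => ξ k ω) (a n) n)}) atTop
      (nhds 0) := by
  have h1 := ENNReal.tendsto_atTop_zero_of_tsum_ne_top
    (tsum_measure_not_isCoupling_ne_top h hE hα hβ hcrp B)
  refine h1.congr fun n => ?_
  exact h.measure_word_shift 0 (a n) n {v | ¬ IsCoupling E B v}

lemma ae_couplesInFuture (h : IsIIDPairs P α β ξ)
    (hE : (compatGraph E).Connected) (hα : ∀ i, α i ≠ 0) (hβ : ∀ j, β j ≠ 0)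
    (hcrp : CompleteResourcePooling E α β) :
    ∀ᵐ ω ∂P, CouplesInFuture E fun k => ξ k ω := by
  refine ae_all_iff.2 fun M => ae_all_iff.2 fun B => ?_
  rw [ae_iff]
  refine le_antisymm (ge_of_tendsto'
    (tendsto_measure_not_isCoupling h hE hα hβ hcrp B fun _ => M) fun n => ?_) zero_le
  exact measure_mono fun ω hω hn => hω ⟨n, hn⟩

end Coupling

/-! ### The stationary version of the chain -/

section LimitState

variable {𝒞 𝒮 : Type*} {E : 𝒞 → 𝒮 → Prop} {ξ : ℤ → 𝒞 × 𝒮}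

open Classical in
/-- The state at time `N` of the system started empty at time `N - n`, for large `n`; if these
states do not stabilize, then the empty state. -/
noncomputable def limitState (E : 𝒞 → 𝒮 → Prop) (ξ : ℤ → 𝒞 × 𝒮) (N : ℤ) : PairState E :=
  if h : ∃ z, ∀ᶠ n : ℕ in atTop, (PairState.empty E).run (window ξ (N - n) n) = z then h.choose
  else PairState.empty E

lemma limitState_eq {N : ℤ} {z : PairState E}
    (h : ∀ᶠ n : ℕ in atTop, (PairState.empty E).run (window ξ (N - n) n) = z) :
    limitState E ξ N = z := by
  have hex : ∃ z, ∀ᶠ n : ℕ in atTop, (PairState.empty E).run (window ξ (N - n) n) = z := ⟨z, h⟩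
  rw [limitState, dif_pos hex]
  obtain ⟨n, h1, h2⟩ := (hex.choose_spec.and h).exists
  exact h1.symm.trans h2

lemma limitState_eq_iff {N : ℤ} {z : PairState E} : limitState E ξ N = z ↔
    (∀ᶠ n : ℕ in atTop, (PairState.empty E).run (window ξ (N - n) n) = z) ∨
    (z = PairState.empty E ∧
      ∀ z, ¬ ∀ᶠ n : ℕ in atTop, (PairState.empty E).run (window ξ (N - n) n) = z) := by
  constructor
  · rintro rfl
    by_cases hex : ∃ z, ∀ᶠ n : ℕ in atTop, (PairState.empty E).run (window ξ (N - n) n) = z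
    · obtain ⟨z, hz⟩ := hex
      rw [limitState_eq hz]
      exact Or.inl hz
    · exact Or.inr ⟨by rw [limitState, dif_neg hex], not_exists.1 hex⟩
  · rintro (h | ⟨rfl, h⟩)
    · exact limitState_eq h
    · rw [limitState, dif_neg (not_exists.2 h)]

lemma CouplesFromPast.eventually_run_empty_eq (h : CouplesFromPast E ξ) (N : ℤ) :
    ∀ᶠ n : ℕ in atTop, (PairState.empty E).run (window ξ (N - n) n) = limitState E ξ N := by
  obtain ⟨n₀, hn₀⟩ := eventually_atTop.1 (h N 1)
  have key : ∀ n ≥ n₀, (PairState.empty E).run (window ξ (N - n) n) =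
      (PairState.empty E).run (window ξ (N - n₀) n₀) := by
    intro n hn
    induction n, hn using Nat.le_induction with
    | base => rfl
    | succ n hn ih =>
      rw [← ih, window_succ', PairState.run_cons]
      have e : N - ((n + 1 : ℕ) : ℤ) + 1 = N - n := by push_cast; ring
      rw [e]
      exact (hn₀ n hn).run_eq ((PairState.size_step_le _ _ _).trans (by simp))
  have hev : ∀ᶠ n : ℕ in atTop, (PairState.empty E).run (window ξ (N - n) n) =
      (PairState.empty E).run (window ξ (N - n₀) n₀) := by
    filter_upwards [eventually_ge_atTop n₀] with n hn using key n hn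
  rwa [limitState_eq hev]

lemma CouplesFromPast.eventually_run_eq (h : CouplesFromPast E ξ) (N : ℤ) (B : ℕ) :
    ∀ᶠ n : ℕ in atTop, ∀ z : PairState E, z.size ≤ B →
      z.run (window ξ (N - n) n) = limitState E ξ N := by
  filter_upwards [h.eventually_run_empty_eq N, h N B] with n h1 h2 z hz
  rw [h2.run_eq hz, h1]

lemma CouplesFromPast.limitState_succ (h : CouplesFromPast E ξ) (N : ℤ) :
    limitState E ξ (N + 1) = (limitState E ξ N).step (ξ (N + 1)).1 (ξ (N + 1)).2 := by
  obtain ⟨n, h1, h2⟩ := ((h.eventually_run_empty_eq N).and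
    ((tendsto_add_atTop_nat 1).eventually (h.eventually_run_empty_eq (N + 1)))).exists
  rw [← h1, ← h2, window_succ, PairState.run_append]
  have e : N + 1 - ((n + 1 : ℕ) : ℤ) = N - n := by push_cast; ring
  have e' : N - (n : ℤ) + n + 1 = N + 1 := by ring
  rw [e, e']
  rfl

lemma eq_run_of_step {O : ℤ → PairState E}
    (hO : ∀ N, O (N + 1) = (O N).step (ξ (N + 1)).1 (ξ (N + 1)).2) (a : ℤ) (n : ℕ) :
    O (a + n) = (O a).run (window ξ a n) := by
  induction n with
  | zero => simp
  | succ n ih =>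
    rw [window_succ, PairState.run_append, ← ih]
    push_cast
    rw [← add_assoc, hO]
    rfl

/-- The law of the chain after `n` steps from the state `y`. -/
noncomputable def iteratedTransition (E : 𝒞 → 𝒮 → Prop) (α : PMF 𝒞) (β : PMF 𝒮) (n : ℕ)
    (y : PairState E) : PMF (PairState E) :=
  (fun p => p.bind (pairTransition E α β))^[n] (PMF.pure y)

lemma iteratedTransition_succ {α : PMF 𝒞} {β : PMF 𝒮} (n : ℕ)
    (y : PairState E) : iteratedTransition E α β (n + 1) y =
    (iteratedTransition E α β n y).bind (pairTransition E α β) :=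
  Function.iterate_succ_apply' _ _ _

lemma IsStationaryLaw.bind_iteratedTransition {α : PMF 𝒞} {β : PMF 𝒮}
    {π : PMF (PairState E)}
    (hπ : IsStationaryLaw E α β π) (n : ℕ) : π.bind (iteratedTransition E α β n) = π := by
  induction n with
  | zero => exact PMF.bind_pure π
  | succ n ih =>
    have : iteratedTransition E α β (n + 1) =
        fun y => (iteratedTransition E α β n y).bind (pairTransition E α β) :=
      funext fun y => iteratedTransition_succ n y
    rw [this, ← PMF.bind_bind, ih]
    exact hπ

lemma tendsto_toMeasure_size_gt (π : PMF (PairState E)) :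
    Tendsto (fun B : ℕ => π.toMeasure {z | B < z.size}) atTop (nhds 0) := by
  have h1 : Tendsto (fun B : ℕ => π.toMeasure {z : PairState E | B < z.size}) atTop
      (nhds (π.toMeasure (⋂ B : ℕ, {z : PairState E | B < z.size}))) :=
    tendsto_measure_iInter_atTop (fun B => MeasurableSet.of_discrete.nullMeasurableSet)
      (fun B B' hB z (hz : B' < z.size) => lt_of_le_of_lt hB hz) ⟨0, measure_ne_top _ _⟩
  have h2 : (⋂ B : ℕ, {z : PairState E | B < z.size}) = ∅ := by
    refine Set.eq_empty_of_forall_notMem fun z hz => ?_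
    exact lt_irrefl z.size (show z.size < z.size from Set.mem_iInter.1 hz z.size)
  rwa [h2, measure_empty] at h1

end LimitState

section Stationary

variable {𝒞 𝒮 Ω : Type*} [Fintype 𝒞] [Fintype 𝒮] [MeasurableSpace 𝒞] [MeasurableSpace 𝒮]
  [MeasurableSingletonClass 𝒞] [MeasurableSingletonClass 𝒮] [MeasurableSpace Ω]
  {P : Measure Ω} [IsProbabilityMeasure P] {E : 𝒞 → 𝒮 → Prop} {α : PMF 𝒞} {β : PMF 𝒮}
  {ξ : ℤ → Ω → 𝒞 × 𝒮}

lemma measurableSet_eventually_nat {Ω : Type*} {mΩ : MeasurableSpace Ω} {p : ℕ → Ω → Prop}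
    (h : ∀ n, MeasurableSet {ω | p n ω}) : MeasurableSet {ω | ∀ᶠ n in atTop, p n ω} := by
  have : {ω | ∀ᶠ n in atTop, p n ω} = ⋃ n₀, ⋂ n ≥ n₀, {ω | p n ω} := by
    ext ω
    simp [eventually_atTop]
  rw [this]
  exact MeasurableSet.iUnion fun n₀ => MeasurableSet.iInter fun n =>
    MeasurableSet.iInter fun _ => h n

omit [MeasurableSpace Ω] in
lemma measurable_limitState {mΩ : MeasurableSpace Ω} {N : ℤ} (h : ∀ k ≤ N, Measurable (ξ k)) :
    Measurable fun ω => limitState E (fun k => ξ k ω) N := by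
  have h1 : ∀ z : PairState E, MeasurableSet {ω | ∀ᶠ n : ℕ in atTop,
      (PairState.empty E).run (window (fun k => ξ k ω) (N - n) n) = z} := by
    intro z
    refine measurableSet_eventually_nat fun n => ?_
    exact measurable_window (fun k _ hk => h k (by omega))
      (MeasurableSet.of_discrete (s := {w | (PairState.empty E).run w = z}))
  refine measurable_to_countable' fun z => ?_
  have h2 : (fun ω => limitState E (fun k => ξ k ω) N) ⁻¹' {z} =
      {ω | ∀ᶠ n : ℕ in atTop,
        (PairState.empty E).run (window (fun k => ξ k ω) (N - n) n) = z} ∪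
      ({ω | z = PairState.empty E} ∩ ⋂ z, {ω | ∀ᶠ n : ℕ in atTop,
        (PairState.empty E).run (window (fun k => ξ k ω) (N - n) n) = z}ᶜ) := by
    ext ω
    simp only [Set.mem_preimage, Set.mem_singleton_iff, limitState_eq_iff, Set.mem_union,
      Set.mem_ofPred_eq, Set.mem_inter_iff, Set.mem_iInter, Set.mem_compl_iff]
  rw [h2]
  exact (h1 z).union ((MeasurableSet.const _).inter (MeasurableSet.iInter fun z => (h1 z).compl))

omit [IsProbabilityMeasure P] in
/-- The law of the next state, when the present state is independent of the later pairs. -/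
lemma measure_step_eq_bind (h : IsIIDPairs P α β ξ) {N : ℤ} {O : Ω → PairState E}
    (hO : Measurable O) (hind : IndepFun O (fun ω (k : Set.Ioi N) => ξ k ω) P)
    {π : PMF (PairState E)} (hπ : ∀ y, P {ω | O ω = y} = π y) (z : PairState E) :
    P {ω | (O ω).step (ξ (N + 1) ω).1 (ξ (N + 1) ω).2 = z} =
      π.bind (pairTransition E α β) z := by
  classical
  have hξ : Measurable (ξ (N + 1)) := h.measurable _
  have hpair : Measurable fun ω => (O ω, ξ (N + 1) ω) := hO.prodMk hξ
  have hind' : IndepFun O (ξ (N + 1)) P :=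
    hind.comp measurable_id (measurable_pi_apply (⟨N + 1, by simp⟩ : Set.Ioi N))
  have hsing : ∀ y x, P.map (fun ω => (O ω, ξ (N + 1) ω)) {(y, x)} = π y * (α x.1 * β x.2) := by
    intro y x
    rw [Measure.map_apply hpair (measurableSet_singleton _), ← hπ, ← h.law (N + 1)]
    refine Eq.trans ?_ (hind'.measure_inter_preimage_eq_mul {y} {x} (measurableSet_singleton _)
      (measurableSet_singleton _))
    congr 1
    ext ω
    simp
  have h1 : P {ω | (O ω).step (ξ (N + 1) ω).1 (ξ (N + 1) ω).2 = z} =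
      P.map (fun ω => (O ω, ξ (N + 1) ω)) {p | p.1.step p.2.1 p.2.2 = z} := by
    rw [Measure.map_apply hpair MeasurableSet.of_discrete]
    rfl
  rw [h1, ← Measure.tsum_indicator_apply_singleton _ _ MeasurableSet.of_discrete,
    ENNReal.tsum_prod', PMF.bind_apply]
  refine tsum_congr fun y => ?_
  rw [pairTransition, PMF.bind_apply, ← ENNReal.tsum_mul_left, ENNReal.tsum_prod']
  refine tsum_congr fun i => ?_
  rw [PMF.map_apply, ← ENNReal.tsum_mul_left, ← ENNReal.tsum_mul_left]
  refine tsum_congr fun j => ?_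
  by_cases hz : y.step i j = z
  · have hmem : (y, i, j) ∈ {p : PairState E × 𝒞 × 𝒮 | p.1.step p.2.1 p.2.2 = z} := hz
    rw [Set.indicator_of_mem hmem, hsing, if_pos hz.symm]
  · have hmem : (y, i, j) ∉ {p : PairState E × 𝒞 × 𝒮 | p.1.step p.2.1 p.2.2 = z} := hz
    rw [Set.indicator_of_notMem hmem, if_neg fun h => hz h.symm, mul_zero, mul_zero]

lemma tendsto_measure_run_eq (h : IsIIDPairs P α β ξ)
    (hp : ∀ᵐ ω ∂P, CouplesFromPast E fun k => ξ k ω) (N : ℤ) (y z : PairState E) :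
    Tendsto (fun n => P {ω | y.run (window (fun k => ξ k ω) 0 n) = z}) atTop
      (nhds (P {ω | limitState E (fun k => ξ k ω) N = z})) := by
  have h1 : Tendsto (fun n : ℕ => P {ω | y.run (window (fun k => ξ k ω) (N - n) n) = z}) atTop
      (nhds (P {ω | limitState E (fun k => ξ k ω) N = z})) := by
    refine tendsto_measure_of_ae_tendsto_indicator_of_isFiniteMeasure atTop
      (measurable_limitState (fun k _ => h.measurable k) (measurableSet_singleton z))
      (fun n => h.measurableSet_word _ _ {w | y.run w = z}) ?_
    filter_upwards [hp] with ω hω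
    filter_upwards [hω.eventually_run_eq N y.size] with n hn
    rw [hn y le_rfl]
  exact h1.congr fun n => h.measure_word_shift _ _ n {w | y.run w = z}

/-- The law of the limit states. -/
noncomputable def limitLaw (P : Measure Ω) [IsProbabilityMeasure P] (E : 𝒞 → 𝒮 → Prop)
    (ξ : ℤ → Ω → 𝒞 × 𝒮) (hξ : ∀ k, Measurable (ξ k)) : PMF (PairState E) :=
  haveI := Measure.isProbabilityMeasure_map (μ := P)
    (measurable_limitState (E := E) (N := 0) fun k _ => hξ k).aemeasurable
  (P.map fun ω => limitState E (fun k => ξ k ω) 0).toPMF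

lemma measure_limitState_eq (h : IsIIDPairs P α β ξ)
    (hp : ∀ᵐ ω ∂P, CouplesFromPast E fun k => ξ k ω) (N : ℤ) (z : PairState E) :
    P {ω | limitState E (fun k => ξ k ω) N = z} = limitLaw P E ξ h.measurable z := by
  have h0 : limitLaw P E ξ h.measurable z = P {ω | limitState E (fun k => ξ k ω) 0 = z} := by
    rw [limitLaw, Measure.toPMF_apply, Measure.map_apply
      (measurable_limitState fun k _ => h.measurable k) (measurableSet_singleton z)]
    rfl
  rw [h0]
  exact tendsto_nhds_unique (tendsto_measure_run_eq h hp N z z) (tendsto_measure_run_eq h hp 0 z z)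

omit [IsProbabilityMeasure P] in
lemma indepFun_limitState (h : IsIIDPairs P α β ξ) (N : ℤ) :
    IndepFun (fun ω => limitState E (fun k => ξ k ω) N) (fun ω (k : Set.Ioi N) => ξ k ω) P :=
  h.indepFun_of_measurable N (measurable_limitState fun k hk => IsIIDPairs.measurable_past N k hk)
    (comap_measurable _)

lemma isStationaryLaw_limitLaw (h : IsIIDPairs P α β ξ)
    (hp : ∀ᵐ ω ∂P, CouplesFromPast E fun k => ξ k ω) :
    IsStationaryLaw E α β (limitLaw P E ξ h.measurable) := by
  refine PMF.ext fun z => ?_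
  rw [← measure_step_eq_bind h (measurable_limitState fun k _ => h.measurable k)
    (indepFun_limitState h 0) (measure_limitState_eq h hp 0) z,
    ← measure_limitState_eq h hp (0 + 1) z]
  refine measure_congr ?_
  filter_upwards [hp] with ω hω
  exact congrArg (· = z) (hω.limitState_succ 0).symm

lemma measure_run_eq_iteratedTransition (h : IsIIDPairs P α β ξ) (n : ℕ) (y : PairState E) :
    ∀ z, P {ω | y.run (window (fun k => ξ k ω) 0 n) = z} = iteratedTransition E α β n y z := by
  induction n with
  | zero =>
    intro z
    by_cases hz : y = z
    · simp [iteratedTransition, hz]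
    · simp [iteratedTransition, hz, Ne.symm hz]
  | succ n ih =>
    intro z
    have hm : Measurable fun ω => y.run (window (fun k => ξ k ω) 0 n) :=
      (Measurable.of_discrete (f := fun w => y.run w)).comp (h.measurable_word 0 n)
    have hind : IndepFun (fun ω => y.run (window (fun k => ξ k ω) 0 n))
        (fun ω (k : Set.Ioi ((0 : ℤ) + n)) => ξ k ω) P := by
      refine h.indepFun_of_measurable (0 + n) ?_ (comap_measurable _)
      exact (Measurable.of_discrete (f := fun w => y.run w)).comp
        (measurable_window fun k _ hk => IsIIDPairs.measurable_past _ k hk)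
    rw [iteratedTransition_succ, ← measure_step_eq_bind h hm hind ih z]
    simp only [window_succ, PairState.run_append, PairState.run_cons, PairState.run_nil]

/-- The stationary law is unique since the laws of the chain converge to `limitLaw` from every
starting state. -/
lemma IsStationaryLaw.eq_limitLaw (h : IsIIDPairs P α β ξ)
    (hp : ∀ᵐ ω ∂P, CouplesFromPast E fun k => ξ k ω) {π : PMF (PairState E)}
    (hπ : IsStationaryLaw E α β π) : π = limitLaw P E ξ h.measurable := by
  refine PMF.ext fun z => ?_
  have h1 : ∀ n, ∫⁻ y, iteratedTransition E α β n y z ∂π.toMeasure = π z := by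
    intro n
    conv_rhs => rw [← hπ.bind_iteratedTransition n]
    rw [lintegral_countable', PMF.bind_apply]
    refine tsum_congr fun y => ?_
    rw [PMF.toMeasure_apply_singleton _ _ (measurableSet_singleton y), mul_comm]
  have h2 : Tendsto (fun n => ∫⁻ y, iteratedTransition E α β n y z ∂π.toMeasure) atTop
      (nhds (∫⁻ _, limitLaw P E ξ h.measurable z ∂π.toMeasure)) := by
    refine tendsto_lintegral_of_dominated_convergence (fun _ => 1)
      (fun n => Measurable.of_discrete) (fun n => Eventually.of_forall fun y => PMF.coe_le_one _ _)
      (by simp) (Eventually.of_forall fun y => ?_)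
    rw [← measure_limitState_eq h hp 0 z]
    exact (tendsto_measure_run_eq h hp 0 y z).congr fun n =>
      measure_run_eq_iteratedTransition h n y z
  simp only [h1, lintegral_const, measure_univ, mul_one] at h2
  exact tendsto_nhds_unique tendsto_const_nhds h2

lemma map_limitState (h : IsIIDPairs P α β ξ)
    (hp : ∀ᵐ ω ∂P, CouplesFromPast E fun k => ξ k ω) (N : ℤ) :
    P.map (fun ω => limitState E (fun k => ξ k ω) N) =
      (limitLaw P E ξ h.measurable).toMeasure := by
  refine Measure.ext_of_singleton fun z => ?_
  rw [Measure.map_apply (measurable_limitState fun k _ => h.measurable k)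
    (measurableSet_singleton z), PMF.toMeasure_apply_singleton _ _ (measurableSet_singleton z)]
  exact measure_limitState_eq h hp N z

/-- Almost surely, the limit states stay below some bound at arbitrarily early times. -/
lemma ae_exists_frequently_size_le (h : IsIIDPairs P α β ξ)
    (hp : ∀ᵐ ω ∂P, CouplesFromPast E fun k => ξ k ω) :
    ∀ᵐ ω ∂P, ∃ B : ℕ, ∃ᶠ N : ℤ in atBot, (limitState E (fun k => ξ k ω) N).size ≤ B := by
  rw [ae_iff]
  refine le_antisymm (ge_of_tendsto' (tendsto_toMeasure_size_gt (limitLaw P E ξ h.measurable))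
    fun B => ?_) zero_le
  have hsub : {ω | ¬ ∃ B : ℕ, ∃ᶠ N : ℤ in atBot, (limitState E (fun k => ξ k ω) N).size ≤ B} ⊆
      ⋃ K : ℕ, {ω | ∀ N : ℤ, N ≤ -(K : ℤ) → B < (limitState E (fun k => ξ k ω) N).size} := by
    intro ω hω
    have h1 : ∀ᶠ N : ℤ in atBot, B < (limitState E (fun k => ξ k ω) N).size := by
      by_contra hcon
      refine hω ⟨B, ?_⟩
      rw [not_eventually] at hcon
      exact hcon.mono fun N hN => not_lt.1 hN
    obtain ⟨N₀, hN₀⟩ := eventually_atBot.1 h1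
    exact Set.mem_iUnion.2 ⟨N₀.natAbs, fun N hN => hN₀ N (by omega)⟩
  refine (measure_mono hsub).trans ?_
  have hmono : Monotone fun K : ℕ =>
      {ω | ∀ N : ℤ, N ≤ -(K : ℤ) → B < (limitState E (fun k => ξ k ω) N).size} :=
    fun K K' hK ω hω N hN => hω N (by omega)
  rw [hmono.measure_iUnion]
  refine iSup_le fun K => ?_
  rw [← map_limitState h hp (-(K : ℤ)), Measure.map_apply
    (measurable_limitState fun k _ => h.measurable k) MeasurableSet.of_discrete]
  exact measure_mono fun ω hω => hω _ le_rfl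

/-- Every stationary version of the chain coincides with the limit states: it was started far in
the past from a state whose size is tight. -/
lemma ae_eq_limitState (h : IsIIDPairs P α β ξ)
    (hp : ∀ᵐ ω ∂P, CouplesFromPast E fun k => ξ k ω) {π : PMF (PairState E)}
    {O : ℤ → Ω → PairState E} (hOm : ∀ N, Measurable (O N)) (hOl : ∀ N, P.map (O N) = π.toMeasure)
    (hO : ∀ᵐ ω ∂P, ∀ N, O (N + 1) ω = (O N ω).step (ξ (N + 1) ω).1 (ξ (N + 1) ω).2) :
    ∀ᵐ ω ∂P, ∀ N, O N ω = limitState E (fun k => ξ k ω) N := by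
  refine ae_all_iff.2 fun N => ?_
  rw [ae_iff]
  refine le_antisymm (ge_of_tendsto' (tendsto_toMeasure_size_gt π) fun B => ?_) zero_le
  set D : ℕ → Set Ω := fun n => {ω | ¬ ∀ z : PairState E, z.size ≤ B →
    z.run (window (fun k => ξ k ω) (N - n) n) = limitState E (fun k => ξ k ω) N} with hD
  have hDm : ∀ n, MeasurableSet (D n) := by
    intro n
    have hm : Measurable fun ω => (window (fun k => ξ k ω) (N - n) n,
        limitState E (fun k => ξ k ω) N) :=
      (h.measurable_word _ _).prodMk (measurable_limitState fun k _ => h.measurable k)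
    exact hm (MeasurableSet.of_discrete
      (s := {p | ¬ ∀ z : PairState E, z.size ≤ B → z.run p.1 = p.2}))
  have hD0 : Tendsto (fun n => P (D n)) atTop (nhds 0) := by
    have h1 := tendsto_measure_of_ae_tendsto_indicator_of_isFiniteMeasure (μ := P) (A := ∅) atTop
      MeasurableSet.empty hDm ?_
    · rwa [measure_empty] at h1
    · filter_upwards [hp] with ω hω
      filter_upwards [hω.eventually_run_eq N B] with n hn
      simpa [hD] using hn
  have hle : ∀ n : ℕ, P {ω | ¬ O N ω = limitState E (fun k => ξ k ω) N} ≤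
      π.toMeasure {z | B < z.size} + P (D n) := by
    intro n
    rw [← hOl (N - n), Measure.map_apply (hOm _) MeasurableSet.of_discrete]
    refine le_trans (measure_mono_ae ?_) (measure_union_le _ _)
    filter_upwards [hO] with ω hω hne
    by_contra hcon
    have hcon' := not_or.1 hcon
    have h1 : (O (N - n) ω).size ≤ B := not_lt.1 hcon'.1
    have h2 := eq_run_of_step (ξ := fun k => ξ k ω) (O := fun k => O k ω) hω (N - n) n
    rw [sub_add_cancel] at h2
    exact hne (h2.trans (not_not.1 hcon'.2 _ h1))
  have h2 := hD0.const_add (π.toMeasure {z | B < z.size})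
  rw [add_zero] at h2
  exact ge_of_tendsto' h2 hle

end Stationary

/-! ### Measurability of the limit matching -/

section Measurability

variable {𝒞 𝒮 Ω : Type*} [Finite 𝒞] [Finite 𝒮] [MeasurableSpace 𝒞] [MeasurableSpace 𝒮]
  [MeasurableSingletonClass 𝒞] [MeasurableSingletonClass 𝒮] [MeasurableSpace Ω]
  {E : 𝒞 → 𝒮 → Prop} {c : ℤ → Ω → 𝒞} {s : ℤ → Ω → 𝒮}

lemma measurable_mem_fcfs (hc : ∀ m, Measurable (c m)) (hs : ∀ n, Measurable (s n)) (a m n : ℤ) :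
    Measurable fun ω => (m, n) ∈ fcfs E (c · ω) (s · ω) a := by
  have key : ∀ N : ℕ, ∀ m n, (m - a).toNat + (n - a).toNat < N →
      Measurable fun ω => (m, n) ∈ fcfs E (c · ω) (s · ω) a := by
    intro N
    induction N with
    | zero => intro m n h; omega
    | succ N ih =>
      intro m n hN
      have hcompat : ∀ m n, Measurable fun ω => E (c m ω) (s n ω) := fun m n =>
        (Measurable.of_discrete (f := fun p : 𝒞 × 𝒮 => E p.1 p.2)).comp ((hc m).prodMk (hs n))
      have hfalse : Measurable fun _ : Ω => False := measurable_const
      simp only [mem_fcfs_iff (m := m) (n := n)]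
      refine Measurable.and measurable_const (Measurable.and measurable_const
        ((hcompat m n).and (Measurable.and ?_ ?_)))
      · refine Measurable.forall fun l => Measurable.forall fun hl => Measurable.forall fun hln =>
          (hcompat m l).imp (Measurable.exists fun k => ?_)
        by_cases hk : a < k ∧ k < m
        · simp only [hk.1, hk.2, true_and]
          exact ih k l (by omega)
        · simp only [← and_assoc, hk, false_and]
          exact hfalse
      · refine Measurable.forall fun k => Measurable.forall fun hk => Measurable.forall fun hkm =>
          (hcompat k n).imp (Measurable.exists fun l => ?_)
        by_cases hl : a < l ∧ l < n
        · simp only [hl.1, hl.2, true_and]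
          exact ih k l (by omega)
        · simp only [← and_assoc, hl, false_and]
          exact hfalse
  exact key _ m n (Nat.lt_succ_self _)

lemma measurableSet_mem_limitMatching (hc : ∀ m, Measurable (c m)) (hs : ∀ n, Measurable (s n))
    (m n : ℤ) : MeasurableSet {ω | (m, n) ∈ limitMatching E (c · ω) (s · ω)} :=
  measurableSet_eventually_nat fun K =>
    measurableSet_setOfPred.2 (measurable_mem_fcfs hc hs (-(K : ℤ)) m n)

end Measurability

end BipartiteFCFS

theorem mainTheorem1 {𝒞 𝒮 Ω : Type*} [Fintype 𝒞] [Fintype 𝒮]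
    [MeasurableSpace 𝒞] [MeasurableSingletonClass 𝒞]
    [MeasurableSpace 𝒮] [MeasurableSingletonClass 𝒮]
    [MeasurableSpace Ω] (P : Measure Ω) [IsProbabilityMeasure P]
    (E : 𝒞 → 𝒮 → Prop) (hE : (BipartiteFCFS.compatGraph E).Connected)
    (α : PMF 𝒞) (β : PMF 𝒮) (hα : ∀ i, α i ≠ 0) (hβ : ∀ j, β j ≠ 0)
    (hcrp : BipartiteFCFS.CompleteResourcePooling E α β)
    (c : ℤ → Ω → 𝒞) (s : ℤ → Ω → 𝒮)
    (hc : ∀ m, Measurable (c m)) (hs : ∀ n, Measurable (s n))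
    (hc_law : ∀ m, P.map (c m) = α.toMeasure) (hs_law : ∀ n, P.map (s n) = β.toMeasure)
    (hc_indep : iIndepFun c P) (hs_indep : iIndepFun s P)
    (hcs_indep : IndepFun (fun ω m => c m ω) (fun ω n => s n ω) P) :
    ∃ A : Ω → Set (ℤ × ℤ),
      (∀ m n, MeasurableSet {ω | (m, n) ∈ A ω}) ∧
      -- existence and uniqueness of the FCFS matching over `ℤ`
      (∀ᵐ ω ∂P,
        BipartiteFCFS.IsFCFSMatching E (c · ω) (s · ω) Set.univ Set.univ (A ω) ∧
        BipartiteFCFS.IsPerfect Set.univ (A ω) ∧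
        BipartiteFCFS.IsBalancedRecurrent (A ω) ∧
        ∀ A' : Set (ℤ × ℤ),
          BipartiteFCFS.IsFCFSMatching E (c · ω) (s · ω) Set.univ Set.univ A' →
          BipartiteFCFS.IsBalancedRecurrent A' → A' = A ω) ∧
      -- the scheme that starts empty at `-K`, with `K → ∞`
      (∀ᵐ ω ∂P,
        ∃ L : ℕ → Set (ℤ × ℤ),
          (∀ K : ℕ,
            BipartiteFCFS.IsFCFSMatching E (c · ω) (s · ω)
              (Set.Ioi (-(K : ℤ))) (Set.Ioi (-(K : ℤ))) (L K) ∧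
            BipartiteFCFS.IsPerfect (Set.Ioi (-(K : ℤ))) (L K) ∧
            ∀ L' : Set (ℤ × ℤ),
              BipartiteFCFS.IsFCFSMatching E (c · ω) (s · ω)
                (Set.Ioi (-(K : ℤ))) (Set.Ioi (-(K : ℤ))) L' → L' = L K) ∧
          ∀ N : ℤ, ∃ K₀ : ℕ, ∀ K ≥ K₀, ∀ m n : ℤ, N < m ∨ N < n →
            ((m, n) ∈ L K ↔ (m, n) ∈ A ω)) ∧
      -- the stationary version of the pair by pair Markov chain
      ∃ π : PMF (BipartiteFCFS.PairState E),
        BipartiteFCFS.IsStationaryLaw E α β π ∧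
        (∀ π' : PMF (BipartiteFCFS.PairState E),
          BipartiteFCFS.IsStationaryLaw E α β π' → π' = π) ∧
        (∃ O : ℤ → Ω → BipartiteFCFS.PairState E,
          BipartiteFCFS.IsStationaryVersion P E c s π O) ∧
        ∀ O : ℤ → Ω → BipartiteFCFS.PairState E,
          BipartiteFCFS.IsStationaryVersion P E c s π O →
          ∀ᵐ ω ∂P, ∀ N, BipartiteFCFS.IsStateAt (c · ω) (s · ω) (A ω) N (O N ω) := by
  open BipartiteFCFS in
  have h := isIIDPairs_of_indep hc hs hc_law hs_law hc_indep hs_indep hcs_indep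
  have hp := ae_couplesFromPast h hE hα hβ hcrp
  have hf := ae_couplesInFuture h hE hα hβ hcrp
  have hstate : ∀ᵐ ω ∂P, ∀ N, HasState (c · ω) (s · ω) Set.univ
      (limitMatching E (c · ω) (s · ω)) N (limitState E (fun k => (c k ω, s k ω)) N) := by
    filter_upwards [hp, hf] with ω hpω hfω N
    obtain ⟨n, h1, h2⟩ := ((eventually_hasState_limitMatching hpω hfω N).and
      (hpω.eventually_run_empty_eq N)).exists
    rw [← h2]
    exact h1
  refine ⟨fun ω => limitMatching E (c · ω) (s · ω), measurableSet_mem_limitMatching hc hs, ?_, ?_,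
    limitLaw P E _ h.measurable, isStationaryLaw_limitLaw h hp, fun π' hπ' => hπ'.eq_limitLaw h hp,
    ⟨fun N ω => limitState E (fun k => (c k ω, s k ω)) N, ?_⟩, fun O hO => ?_⟩
  · filter_upwards [hp, hf, hstate, ae_exists_frequently_size_le h hp] with ω hpω hfω hst hb
    refine ⟨isFCFSMatching_limitMatching hpω hfω, isPerfect_limitMatching hpω hfω, ?_,
      fun A' hA' hb' => hA'.eq_limitMatching hpω hb'⟩
    obtain ⟨B, hB⟩ := hb
    refine ⟨B, hB.mono fun N hN => ?_⟩
    obtain ⟨h1, h2⟩ := (hst N).encard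
    rw [h1, h2]
    exact ⟨rfl, by exact_mod_cast hN⟩
  · filter_upwards [hp, hf] with ω hpω hfω
    exact ⟨fun K => fcfs E (c · ω) (s · ω) (-(K : ℤ)), fun K =>
      ⟨isFCFSMatching_fcfs _, isPerfect_fcfs hfω _, fun L' hL' => hL'.eq_fcfs⟩,
      fun N => eventually_atTop.1 (eventually_mem_fcfs_iff hpω N)⟩
  · exact
      { measurable := fun N => measurable_limitState fun k _ => h.measurable k
        law := map_limitState h hp
        indep := indepFun_limitState h
        step := by
          filter_upwards [hp] with ω hω N
          exact hω.limitState_succ N }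
  · filter_upwards [hstate, ae_eq_limitState h hp hO.measurable hO.law hO.step] with ω hst hω N
    rw [hω N]
    exact (hst N).isStateAt
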